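/- Let $d\ge 1$ and let $\rho\neq 0$ be a finite Borel measure concentrated on the open interval $(0,2)$. Put $$b(\alpha)=\frac{\alpha\,\Gamma(\frac{\alpha}{2})\,\Gamma(\frac{d+\alpha}{2})\,\sin\frac{\alpha\pi}{2}}{2^{2-\alpha}\pi^{1+d/2}},\qquad \mathbb{D}_0^{\alpha}f(x)=b(\alpha)\int_{\mathbb{R}^d}\frac{f(x+y)-2f(x)+f(x-y)}{|y|^{d+\alpha}}\,dy,$$ $\Psi(\xi)=-\int_0^2|\xi|^{\alpha}\,d\rho(\alpha)$, and, for $h>0$ and $k\in\mathbb{Z}^d\setminus\{0\}$, $$Q_k(h)=2\int_0^2\frac{b(\alpha)}{h^{\alpha}|k|^{\alpha}}\,d\rho(\alpha).$$ Let $X^\rho_t\in\mathbb{SS}$ denote any $d$-dimensional semimartingale with $X_0^\rho=0$ and $\mathbb{E}\,e^{i\xi\cdot X^\rho_t}=e^{t\Psi(\xi)}$ for all $t\ge 0$, $\xi\in\mathbb{R}^d$. (i) Fix $t>0$ and put $\tau_N=t/N$. Let $h_N>0$ with $h_N\to0$ as $N\to\infty$, and assume that for every $N\ge1$ $$2\tau_N\sum_{m\ne0}\frac{Q_m(h_N)}{|m|^d}\le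 1 .$$ For each $N\ge 1$ let $X_1,X_2,\dots$ (depending on $N$) be i.i.d. random vectors in $h_N\mathbb{Z}^d$ with $\mathbb{P}(X_1=h_Nk)=p_k$, where $p_0=1-\tau_N\sum_{m\neq0}Q_m(h_N)/|m|^d$ and $p_k=\tau_NQ_k(h_N)/|k|^d$ for $k\ne0$. Then $S_N=X_1+\dots+X_N$ converges in law, as $N\to\infty$, to the law on $\mathbb{R}^d$ with density $G^\rho(t,\cdot)$ given in (ii), that is, to $X_t^\rho$. (ii) For $t>0$ the integral $$G^{\rho}(t,x)=\frac1{(2\pi)^d}\int_{\mathbb{R}^d}e^{t\Psi(\xi)-ix\cdot\xi}\,d\xi$$ converges absolutely, $G^\rho(t,\cdot)$ is a probability density with Fourier transform $\int e^{i\xi\cdot x}G^\rho(t,x)\,dx=\exp\left(-t\int_0^2|\xi|^\alpha d\rho(\alpha)\right)$, and it is the density of $X^\rho_t$. (iii) $G^\rho$ is the solution of $$\frac{\partial u(t,x)}{\partial t}=\int_0^2\mathbb{D}_0^{\alpha}u(t,x)\,d\rho(\alpha),\quad t>0,\ x\in\mathbb{R}^d,\qquad u(0,x)=\delta_0(x):$$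 it satisfies the equation pointwise and $G^\rho(t,x)\,dx\to\delta_0$ weakly as $t\downarrow0$, and it is the only such solution $u$ among the families $u(t,\cdot)$, $t>0$, of probability densities such that $u$ and $\partial_tu$ are continuous in $(t,x)$ and $u(t,\cdot)$ is twice continuously differentiable. -/

import Mathlib

open MeasureTheory ProbabilityTheory Filter Topology
open scoped NNReal ENNReal RealInnerProductSpace

namespace MixedStable

/-- `d`-dimensional Euclidean space. -/
abbrev Space (d : ℕ) : Type := EuclideanSpace ℝ (Fin d)

/-- The point of `ℝ^d` with integer coordinates `k`; its norm is the Euclidean norm `|k|`. -/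
noncomputable def latticePoint {d : ℕ} (k : Fin d → ℤ) : Space d :=
  WithLp.toLp 2 (fun i => (k i : ℝ))

/-- The normalizing constant
`b(α) = α Γ(α/2) Γ((d+α)/2) sin(απ/2) / (2^(2-α) π^(1+d/2))`. -/
noncomputable def normConst (d : ℕ) (α : ℝ) : ℝ :=
  α * Real.Gamma (α / 2) * Real.Gamma (((d : ℝ) + α) / 2) * Real.sin (α * Real.pi / 2) /
    ((2 : ℝ) ^ (2 - α) * Real.pi ^ (1 + (d : ℝ) / 2))

/-- The integrand `Δ_y² f(x) / |y|^(d+α)`, where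
`Δ_y² f(x) = f(x+y) - 2 f(x) + f(x-y)` is the centered second difference. -/
noncomputable def hypersingularIntegrand {d : ℕ} (α : ℝ) (f : Space d → ℝ) (x y : Space d) : ℝ :=
  (f (x + y) - 2 * f x + f (x - y)) / ‖y‖ ^ ((d : ℝ) + α)

/-- The hypersingular integral operator `𝔻_0^α f(x) = b(α) ∫ Δ_y² f(x) / |y|^(d+α) dy`. -/
noncomputable def hypersingular {d : ℕ} (α : ℝ) (f : Space d → ℝ) (x : Space d) : ℝ :=
  normConst d α * ∫ y, hypersingularIntegrand α f x y

/-- The symbol `Ψ(ξ) = -∫ |ξ|^α dρ(α)`. -/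
noncomputable def levySymbol {d : ℕ} (ρ : Measure ℝ) (ξ : Space d) : ℝ :=
  -∫ α, ‖ξ‖ ^ α ∂ρ

/-- The integrand `exp(t Ψ(ξ) - i x·ξ)`. -/
noncomputable def kernelIntegrand {d : ℕ} (ρ : Measure ℝ) (t : ℝ) (x ξ : Space d) : ℂ :=
  Complex.exp (((t * levySymbol ρ ξ : ℝ) : ℂ) - Complex.I * ((⟪x, ξ⟫ : ℝ) : ℂ))

/-- `(2π)^(-d) ∫ exp(t Ψ(ξ) - i x·ξ) dξ`, as a complex number. -/
noncomputable def kernelC {d : ℕ} (ρ : Measure ℝ) (t : ℝ) (x : Space d) : ℂ :=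
  (1 / ((2 * Real.pi) ^ d : ℝ) : ℂ) * ∫ ξ, kernelIntegrand ρ t x ξ

/-- The real function `G^ρ(t,x)`: the real part of `kernelC`. That `kernelC` is in fact real for
`t > 0` is part of the theorem. -/
noncomputable def kernelG {d : ℕ} (ρ : Measure ℝ) (t : ℝ) (x : Space d) : ℝ :=
  (kernelC ρ t x).re

/-- `u` is a solution of `∂u/∂t = ∫ 𝔻_0^α u dρ(α)` for `t > 0`, `x ∈ ℝ^d`, with `u(0,·) = δ_0`:
a classical solution (once continuously differentiable in time, twice in space), which is a
probability density at each time `t > 0` and tends weakly to the Dirac mass at `0` as `t ↓ 0`. -/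
structure IsSolution {d : ℕ} (ρ : Measure ℝ) (u : ℝ → Space d → ℝ) : Prop where
  continuousOn : ContinuousOn (fun p : ℝ × Space d => u p.1 p.2) (Set.Ioi 0 ×ˢ Set.univ)
  contDiff_space : ∀ t, 0 < t → ContDiff ℝ 2 (u t)
  continuousOn_deriv : ContinuousOn (fun p : ℝ × Space d => deriv (fun s => u s p.2) p.1)
    (Set.Ioi 0 ×ˢ Set.univ)
  nonneg : ∀ t, 0 < t → ∀ x, 0 ≤ u t x
  integrable : ∀ t, 0 < t → Integrable (u t)
  integral_eq_one : ∀ t, 0 < t → ∫ x, u t x = 1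
  integrable_hypersingularIntegrand : ∀ t, 0 < t → ∀ x, ∀ α ∈ Set.Ioo (0 : ℝ) 2,
    Integrable (hypersingularIntegrand α (u t) x)
  integrable_hypersingular : ∀ t, 0 < t → ∀ x, Integrable (fun α => hypersingular α (u t) x) ρ
  equation : ∀ t, 0 < t → ∀ x,
    HasDerivAt (fun s => u s x) (∫ α, hypersingular α (u t) x ∂ρ) t
  initial : ∀ φ : BoundedContinuousFunction (Space d) ℝ,
    Tendsto (fun t => ∫ x, φ x * u t x) (𝓝[>] 0) (𝓝 (φ 0))

/-- `Q_k(h) = 2 ∫ b(α) / (h^α |k|^α) dρ(α)`, used for `k ≠ 0`. -/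
noncomputable def Qk {d : ℕ} (ρ : Measure ℝ) (h : ℝ) (k : Fin d → ℤ) : ℝ :=
  2 * ∫ α, normConst d α / (h ^ α * ‖latticePoint k‖ ^ α) ∂ρ

/-- `Q(h) = ∑_{m ≠ 0} Q_m(h) / |m|^d`. -/
noncomputable def Qsum (d : ℕ) (ρ : Measure ℝ) (h : ℝ) : ℝ :=
  ∑' m : {m : Fin d → ℤ // m ≠ 0}, Qk ρ h m.1 / ‖latticePoint m.1‖ ^ d

open Classical in
/-- The step probabilities: `p_0 = 1 - τ Q(h)` and `p_k = τ Q_k(h) / |k|^d` for `k ≠ 0`. -/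
noncomputable def stepProb {d : ℕ} (ρ : Measure ℝ) (τ h : ℝ) (k : Fin d → ℤ) : ℝ :=
  if k = 0 then 1 - τ * Qsum d ρ h else τ * (Qk ρ h k / ‖latticePoint k‖ ^ d)

/-- `X 0, X 1, …` are i.i.d. random vectors in `h ℤ^d` that take the value `h k` with
probability `p_k`. -/
structure IsLatticeSteps {d : ℕ} {Ω : Type*} [MeasurableSpace Ω] (ρ : Measure ℝ) (τ h : ℝ)
    (P : Measure Ω) (X : ℕ → Ω → Space d) : Prop where
  indep : iIndepFun X P
  mem_lattice : ∀ j, ∀ᵐ ω ∂P, ∃ k : Fin d → ℤ, X j ω = h • latticePoint k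
  prob : ∀ j, ∀ k : Fin d → ℤ,
    P {ω | X j ω = h • latticePoint k} = ENNReal.ofReal (stepProb ρ τ h k)

/-- Right-continuity with left limits. -/
def IsCadlagPath {E : Type*} [TopologicalSpace E] (f : ℝ≥0 → E) : Prop :=
  ∀ t, ContinuousWithinAt f (Set.Ici t) t ∧ ∃ l, Tendsto f (𝓝[<] t) (𝓝 l)

/-- `Z` is a semimartingale: the sum of a càdlàg local martingale and a càdlàg adapted process
with paths of locally finite variation. -/
def IsSemimartingale {d : ℕ} {Ω : Type*} {mΩ : MeasurableSpace Ω} (𝓕 : Filtration ℝ≥0 mΩ)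
    (P : Measure Ω) (Z : ℝ≥0 → Ω → Space d) : Prop :=
  StronglyAdapted 𝓕 Z ∧
  ∃ M A : ℝ≥0 → Ω → Space d,
    (StronglyAdapted 𝓕 M ∧ (∀ᵐ ω ∂P, IsCadlagPath (fun t => M t ω)) ∧
      Locally (fun Y => Martingale Y 𝓕 P) 𝓕 M P) ∧
    (StronglyAdapted 𝓕 A ∧ (∀ᵐ ω ∂P, IsCadlagPath (fun t => A t ω)) ∧
      ∀ᵐ ω ∂P, LocallyBoundedVariationOn (fun t => A t ω) Set.univ) ∧
    ∀ᵐ ω ∂P, ∀ t, Z t ω = M t ω + A t ω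

/-- `Z = X^ρ` is the element of the class `𝕊𝕊` with mixing measure `ρ`: a semimartingale with
`Z_0 = 0` and `E exp(i ξ·Z_t) = exp(-t ∫ |ξ|^α dρ(α))`. -/
structure IsSS {d : ℕ} {Ω : Type*} {mΩ : MeasurableSpace Ω} (ρ : Measure ℝ)
    (𝓕 : Filtration ℝ≥0 mΩ) (P : Measure Ω) (Z : ℝ≥0 → Ω → Space d) : Prop where
  semimartingale : IsSemimartingale 𝓕 P Z
  zero : ∀ᵐ ω ∂P, Z 0 ω = 0
  charFun_eq : ∀ (t : ℝ≥0) (ξ : Space d),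
    ∫ ω, Complex.exp (Complex.I * ((⟪ξ, Z t ω⟫ : ℝ) : ℂ)) ∂P =
      Complex.exp ((-((t : ℝ) * ∫ α, ‖ξ‖ ^ α ∂ρ) : ℝ) : ℂ)

end MixedStable

namespace MixedStable

/-! ### The normalizing constant -/

/-! Write ψ(ξ) = ∫ |ξ|^α dρ(α). Everything rests on one identity: b(α) is the constant for which
b(α) ∫ 2(1 - cos ξ·y) / |y|^(d+α) dy = |ξ|^α (`lintegral_normConst_mul_one_sub_cos`). Averaging over
ρ gives a single density K(y) = ∫ b(α) |y|^(-d-α) dρ(α) with ∫ min(1,|y|²) K(y) dy finite and ∫ 2(1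
- cos ξ·y) K(y) dy = ψ(ξ). Hence ∫ 𝔻_0^α dρ(α) becomes integration of second differences against K,
a symmetric operator for which x ↦ cos(ξ·x + θ) is an eigenfunction with eigenvalue -ψ(ξ).

Kernel. Since ρ ≠ 0, ψ grows at least like a positive power of |ξ|, so e^{-tψ} beats every
polynomial (`integrable_pow_mul_exp`). This gives absolute convergence, smoothness, the time
derivative and, by Fubini, the equation. Positivity comes from approximation: cutting K off near 0
leaves a finite measure, whose compound Poisson exponential is a limit of characteristic functions.
Gaussian smoothing makes positivity of the inverse transform stable under these limits
(`isFourierPositive_exp_neg_mul_charExponent`). Fatou then gives integrability of the kernel,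
Fourier inversion gives its transform, and Lévy's continuity theorem gives the initial condition.

Uniqueness. For a solution u, moving the operator onto cos(ξ·x + θ) shows that e^{tψ(ξ)} ∫ u(t,x)
cos(ξ·x + θ) dx does not depend on t (`IsSolution.exp_mul_integral_cos_eq`). Cosines are not
compactly supported, so they are approximated by cutoffs with uniformly controlled differences. The
value as t ↓ 0 is cos θ, which fixes the Fourier transform of u(t,·).

Random walk. The weight Q_k(h)/|k|^d equals 2 h^d K(hk), so one step has characteristic function 1 -
τ A_h(ξ), with A_h(ξ) a Riemann sum for ∫ 2(1 - cos ξ·y) K(y) dy = ψ(ξ) (`charFun_map_step`,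
`tendsto_stepExponent`). With τ = t/N, its N-th power tends to e^{-tψ(ξ)}, and the continuity
theorem concludes. -/

lemma integrable_exp_neg_mul_sq_norm {d : ℕ} {s : ℝ} (hs : 0 < s) :
    Integrable (fun y : Space d => Real.exp (-s * ‖y‖ ^ 2)) := by
  have h := GaussianFourier.integrable_cexp_neg_mul_sq_norm_add (V := Space d) (b := (s : ℂ))
    (by simpa using hs) 0 0
  refine h.norm.congr (ae_of_all _ fun y => ?_)
  simp only [zero_mul, add_zero, Complex.norm_exp]
  congr 1
  norm_cast

lemma integral_exp_neg_mul_sq_norm_mul_cos {d : ℕ} {s : ℝ} (hs : 0 < s) (ξ : Space d) :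
    ∫ y : Space d, Real.exp (-s * ‖y‖ ^ 2) * Real.cos ⟪ξ, y⟫ =
      (Real.pi / s) ^ ((d : ℝ) / 2) * Real.exp (-‖ξ‖ ^ 2 / (4 * s)) := by
  have hs' : 0 < (s : ℂ).re := by simpa using hs
  have h := GaussianFourier.integral_cexp_neg_mul_sq_norm_add (V := Space d) (b := (s : ℂ))
    hs' Complex.I ξ
  have hi := GaussianFourier.integrable_cexp_neg_mul_sq_norm_add (V := Space d) (b := (s : ℂ))
    hs' Complex.I ξ
  have h2 := congrArg Complex.re h
  rw [← RCLike.re_eq_complex_re, ← integral_re hi] at h2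
  convert h2 using 1
  · refine integral_congr_ae (ae_of_all _ fun y => ?_)
    simp only [RCLike.re_eq_complex_re]
    rw [Complex.exp_re]
    have e1 : (-(s : ℂ) * (‖y‖ : ℂ) ^ 2 + Complex.I * ((⟪ξ, y⟫ : ℝ) : ℂ)).re = -s * ‖y‖ ^ 2 := by
      rw [show -(s : ℂ) * (‖y‖ : ℂ) ^ 2 = ((-s * ‖y‖ ^ 2 : ℝ) : ℂ) by push_cast; ring]
      simp only [Complex.add_re, Complex.ofReal_re, Complex.mul_re, Complex.I_re, Complex.I_im,
        Complex.ofReal_im]; ring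
    have e2 : (-(s : ℂ) * (‖y‖ : ℂ) ^ 2 + Complex.I * ((⟪ξ, y⟫ : ℝ) : ℂ)).im = ⟪ξ, y⟫ := by
      rw [show -(s : ℂ) * (‖y‖ : ℂ) ^ 2 = ((-s * ‖y‖ ^ 2 : ℝ) : ℂ) by push_cast; ring]
      simp only [Complex.add_im, Complex.ofReal_re, Complex.mul_im, Complex.I_re, Complex.I_im,
        Complex.ofReal_im]; ring
    rw [e1, e2]
  · have e : ((Real.pi : ℂ) / s) ^ (Module.finrank ℝ (Space d) / 2 : ℂ) *
        Complex.exp (Complex.I ^ 2 * ‖ξ‖ ^ 2 / (4 * s)) =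
        (((Real.pi / s) ^ ((d : ℝ) / 2) * Real.exp (-‖ξ‖ ^ 2 / (4 * s)) : ℝ) : ℂ) := by
      rw [Complex.ofReal_mul, Complex.ofReal_cpow (by positivity)]
      push_cast
      simp
    rw [e]
    exact (Complex.ofReal_re _).symm

lemma integral_exp_neg_mul_sq_norm {d : ℕ} {s : ℝ} (hs : 0 < s) :
    ∫ y : Space d, Real.exp (-s * ‖y‖ ^ 2) = (Real.pi / s) ^ ((d : ℝ) / 2) := by
  simpa using integral_exp_neg_mul_sq_norm_mul_cos hs (0 : Space d)

lemma lintegral_one_sub_cos_mul_exp {d : ℕ} {s : ℝ} (hs : 0 < s) (ξ : Space d) :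
    ∫⁻ y : Space d, ENNReal.ofReal ((1 - Real.cos ⟪ξ, y⟫) * Real.exp (-s * ‖y‖ ^ 2)) =
      ENNReal.ofReal ((Real.pi / s) ^ ((d : ℝ) / 2) * (1 - Real.exp (-‖ξ‖ ^ 2 / (4 * s)))) := by
  have hi := integrable_exp_neg_mul_sq_norm (d := d) hs
  have hc : Integrable (fun y : Space d => Real.exp (-s * ‖y‖ ^ 2) * Real.cos ⟪ξ, y⟫) := by
    refine hi.mono (by fun_prop) (ae_of_all _ fun y => ?_)
    rw [norm_mul]
    exact mul_le_of_le_one_right (norm_nonneg _) (Real.abs_cos_le_one _)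
  rw [← ofReal_integral_eq_lintegral_ofReal]
  · congr 1
    rw [mul_sub, mul_one, ← integral_exp_neg_mul_sq_norm_mul_cos hs, ← integral_exp_neg_mul_sq_norm
      hs, ← integral_sub hi hc]
    congr 1; ext y; ring
  · refine (hi.sub hc).congr (ae_of_all _ fun y => ?_)
    simp only [Pi.sub_apply]; ring
  · exact ae_of_all _ fun y => mul_nonneg (sub_nonneg.2 (Real.cos_le_one _)) (Real.exp_pos _).le

lemma lintegral_rpow_mul_exp {p r : ℝ} (hp : 0 < p) (hr : 0 < r) :
    ∫⁻ s in Set.Ioi (0 : ℝ), ENNReal.ofReal (s ^ (p - 1) * Real.exp (-(r * s))) =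
      ENNReal.ofReal ((1 / r) ^ p * Real.Gamma p) := by
  have h := Real.integral_rpow_mul_exp_neg_mul_Ioi hp hr
  rw [← h, ofReal_integral_eq_lintegral_ofReal]
  · refine Integrable.of_integral_ne_zero ?_
    rw [h]
    have := Real.Gamma_pos_of_pos hp
    positivity
  · filter_upwards [ae_restrict_mem measurableSet_Ioi] with s hs
    have : (0 : ℝ) < s := hs
    simp only [Pi.zero_apply]; positivity

lemma lintegral_exp_neg_Ioo {c : ℝ} (hc : 0 ≤ c) :
    ∫⁻ v in Set.Ioo 0 c, ENNReal.ofReal (Real.exp (-v)) = ENNReal.ofReal (1 - Real.exp (-c)) := by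
  rw [setLIntegral_congr Ioo_ae_eq_Ioc, ← ofReal_integral_eq_lintegral_ofReal,
    ← intervalIntegral.integral_of_le hc]
  · congr 1
    rw [intervalIntegral.integral_comp_neg (fun x => Real.exp x), integral_exp]
    simp
  · exact (by fun_prop : Continuous fun v : ℝ => Real.exp (-v)).integrableOn_Ioc
  · exact ae_of_all _ fun v => (Real.exp_pos _).le

lemma lintegral_rpow_Ioo {β c : ℝ} (hβ : 0 < β) (hc : 0 ≤ c) :
    ∫⁻ s in Set.Ioo 0 c, ENNReal.ofReal (s ^ (β - 1)) = ENNReal.ofReal (c ^ β / β) := by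
  rw [setLIntegral_congr Ioo_ae_eq_Ioc, ← ofReal_integral_eq_lintegral_ofReal,
    ← intervalIntegral.integral_of_le hc]
  · congr 1
    rw [integral_rpow (Or.inl (by linarith))]
    simp [Real.zero_rpow hβ.ne']
  · rw [← IntegrableOn, ← intervalIntegrable_iff_integrableOn_Ioc_of_le hc]
    exact intervalIntegral.intervalIntegrable_rpow' (by linarith)
  · filter_upwards [ae_restrict_mem measurableSet_Ioc] with s hs
    exact Real.rpow_nonneg hs.1.le _

/-- Expand 1 - e^{-c/s} as the integral of e^{-v} over 0 < v < c/s and apply Tonelli on the region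
sv < c. The s-integral gives (c/v)^β / β, leaving the Gamma integral Γ(1-β), which converges at 0
because β < 1. -/
lemma lintegral_rpow_mul_one_sub_exp {β c : ℝ} (hβ : 0 < β) (hβ1 : β < 1) (hc : 0 ≤ c) :
    ∫⁻ s in Set.Ioi (0 : ℝ), ENNReal.ofReal (s ^ (β - 1) * (1 - Real.exp (-(c / s)))) =
      ENNReal.ofReal (c ^ β * Real.Gamma (1 - β) / β) := by
  have h1 : ∀ s ∈ Set.Ioi (0 : ℝ),
      ENNReal.ofReal (s ^ (β - 1) * (1 - Real.exp (-(c / s)))) =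
      ∫⁻ v in Set.Ioi (0 : ℝ), {p : ℝ × ℝ | p.1 * p.2 < c}.indicator
        (fun p => ENNReal.ofReal (p.1 ^ (β - 1)) * ENNReal.ofReal (Real.exp (-p.2))) (s, v) := by
    intro s hs
    have hs : 0 < s := hs
    rw [ENNReal.ofReal_mul (Real.rpow_nonneg hs.le _), ← lintegral_exp_neg_Ioo (by positivity),
      ← lintegral_const_mul _ (by fun_prop), ← lintegral_indicator measurableSet_Ioo,
      ← lintegral_indicator measurableSet_Ioi]
    congr 1; ext v
    simp only [Set.indicator_apply, Set.mem_Ioo, Set.mem_Ioi, Set.mem_ofPred_eq]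
    by_cases hv : 0 < v
    · simp only [hv, true_and, if_true, lt_div_iff₀ hs, mul_comm v s]
    · simp [hv]
  have hm : Measurable ({p : ℝ × ℝ | p.1 * p.2 < c}.indicator
        (fun p => ENNReal.ofReal (p.1 ^ (β - 1)) * ENNReal.ofReal (Real.exp (-p.2)))) := by
    refine Measurable.indicator (by fun_prop) ?_
    exact measurableSet_lt (by fun_prop) (by fun_prop)
  rw [setLIntegral_congr_fun measurableSet_Ioi h1]
  refine (lintegral_lintegral_swap (f := fun s v => {p : ℝ × ℝ | p.1 * p.2 < c}.indicator
    (fun p => ENNReal.ofReal (p.1 ^ (β - 1)) * ENNReal.ofReal (Real.exp (-p.2))) (s, v))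
    hm.aemeasurable).trans ?_
  have h2 : ∀ v ∈ Set.Ioi (0 : ℝ),
      ∫⁻ s in Set.Ioi (0 : ℝ), {p : ℝ × ℝ | p.1 * p.2 < c}.indicator
        (fun p => ENNReal.ofReal (p.1 ^ (β - 1)) * ENNReal.ofReal (Real.exp (-p.2))) (s, v) =
      ENNReal.ofReal (c ^ β / β) *
        ENNReal.ofReal (v ^ ((1 - β) - 1) * Real.exp (-(1 * v))) := by
    intro v hv
    have hv : 0 < v := hv
    have : ENNReal.ofReal (c ^ β / β) *
        ENNReal.ofReal (v ^ ((1 - β) - 1) * Real.exp (-(1 * v))) =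
        ENNReal.ofReal ((c / v) ^ β / β) * ENNReal.ofReal (Real.exp (-v)) := by
      rw [← ENNReal.ofReal_mul (by positivity), ← ENNReal.ofReal_mul (by positivity)]
      congr 1
      rw [Real.div_rpow hc hv.le, show 1 - β - 1 = -β by ring, Real.rpow_neg hv.le, one_mul]
      ring
    rw [this, ← lintegral_rpow_Ioo hβ (by positivity), ← lintegral_mul_const _ (by fun_prop),
      ← lintegral_indicator measurableSet_Ioo, ← lintegral_indicator measurableSet_Ioi]
    congr 1; ext s
    simp only [Set.indicator_apply, Set.mem_Ioo, Set.mem_Ioi, Set.mem_ofPred_eq]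
    by_cases hs : 0 < s
    · simp only [hs, true_and, if_true, lt_div_iff₀ hv]
    · simp [hs]
  rw [setLIntegral_congr_fun measurableSet_Ioi h2, lintegral_const_mul _ (by fun_prop),
    lintegral_rpow_mul_exp (by linarith) one_pos, ← ENNReal.ofReal_mul (by positivity)]
  congr 1
  simp
  ring

/-- Subordination: with p = (d+α)/2, Γ(p) |y|^(-2p) = ∫ s^(p-1) e^{-s|y|²} ds writes the power as a
mixture of Gaussians, against which 1 - cos integrates explicitly. The remaining s-integral is
`lintegral_rpow_mul_one_sub_exp` with β = α/2 and c = |ξ|²/4. -/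
lemma lintegral_one_sub_cos_div_norm_rpow {d : ℕ} {α : ℝ} (hα : α ∈ Set.Ioo (0 : ℝ) 2)
    (ξ : Space d) :
    ENNReal.ofReal (Real.Gamma ((d + α) / 2)) *
      ∫⁻ y : Space d, ENNReal.ofReal ((1 - Real.cos ⟪ξ, y⟫) / ‖y‖ ^ ((d : ℝ) + α)) =
    ENNReal.ofReal (Real.pi ^ ((d : ℝ) / 2) *
      ((‖ξ‖ ^ 2 / 4) ^ (α / 2) * Real.Gamma (1 - α / 2) / (α / 2))) := by
  obtain ⟨h0, h2⟩ := hα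
  set p : ℝ := (d + α) / 2 with hp
  have hp0 : 0 < p := by positivity
  have hm : Measurable (fun q : Space d × ℝ =>
      ENNReal.ofReal (1 - Real.cos ⟪ξ, q.1⟫) *
        ENNReal.ofReal (q.2 ^ (p - 1) * Real.exp (-(‖q.1‖ ^ 2 * q.2)))) := by fun_prop
  have h1 : ∀ y : Space d, ENNReal.ofReal (Real.Gamma p) *
      ENNReal.ofReal ((1 - Real.cos ⟪ξ, y⟫) / ‖y‖ ^ ((d : ℝ) + α)) =
      ∫⁻ s in Set.Ioi (0 : ℝ), ENNReal.ofReal (1 - Real.cos ⟪ξ, y⟫) *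
        ENNReal.ofReal (s ^ (p - 1) * Real.exp (-(‖y‖ ^ 2 * s))) := by
    intro y
    rw [lintegral_const_mul _ (by fun_prop)]
    -- At the origin both sides vanish, because 1 - cos 0 = 0.
    by_cases hy : y = 0
    · simp [hy]
    have hy : 0 < ‖y‖ := norm_pos_iff.2 hy
    rw [lintegral_rpow_mul_exp hp0 (by positivity), ← ENNReal.ofReal_mul
      (Real.Gamma_pos_of_pos hp0).le, ← ENNReal.ofReal_mul (sub_nonneg.2 (Real.cos_le_one _))]
    congr 1
    rw [Real.div_rpow zero_le_one (by positivity), Real.one_rpow, ← Real.rpow_natCast,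
      ← Real.rpow_mul hy.le, show ((2 : ℕ) : ℝ) * p = d + α by rw [hp]; push_cast; ring]
    ring
  rw [← lintegral_const_mul _ (by fun_prop), lintegral_congr h1,
    lintegral_lintegral_swap hm.aemeasurable]
  have h3 : ∀ s ∈ Set.Ioi (0 : ℝ),
      ∫⁻ y : Space d, ENNReal.ofReal (1 - Real.cos ⟪ξ, y⟫) *
        ENNReal.ofReal (s ^ (p - 1) * Real.exp (-(‖y‖ ^ 2 * s))) =
      ENNReal.ofReal (Real.pi ^ ((d : ℝ) / 2)) *
        ENNReal.ofReal (s ^ (α / 2 - 1) * (1 - Real.exp (-((‖ξ‖ ^ 2 / 4) / s)))) := by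
    intro s hs
    have hs : 0 < s := hs
    have : ∀ y : Space d, ENNReal.ofReal (1 - Real.cos ⟪ξ, y⟫) *
        ENNReal.ofReal (s ^ (p - 1) * Real.exp (-(‖y‖ ^ 2 * s))) =
        ENNReal.ofReal (s ^ (p - 1)) *
          ENNReal.ofReal ((1 - Real.cos ⟪ξ, y⟫) * Real.exp (-s * ‖y‖ ^ 2)) := by
      intro y
      have := Real.cos_le_one ⟪ξ, y⟫
      rw [← ENNReal.ofReal_mul (by linarith), ← ENNReal.ofReal_mul (by positivity)]
      congr 1
      rw [show -(‖y‖ ^ 2 * s) = -s * ‖y‖ ^ 2 by ring]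
      ring
    rw [lintegral_congr this, lintegral_const_mul _ (by fun_prop),
      lintegral_one_sub_cos_mul_exp hs, ← ENNReal.ofReal_mul (by positivity),
      ← ENNReal.ofReal_mul (by positivity)]
    congr 1
    rw [Real.div_rpow Real.pi_pos.le hs.le, show p - 1 = (α / 2 - 1) + d / 2 by rw [hp]; ring,
      Real.rpow_add hs, show -‖ξ‖ ^ 2 / (4 * s) = -((‖ξ‖ ^ 2 / 4) / s) by field_simp]
    have : 0 < s ^ ((d : ℝ) / 2) := by positivity
    field_simp
  rw [setLIntegral_congr_fun measurableSet_Ioi h3, lintegral_const_mul _ (by fun_prop),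
    lintegral_rpow_mul_one_sub_exp (by linarith) (by linarith) (by positivity),
    ← ENNReal.ofReal_mul (by positivity)]

lemma normConst_pos {d : ℕ} {α : ℝ} (hα : α ∈ Set.Ioo (0 : ℝ) 2) : 0 < normConst d α := by
  obtain ⟨h0, h2⟩ := hα
  have := Real.Gamma_pos_of_pos (s := α / 2) (by positivity)
  have := Real.Gamma_pos_of_pos (s := (d + α) / 2) (by positivity)
  have := Real.sin_pos_of_pos_of_lt_pi (x := α * Real.pi / 2) (by positivity)
    (by nlinarith [Real.pi_pos])
  unfold normConst
  positivity

/-- The reflection formula replaces Γ(1 - α/2) by π / (sin(πα/2) Γ(α/2)), after which every factor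
of b(α) cancels. -/
lemma lintegral_normConst_mul_one_sub_cos {d : ℕ} {α : ℝ} (hα : α ∈ Set.Ioo (0 : ℝ) 2)
    (ξ : Space d) :
    ∫⁻ y : Space d, ENNReal.ofReal
      (normConst d α * (2 * (1 - Real.cos ⟪ξ, y⟫)) / ‖y‖ ^ ((d : ℝ) + α)) =
    ENNReal.ofReal (‖ξ‖ ^ α) := by
  have h := lintegral_one_sub_cos_div_norm_rpow hα ξ
  have hb := normConst_pos (d := d) hα
  obtain ⟨h0, h2⟩ := hα
  have g1 := Real.Gamma_pos_of_pos (s := α / 2) (by positivity)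
  have g2 := Real.Gamma_pos_of_pos (s := (d + α) / 2) (by positivity)
  have g3 := Real.Gamma_pos_of_pos (s := 1 - α / 2) (by linarith)
  have g4 := Real.sin_pos_of_pos_of_lt_pi (x := α * Real.pi / 2) (by positivity)
    (by nlinarith [Real.pi_pos])
  have hrefl := Real.Gamma_mul_Gamma_one_sub (α / 2)
  rw [show Real.pi * (α / 2) = α * Real.pi / 2 by ring] at hrefl
  have e : ∀ y : Space d, ENNReal.ofReal
      (normConst d α * (2 * (1 - Real.cos ⟪ξ, y⟫)) / ‖y‖ ^ ((d : ℝ) + α)) =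
      ENNReal.ofReal (2 * normConst d α / Real.Gamma ((d + α) / 2)) *
       (ENNReal.ofReal (Real.Gamma ((d + α) / 2)) *
        ENNReal.ofReal ((1 - Real.cos ⟪ξ, y⟫) / ‖y‖ ^ ((d : ℝ) + α))) := by
    intro y
    rw [← ENNReal.ofReal_mul g2.le, ← ENNReal.ofReal_mul (by positivity)]
    congr 1
    field_simp
  rw [lintegral_congr e, lintegral_const_mul _ (by fun_prop), lintegral_const_mul _ (by fun_prop),
    h, ← ENNReal.ofReal_mul (by positivity)]
  congr 1
  have e1 : (‖ξ‖ ^ 2 / 4) ^ (α / 2) = ‖ξ‖ ^ α / 2 ^ α := by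
    rw [show ‖ξ‖ ^ 2 / 4 = (‖ξ‖ / 2) ^ 2 by ring, ← Real.rpow_natCast, ← Real.rpow_mul
      (by positivity), ← Real.div_rpow (by positivity) (by positivity)]
    congr 1; push_cast; ring
  have e2 : (2 : ℝ) ^ (2 - α) = 4 / 2 ^ α := by
    rw [Real.rpow_sub two_pos]; norm_num
  have e3 : Real.pi ^ (1 + (d : ℝ) / 2) = Real.pi * Real.pi ^ ((d : ℝ) / 2) := by
    rw [Real.rpow_add Real.pi_pos, Real.rpow_one]
  have e4 : Real.Gamma (1 - α / 2) =
      Real.pi / Real.sin (α * Real.pi / 2) / Real.Gamma (α / 2) := by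
    rw [← hrefl]; field_simp
  rw [normConst, e1, e2, e3, e4]
  have := Real.pi_pos
  field_simp
  ring


/-! ### The Lévy density -/

lemma ae_mem_Ioo {ρ : Measure ℝ} (hρ : ρ (Set.Ioo (0 : ℝ) 2)ᶜ = 0) :
    ∀ᵐ α ∂ρ, α ∈ Set.Ioo (0 : ℝ) 2 := by
  rw [ae_iff]; exact hρ

lemma continuousAt_gamma {x : ℝ} (hx : 0 < x) : ContinuousAt Real.Gamma x := by
  refine (Real.differentiableAt_Gamma fun m => ?_).continuousAt
  have : (0 : ℝ) ≤ m := m.cast_nonneg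
  linarith

lemma continuousOn_normConst (d : ℕ) : ContinuousOn (normConst d) (Set.Ioo (0 : ℝ) 2) := by
  intro α hα
  have h0 : 0 < α := hα.1
  have g1 : ContinuousAt Real.Gamma (α / 2) :=
    continuousAt_gamma (by positivity)
  have g2 : ContinuousAt Real.Gamma (((d : ℝ) + α) / 2) :=
    continuousAt_gamma (by positivity)
  have g1' : ContinuousAt (fun α : ℝ => Real.Gamma (α / 2)) α :=
    ContinuousAt.comp (f := fun α : ℝ => α / 2) g1 (by fun_prop)
  have g2' : ContinuousAt (fun α : ℝ => Real.Gamma (((d : ℝ) + α) / 2)) α :=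
    ContinuousAt.comp (f := fun α : ℝ => ((d : ℝ) + α) / 2) g2 (by fun_prop)
  have g3 : ContinuousAt (fun α : ℝ => (2 : ℝ) ^ (2 - α)) α :=
    (Real.continuous_const_rpow two_ne_zero).continuousAt.comp (by fun_prop)
  refine ContinuousAt.continuousWithinAt ?_
  unfold normConst
  refine ContinuousAt.div (by fun_prop) (by fun_prop) ?_
  positivity

lemma aestronglyMeasurable_normConst {ρ : Measure ℝ} (hρ : ρ (Set.Ioo (0 : ℝ) 2)ᶜ = 0) (d : ℕ) :
    AEStronglyMeasurable (normConst d) ρ := by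
  have h : ρ.restrict (Set.Ioo 0 2) = ρ := Measure.restrict_eq_self_of_ae_mem (ae_mem_Ioo hρ)
  rw [← h]
  exact (continuousOn_normConst d).aestronglyMeasurable measurableSet_Ioo

/-- The relation α Γ(α/2) = 2 Γ(α/2 + 1) removes the pole at α = 0, and d ≥ 1 keeps Γ((d+α)/2) away
from its own. The numerator is thus dominated by a function continuous on [0,2], while both factors
of the denominator are at least 1. -/
lemma exists_normConst_le {d : ℕ} (hd : 1 ≤ d) :
    ∃ B : ℝ, 0 < B ∧ ∀ α ∈ Set.Ioo (0 : ℝ) 2, normConst d α ≤ B := by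
  have hd' : (1 : ℝ) ≤ d := by exact_mod_cast hd
  have hc : ContinuousOn (fun α : ℝ => 2 * Real.Gamma (α / 2 + 1) * Real.Gamma ((d + α) / 2))
      (Set.Icc (0 : ℝ) 2) := by
    intro α hα
    have h0 : 0 ≤ α := hα.1
    have g1 : ContinuousAt Real.Gamma (α / 2 + 1) :=
      continuousAt_gamma (by positivity)
    have g2 : ContinuousAt Real.Gamma (((d : ℝ) + α) / 2) :=
      continuousAt_gamma (by positivity)
    have g1' : ContinuousAt (fun α : ℝ => Real.Gamma (α / 2 + 1)) α :=
      ContinuousAt.comp (f := fun α : ℝ => α / 2 + 1) g1 (by fun_prop)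
    have g2' : ContinuousAt (fun α : ℝ => Real.Gamma (((d : ℝ) + α) / 2)) α :=
      ContinuousAt.comp (f := fun α : ℝ => ((d : ℝ) + α) / 2) g2 (by fun_prop)
    exact ((continuousAt_const.mul g1').mul g2').continuousWithinAt
  obtain ⟨B, hB⟩ := isCompact_Icc.exists_bound_of_continuousOn hc
  refine ⟨B + 1, ?_, fun α hα => ?_⟩
  · have := hB 0 (by simp)
    linarith [norm_nonneg (2 * Real.Gamma ((0 : ℝ) / 2 + 1) * Real.Gamma ((d + 0) / 2))]
  have h0 : 0 < α := hα.1
  have h2 : α < 2 := hα.2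
  have := hB α ⟨hα.1.le, hα.2.le⟩
  have h3 := (le_abs_self _).trans this
  rw [Real.Gamma_add_one (by positivity)] at h3
  have g1 := Real.Gamma_pos_of_pos (s := α / 2) (by positivity)
  have g2 := Real.Gamma_pos_of_pos (s := (d + α) / 2) (by positivity)
  have hp : (1 : ℝ) ≤ 2 ^ (2 - α) := Real.one_le_rpow (by norm_num) (by linarith)
  have hq : (1 : ℝ) ≤ Real.pi ^ (1 + (d : ℝ) / 2) :=
    Real.one_le_rpow (by linarith [Real.two_le_pi]) (by positivity)
  unfold normConst
  rw [div_le_iff₀ (by positivity)]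
  have hX : 0 ≤ α * Real.Gamma (α / 2) * Real.Gamma ((d + α) / 2) := by positivity
  have e1 : α * Real.Gamma (α / 2) * Real.Gamma ((d + α) / 2) * Real.sin (α * Real.pi / 2) ≤
      α * Real.Gamma (α / 2) * Real.Gamma ((d + α) / 2) :=
    mul_le_of_le_one_right hX (Real.sin_le_one _)
  have e2 : α * Real.Gamma (α / 2) * Real.Gamma ((d + α) / 2) ≤ B + 1 := by
    refine le_trans (le_of_eq ?_) (h3.trans (by linarith)); ring
  exact e1.trans (e2.trans (le_mul_of_one_le_right (hX.trans e2) (one_le_mul_of_one_le_of_one_le hp hq)))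

/-- The Lévy density `K(y) = ∫ b(α) |y|^(-d-α) dρ(α)`. -/
noncomputable def levyDensity {d : ℕ} (ρ : Measure ℝ) (y : Space d) : ℝ :=
  ∫ α, normConst d α / ‖y‖ ^ ((d : ℝ) + α) ∂ρ

/-- `min(1, |y|²)`. -/
noncomputable def truncSq {d : ℕ} (y : Space d) : ℝ := min 1 (‖y‖ ^ 2)

lemma truncSq_nonneg {d : ℕ} (y : Space d) : 0 ≤ truncSq y := by unfold truncSq; positivity

lemma continuous_truncSq {d : ℕ} : Continuous (truncSq (d := d)) := by unfold truncSq; fun_prop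

lemma truncSq_le_two_mul {d : ℕ} (y : Space d) : truncSq y ≤ 2 * (1 - Real.exp (-‖y‖ ^ 2)) := by
  set r := ‖y‖ ^ 2 with hr
  have hr0 : 0 ≤ r := by positivity
  have h1 : Real.exp (-r) ≤ 1 / (1 + r) := by
    rw [Real.exp_neg, ← one_div]
    exact one_div_le_one_div_of_le (by positivity) (by linarith [Real.add_one_le_exp r])
  have h2 : truncSq y ≤ 2 * (1 - 1 / (1 + r)) := by
    have e : 2 * (1 - 1 / (1 + r)) = 2 * r / (1 + r) := by field_simp; ring
    rw [e, le_div_iff₀ (by positivity)]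
    unfold truncSq
    rw [← hr]
    rcases le_total 1 r with h | h
    · rw [min_eq_left h]; linarith
    · rw [min_eq_right h]; nlinarith
  linarith

lemma one_sub_cos_le_truncSq {d : ℕ} (ξ y : Space d) :
    1 - Real.cos ⟪ξ, y⟫ ≤ (2 + ‖ξ‖ ^ 2) * truncSq y := by
  have h1 := Real.neg_one_le_cos ⟪ξ, y⟫
  have h2 := Real.one_sub_sq_div_two_le_cos (x := ⟪ξ, y⟫)
  have h3 : ⟪ξ, y⟫ ^ 2 ≤ ‖ξ‖ ^ 2 * ‖y‖ ^ 2 := by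
    rw [← mul_pow]
    exact sq_le_sq' (by linarith [neg_le_of_abs_le (abs_real_inner_le_norm ξ y)])
      (le_of_abs_le (abs_real_inner_le_norm ξ y))
  unfold truncSq
  rcases le_total 1 (‖y‖ ^ 2) with h | h
  · rw [min_eq_left h]; nlinarith [sq_nonneg ‖ξ‖]
  · rw [min_eq_right h]; nlinarith [sq_nonneg ‖ξ‖, sq_nonneg ‖y‖]

lemma rpow_le_one_add_sq {r α : ℝ} (hr : 0 ≤ r) (hα : α ∈ Set.Ioo (0 : ℝ) 2) :
    r ^ α ≤ 1 + r ^ 2 := by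
  rcases le_total r 1 with h | h
  · have := Real.rpow_le_one hr h hα.1.le
    nlinarith [sq_nonneg r]
  · have := Real.rpow_le_rpow_of_exponent_le h hα.2.le
    rw [Real.rpow_two] at this
    linarith

lemma integrable_one_add_sq_mul_exp {d : ℕ} :
    Integrable (fun ξ : Space d => (1 + ‖ξ‖ ^ 2) * Real.exp (-(1 / 4) * ‖ξ‖ ^ 2)) := by
  have h := (integrable_exp_neg_mul_sq_norm (d := d) (s := 1 / 8) (by norm_num)).const_mul 8
  refine h.mono' (by fun_prop) (ae_of_all _ fun ξ => ?_)
  rw [Real.norm_of_nonneg (by positivity)]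
  have e : Real.exp (-(1 / 4) * ‖ξ‖ ^ 2) =
      Real.exp (-(1 / 8) * ‖ξ‖ ^ 2) * Real.exp (-(1 / 8) * ‖ξ‖ ^ 2) := by
    rw [← Real.exp_add]; congr 1; ring
  have h1 := Real.add_one_le_exp (1 / 8 * ‖ξ‖ ^ 2)
  have h2 : Real.exp (1 / 8 * ‖ξ‖ ^ 2) * Real.exp (-(1 / 8) * ‖ξ‖ ^ 2) = 1 := by
    rw [← Real.exp_add]; simp
  have h3 := Real.exp_pos (-(1 / 8) * ‖ξ‖ ^ 2)
  rw [e, ← mul_assoc]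
  refine mul_le_mul_of_nonneg_right ?_ h3.le
  calc (1 + ‖ξ‖ ^ 2) * Real.exp (-(1 / 8) * ‖ξ‖ ^ 2)
      ≤ (8 * Real.exp (1 / 8 * ‖ξ‖ ^ 2)) * Real.exp (-(1 / 8) * ‖ξ‖ ^ 2) := by
        refine mul_le_mul_of_nonneg_right ?_ h3.le
        linarith
    _ = 8 := by rw [mul_assoc, h2, mul_one]

/-- Integrate the identity for |ξ|^α against e^{-|ξ|²/4} in ξ. On the left 1 - cos(ξ·y) becomes a
multiple of 1 - e^{-|y|²}, which dominates `truncSq` up to a factor. On the right |ξ|^α ≤ 1 + |ξ|²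
gives a bound independent of α, which is what allows integration over ρ without any assumption on
its behaviour near 0 and 2. -/
lemma exists_lintegral_truncSq_le (d : ℕ) :
    ∃ C : ℝ, ∀ α ∈ Set.Ioo (0 : ℝ) 2, ∫⁻ y : Space d, ENNReal.ofReal
      (normConst d α * truncSq y / ‖y‖ ^ ((d : ℝ) + α)) ≤ ENNReal.ofReal C := by
  refine ⟨∫ ξ : Space d, (1 + ‖ξ‖ ^ 2) * Real.exp (-(1 / 4) * ‖ξ‖ ^ 2), fun α hα => ?_⟩
  have hb := normConst_pos (d := d) hα
  have hm : Measurable (fun q : Space d × Space d =>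
      ENNReal.ofReal (normConst d α * (2 * (1 - Real.cos ⟪q.2, q.1⟫)) / ‖q.1‖ ^ ((d : ℝ) + α)) *
        ENNReal.ofReal (Real.exp (-(1 / 4) * ‖q.2‖ ^ 2))) := by fun_prop
  have h1 : ∀ y : Space d, ENNReal.ofReal (normConst d α * truncSq y / ‖y‖ ^ ((d : ℝ) + α)) ≤
      ∫⁻ ξ : Space d, ENNReal.ofReal
          (normConst d α * (2 * (1 - Real.cos ⟪ξ, y⟫)) / ‖y‖ ^ ((d : ℝ) + α)) *
        ENNReal.ofReal (Real.exp (-(1 / 4) * ‖ξ‖ ^ 2)) := by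
    intro y
    have e : ∀ ξ : Space d, ENNReal.ofReal
          (normConst d α * (2 * (1 - Real.cos ⟪ξ, y⟫)) / ‖y‖ ^ ((d : ℝ) + α)) *
        ENNReal.ofReal (Real.exp (-(1 / 4) * ‖ξ‖ ^ 2)) =
        ENNReal.ofReal (2 * normConst d α / ‖y‖ ^ ((d : ℝ) + α)) *
          ENNReal.ofReal ((1 - Real.cos ⟪y, ξ⟫) * Real.exp (-(1 / 4) * ‖ξ‖ ^ 2)) := by
      intro ξ
      have := Real.cos_le_one ⟪ξ, y⟫
      rw [← ENNReal.ofReal_mul (by have : 0 ≤ 1 - Real.cos ⟪ξ, y⟫ := by linarith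
                                   positivity), ← ENNReal.ofReal_mul (by positivity),
        real_inner_comm y ξ]
      congr 1; ring
    rw [lintegral_congr e, lintegral_const_mul _ (by fun_prop),
      lintegral_one_sub_cos_mul_exp (by norm_num), ← ENNReal.ofReal_mul (by positivity)]
    refine ENNReal.ofReal_le_ofReal ?_
    have h := truncSq_le_two_mul y
    -- The Gaussian normalisation (4π)^(d/2) is at least 1 and is simply discarded.
    have hp : (1 : ℝ) ≤ (Real.pi / (1 / 4)) ^ ((d : ℝ) / 2) :=
      Real.one_le_rpow (by linarith [Real.two_le_pi]) (by positivity)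
    rw [show -‖y‖ ^ 2 / (4 * (1 / 4)) = -‖y‖ ^ 2 by ring]
    have h0 : 0 ≤ 1 - Real.exp (-‖y‖ ^ 2) := by linarith [truncSq_nonneg y]
    calc normConst d α * truncSq y / ‖y‖ ^ ((d : ℝ) + α)
        ≤ normConst d α * (2 * (1 - Real.exp (-‖y‖ ^ 2))) / ‖y‖ ^ ((d : ℝ) + α) := by gcongr
      _ = 2 * normConst d α / ‖y‖ ^ ((d : ℝ) + α) * (1 - Real.exp (-‖y‖ ^ 2)) := by ring
      _ ≤ _ := by
        refine mul_le_mul_of_nonneg_left ?_ (by positivity)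
        exact le_mul_of_one_le_left h0 hp
  refine (lintegral_mono h1).trans ?_
  rw [lintegral_lintegral_swap hm.aemeasurable, ofReal_integral_eq_lintegral_ofReal
    integrable_one_add_sq_mul_exp (ae_of_all _ fun ξ => by positivity)]
  refine lintegral_mono fun ξ => ?_
  rw [lintegral_mul_const _ (by fun_prop), lintegral_normConst_mul_one_sub_cos hα,
    ← ENNReal.ofReal_mul (by positivity)]
  exact ENNReal.ofReal_le_ofReal
    (mul_le_mul_of_nonneg_right (rpow_le_one_add_sq (norm_nonneg _) hα) (Real.exp_pos _).le)

lemma inv_norm_rpow_le {d : ℕ} {α r : ℝ} (hα : α ∈ Set.Ioo (0 : ℝ) 2) (hr : 0 < r) {y : Space d}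
    (hy : r ≤ ‖y‖) : (‖y‖ ^ ((d : ℝ) + α))⁻¹ ≤ (1 + r⁻¹) ^ ((d : ℝ) + 2) := by
  have h0 := hα.1
  have hy0 : 0 < ‖y‖ := hr.trans_le hy
  have hri : 0 < r⁻¹ := by positivity
  rw [← Real.inv_rpow hy0.le]
  calc ‖y‖⁻¹ ^ ((d : ℝ) + α) ≤ (1 + r⁻¹) ^ ((d : ℝ) + α) := by
        refine Real.rpow_le_rpow (by positivity) ?_ (by positivity)
        have := inv_anti₀ hr hy
        linarith
    _ ≤ _ := Real.rpow_le_rpow_of_exponent_le (by linarith) (by linarith [hα.2])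

/-! ### Integration against the mixed Lévy density -/

section Density

variable {d : ℕ} {ρ : Measure ℝ}

lemma levyDensity_nonneg (hρ : ρ (Set.Ioo (0 : ℝ) 2)ᶜ = 0) (y : Space d) :
    0 ≤ levyDensity ρ y := by
  refine integral_nonneg_of_ae ?_
  filter_upwards [ae_mem_Ioo hρ] with α hα
  have := normConst_pos (d := d) hα
  simp only [Pi.zero_apply]
  positivity

lemma aestronglyMeasurable_levy_joint [SFinite ρ] (hρ : ρ (Set.Ioo (0 : ℝ) 2)ᶜ = 0)
    {g : Space d → ℝ} (hg : AEStronglyMeasurable g) :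
    AEStronglyMeasurable (fun p : ℝ × Space d =>
      normConst d p.1 * (g p.2 / ‖p.2‖ ^ ((d : ℝ) + p.1))) (ρ.prod volume) := by
  refine (aestronglyMeasurable_normConst hρ d).comp_fst.mul (hg.comp_snd.div₀ ?_)
  exact (by fun_prop : Measurable fun p : ℝ × Space d =>
    ‖p.2‖ ^ ((d : ℝ) + p.1)).aestronglyMeasurable

lemma integral_normConst_mul_one_sub_cos {α : ℝ} (hα : α ∈ Set.Ioo (0 : ℝ) 2) (ξ : Space d) :
    Integrable (fun y : Space d => (2 * (1 - Real.cos ⟪ξ, y⟫)) / ‖y‖ ^ ((d : ℝ) + α)) ∧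
    normConst d α * ∫ y : Space d, (2 * (1 - Real.cos ⟪ξ, y⟫)) / ‖y‖ ^ ((d : ℝ) + α) =
      ‖ξ‖ ^ α := by
  have hb := normConst_pos (d := d) hα
  have h := lintegral_normConst_mul_one_sub_cos hα ξ
  have hn : ∀ y : Space d, 0 ≤
      normConst d α * (2 * (1 - Real.cos ⟪ξ, y⟫)) / ‖y‖ ^ ((d : ℝ) + α) := fun y => by
    have : 0 ≤ 1 - Real.cos ⟪ξ, y⟫ := by linarith [Real.cos_le_one ⟪ξ, y⟫]
    positivity
  have hm : Measurable fun y : Space d =>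
      normConst d α * (2 * (1 - Real.cos ⟪ξ, y⟫)) / ‖y‖ ^ ((d : ℝ) + α) := by fun_prop
  have hI : Integrable fun y : Space d =>
      normConst d α * (2 * (1 - Real.cos ⟪ξ, y⟫)) / ‖y‖ ^ ((d : ℝ) + α) := by
    refine ⟨hm.aestronglyMeasurable, ?_⟩
    rw [hasFiniteIntegral_iff_ofReal (ae_of_all _ hn), h]
    exact ENNReal.ofReal_lt_top
  constructor
  · refine (hI.const_mul (normConst d α)⁻¹).congr (ae_of_all _ fun y => ?_)
    field_simp
  · rw [← integral_const_mul]
    simp_rw [← mul_div_assoc]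
    rw [integral_eq_lintegral_of_nonneg_ae (ae_of_all _ hn) hm.aestronglyMeasurable, h,
      ENNReal.toReal_ofReal (by positivity)]

variable [IsFiniteMeasure ρ]

lemma exists_levy_bound (hd : 1 ≤ d) {r : ℝ} (hr : 0 < r) :
    ∃ B : ℝ, 0 < B ∧ ∀ α ∈ Set.Ioo (0 : ℝ) 2, ∀ y : Space d, r ≤ ‖y‖ →
      ‖normConst d α / ‖y‖ ^ ((d : ℝ) + α)‖ ≤ B := by
  obtain ⟨B, hB, h⟩ := exists_normConst_le hd
  refine ⟨B * (1 + r⁻¹) ^ ((d : ℝ) + 2), by positivity, fun α hα y hy => ?_⟩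
  have := normConst_pos (d := d) hα
  rw [Real.norm_of_nonneg (by positivity), div_eq_mul_inv]
  exact mul_le_mul (h α hα) (inv_norm_rpow_le hα hr hy) (by positivity) hB.le

lemma integrable_levy_slice (hd : 1 ≤ d) (hρ : ρ (Set.Ioo (0 : ℝ) 2)ᶜ = 0) {y : Space d}
    (hy : y ≠ 0) : Integrable (fun α => normConst d α / ‖y‖ ^ ((d : ℝ) + α)) ρ := by
  obtain ⟨B, -, h⟩ := exists_levy_bound (d := d) hd (norm_pos_iff.2 hy)
  refine (integrable_const B).mono' ?_ ?_
  · refine (aestronglyMeasurable_normConst hρ d).div₀ ?_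
    exact (by fun_prop : Measurable fun α : ℝ => ‖y‖ ^ ((d : ℝ) + α)).aestronglyMeasurable
  · filter_upwards [ae_mem_Ioo hρ] with α hα using h α hα y le_rfl

lemma exists_levyDensity_le (hd : 1 ≤ d) (hρ : ρ (Set.Ioo (0 : ℝ) 2)ᶜ = 0) {r : ℝ} (hr : 0 < r) :
    ∃ B : ℝ, 0 ≤ B ∧ ∀ y : Space d, r ≤ ‖y‖ → levyDensity ρ y ≤ B := by
  obtain ⟨B, hB, h⟩ := exists_levy_bound hd hr
  refine ⟨B * ρ.real Set.univ, by positivity, fun y hy => ?_⟩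
  refine (Real.le_norm_self _).trans ?_
  rw [levyDensity]
  refine norm_integral_le_of_norm_le_const ?_
  filter_upwards [ae_mem_Ioo hρ] with α hα using h α hα y hy

lemma continuousAt_levyDensity (hd : 1 ≤ d) (hρ : ρ (Set.Ioo (0 : ℝ) 2)ᶜ = 0) {y : Space d}
    (hy : y ≠ 0) : ContinuousAt (levyDensity ρ) y := by
  have hy0 : 0 < ‖y‖ := norm_pos_iff.2 hy
  obtain ⟨B, -, h⟩ := exists_levy_bound hd (half_pos hy0)
  have hev : ∀ᶠ z in 𝓝 y, ‖y‖ / 2 < ‖z‖ :=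
    continuous_norm.continuousAt.eventually (lt_mem_nhds (half_lt_self hy0))
  refine continuousAt_of_dominated (bound := fun _ => B) ?_ ?_ (integrable_const B) ?_
  · filter_upwards [hev] with z hz
    refine (integrable_levy_slice hd hρ ?_).1
    rintro rfl
    simp at hz; linarith
  · filter_upwards [hev] with z hz
    filter_upwards [ae_mem_Ioo hρ] with α hα using h α hα z hz.le
  · filter_upwards [ae_mem_Ioo hρ] with α hα
    refine ContinuousAt.div continuousAt_const ?_ (by positivity)
    exact continuous_norm.continuousAt.rpow_const (Or.inl hy0.ne')

lemma measurable_levyDensity (hd : 1 ≤ d) (hρ : ρ (Set.Ioo (0 : ℝ) 2)ᶜ = 0) :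
    Measurable (levyDensity (d := d) ρ) :=
  measurable_of_continuousOn_compl_singleton 0
    fun _ hy => (continuousAt_levyDensity hd hρ hy).continuousWithinAt

/-- Each power |y|^(-d-α) has this property with constant c^(d+α) ≤ c^(d+2). It serves to compare K
at a point with K at the nearest lattice point in the Riemann sums. -/
lemma levyDensity_le_of_norm_le (hd : 1 ≤ d) (hρ : ρ (Set.Ioo (0 : ℝ) 2)ᶜ = 0) {c : ℝ}
    (hc : 1 ≤ c) {y z : Space d} (hy : y ≠ 0) (hz : z ≠ 0) (h : ‖y‖ ≤ c * ‖z‖) :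
    levyDensity ρ z ≤ c ^ ((d : ℝ) + 2) * levyDensity ρ y := by
  unfold levyDensity
  rw [← integral_const_mul]
  refine integral_mono_ae (integrable_levy_slice hd hρ hz)
    ((integrable_levy_slice hd hρ hy).const_mul _) ?_
  filter_upwards [ae_mem_Ioo hρ] with α hα
  have hb := normConst_pos (d := d) hα
  have hy0 : 0 < ‖y‖ := norm_pos_iff.2 hy
  have hz0 : 0 < ‖z‖ := norm_pos_iff.2 hz
  have hα0 := hα.1
  rw [mul_div_assoc', div_le_div_iff₀ (by positivity) (by positivity)]
  calc normConst d α * ‖y‖ ^ ((d : ℝ) + α)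
      ≤ normConst d α * (c * ‖z‖) ^ ((d : ℝ) + α) := by gcongr
    _ = c ^ ((d : ℝ) + α) * normConst d α * ‖z‖ ^ ((d : ℝ) + α) := by
        rw [Real.mul_rpow (by positivity) hz0.le]; ring
    _ ≤ _ := by
        gcongr
        exact hα.2.le

lemma ae_ne_zero (hd : 1 ≤ d) : ∀ᵐ y : Space d, y ≠ 0 := by
  have : Nonempty (Fin d) := ⟨⟨0, hd⟩⟩
  have : Nontrivial (Space d) := inferInstance
  exact Measure.ae_ne volume 0

/-- The Lévy condition on K: the bound of `exists_lintegral_truncSq_le` is uniform in α, hence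
integrable against the finite measure ρ, and Fubini applies. It supplies the dominating function in
most later limits. -/
lemma integrable_truncSq_mul_levyDensity (hρ : ρ (Set.Ioo (0 : ℝ) 2)ᶜ = 0) :
    Integrable (fun y : Space d => truncSq y * levyDensity ρ y) := by
  obtain ⟨C, hC⟩ := exists_lintegral_truncSq_le d
  have hi : Integrable (fun p : ℝ × Space d =>
      normConst d p.1 * (truncSq p.2 / ‖p.2‖ ^ ((d : ℝ) + p.1))) (ρ.prod volume) := by
    have hm := aestronglyMeasurable_levy_joint hρ (d := d)
      continuous_truncSq.aestronglyMeasurable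
    refine ⟨hm, ?_⟩
    rw [hasFiniteIntegral_iff_norm, lintegral_prod _ hm.norm.aemeasurable.ennreal_ofReal]
    have : ∀ᵐ α ∂ρ, ∫⁻ y : Space d, ENNReal.ofReal
        ‖normConst d α * (truncSq y / ‖y‖ ^ ((d : ℝ) + α))‖ ≤ ENNReal.ofReal C := by
      filter_upwards [ae_mem_Ioo hρ] with α hα
      refine le_trans (le_of_eq ?_) (hC α hα)
      congr 1; ext y
      have := normConst_pos (d := d) hα
      have := truncSq_nonneg y
      rw [Real.norm_of_nonneg (by positivity), mul_div_assoc]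
    refine (lintegral_mono_ae this).trans_lt ?_
    rw [lintegral_const]
    exact ENNReal.mul_lt_top ENNReal.ofReal_lt_top (measure_lt_top _ _)
  refine hi.integral_prod_right.congr (ae_of_all _ fun y => ?_)
  simp only [levyDensity]
  rw [← integral_const_mul]
  congr 1; ext α; ring

lemma integrable_mul_levyDensity (hd : 1 ≤ d) (hρ : ρ (Set.Ioo (0 : ℝ) 2)ᶜ = 0) {C : ℝ}
    {g : Space d → ℝ} (hg : AEStronglyMeasurable g) (h : ∀ y, |g y| ≤ C * truncSq y) :
    Integrable (fun y => g y * levyDensity ρ y) := by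
  refine ((integrable_truncSq_mul_levyDensity hρ).const_mul C).mono'
    (hg.mul (measurable_levyDensity hd hρ).aestronglyMeasurable) (ae_of_all _ fun y => ?_)
  rw [norm_mul, Real.norm_of_nonneg (levyDensity_nonneg hρ y), ← mul_assoc]
  exact mul_le_mul_of_nonneg_right (h y) (levyDensity_nonneg hρ y)

/-- Fubini in (α, y). Since b(α) ≥ 0, integrating the absolute value over α gives exactly |g| K, so
integrability of g K already implies integrability on the product. -/
lemma integral_mul_levyDensity (hd : 1 ≤ d) (hρ : ρ (Set.Ioo (0 : ℝ) 2)ᶜ = 0) {g : Space d → ℝ}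
    (hg : AEStronglyMeasurable g) (hi : Integrable (fun y => g y * levyDensity ρ y)) :
    ∫ α, (normConst d α * ∫ y, g y / ‖y‖ ^ ((d : ℝ) + α)) ∂ρ = ∫ y, g y * levyDensity ρ y := by
  have hI : Integrable (fun p : ℝ × Space d =>
      normConst d p.1 * (g p.2 / ‖p.2‖ ^ ((d : ℝ) + p.1))) (ρ.prod volume) := by
    rw [integrable_prod_iff' (aestronglyMeasurable_levy_joint hρ hg)]
    constructor
    · filter_upwards [ae_ne_zero hd] with y hy
      refine ((integrable_levy_slice hd hρ hy).const_mul (g y)).congr (ae_of_all _ fun α => ?_)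
      ring
    · refine hi.norm.congr (ae_of_all _ fun y => ?_)
      simp only
      rw [norm_mul, Real.norm_of_nonneg (levyDensity_nonneg hρ y), levyDensity,
        ← integral_const_mul]
      refine integral_congr_ae ?_
      filter_upwards [ae_mem_Ioo hρ] with α hα
      have := normConst_pos (d := d) hα
      rw [norm_mul, norm_div, Real.norm_of_nonneg this.le,
        Real.norm_of_nonneg (Real.rpow_nonneg (norm_nonneg y) _)]
      ring
  have h1 := integral_integral_swap (f := fun (α : ℝ) (y : Space d) =>
    normConst d α * (g y / ‖y‖ ^ ((d : ℝ) + α))) hI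
  simp only [integral_const_mul] at h1
  rw [h1]
  refine integral_congr_ae (ae_of_all _ fun y => ?_)
  simp only [levyDensity]
  rw [← integral_const_mul]
  congr 1; ext α; ring

lemma integrable_one_sub_cos_mul_levyDensity (hd : 1 ≤ d) (hρ : ρ (Set.Ioo (0 : ℝ) 2)ᶜ = 0)
    (ξ : Space d) :
    Integrable (fun y : Space d => (2 * (1 - Real.cos ⟪ξ, y⟫)) * levyDensity ρ y) := by
  refine integrable_mul_levyDensity hd hρ (C := 2 * (2 + ‖ξ‖ ^ 2))
    (by fun_prop) fun y => ?_
  have := one_sub_cos_le_truncSq ξ y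
  rw [abs_of_nonneg (by linarith [Real.cos_le_one ⟪ξ, y⟫])]
  linarith

/-- Lévy–Khintchine representation of the exponent. The factor 2 reflects that a second difference
uses both y and -y, so the Lévy measure has density 2K. -/
lemma integral_one_sub_cos_mul_levyDensity (hd : 1 ≤ d) (hρ : ρ (Set.Ioo (0 : ℝ) 2)ᶜ = 0)
    (ξ : Space d) :
    ∫ y : Space d, (2 * (1 - Real.cos ⟪ξ, y⟫)) * levyDensity ρ y = ∫ α, ‖ξ‖ ^ α ∂ρ := by
  rw [← integral_mul_levyDensity hd hρ (by fun_prop)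
    (integrable_one_sub_cos_mul_levyDensity hd hρ ξ)]
  refine integral_congr_ae ?_
  filter_upwards [ae_mem_Ioo hρ] with α hα using (integral_normConst_mul_one_sub_cos hα ξ).2

end Density


/-! ### The symbol and its growth -/

/-- The characteristic exponent `∫ |ξ|^α dρ(α)`. -/
noncomputable def charExponent {d : ℕ} (ρ : Measure ℝ) (ξ : Space d) : ℝ := ∫ α, ‖ξ‖ ^ α ∂ρ

lemma levySymbol_eq {d : ℕ} (ρ : Measure ℝ) (ξ : Space d) :
    levySymbol ρ ξ = -charExponent ρ ξ := rfl

lemma charExponent_neg {d : ℕ} (ρ : Measure ℝ) (ξ : Space d) :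
    charExponent ρ (-ξ) = charExponent ρ ξ := by simp [charExponent]

lemma charExponent_nonneg {d : ℕ} (ρ : Measure ℝ) (ξ : Space d) : 0 ≤ charExponent ρ ξ :=
  integral_nonneg fun _ => by positivity

section Symbol

variable {d : ℕ} {ρ : Measure ℝ} [IsFiniteMeasure ρ]

lemma integrable_norm_rpow (hρ : ρ (Set.Ioo (0 : ℝ) 2)ᶜ = 0) (ξ : Space d) :
    Integrable (fun α => ‖ξ‖ ^ α) ρ := by
  refine (integrable_const (1 + ‖ξ‖ ^ 2)).mono' (by fun_prop) ?_
  filter_upwards [ae_mem_Ioo hρ] with α hα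
  rw [Real.norm_of_nonneg (by positivity)]
  exact rpow_le_one_add_sq (norm_nonneg _) hα

lemma charExponent_le (hρ : ρ (Set.Ioo (0 : ℝ) 2)ᶜ = 0) (ξ : Space d) :
    charExponent ρ ξ ≤ ρ.real Set.univ * (1 + ‖ξ‖) ^ 2 := by
  refine (integral_mono_ae (integrable_norm_rpow hρ ξ)
    (integrable_const ((1 + ‖ξ‖) ^ 2)) ?_).trans (by simp)
  filter_upwards [ae_mem_Ioo hρ] with α hα
  refine (rpow_le_one_add_sq (norm_nonneg _) hα).trans ?_
  nlinarith [norm_nonneg ξ]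

lemma continuous_charExponent (hρ : ρ (Set.Ioo (0 : ℝ) 2)ᶜ = 0) :
    Continuous (charExponent (d := d) ρ) := by
  refine continuous_iff_continuousAt.2 fun ξ => ?_
  have hev : ∀ᶠ η in 𝓝 ξ, ‖η‖ < ‖ξ‖ + 1 :=
    continuous_norm.continuousAt.eventually (gt_mem_nhds (lt_add_one _))
  refine continuousAt_of_dominated (bound := fun _ => 1 + (‖ξ‖ + 1) ^ 2) ?_ ?_
    (integrable_const _) ?_
  · exact Eventually.of_forall fun η => (integrable_norm_rpow hρ η).1
  · filter_upwards [hev] with η hη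
    filter_upwards [ae_mem_Ioo hρ] with α hα
    rw [Real.norm_of_nonneg (by positivity)]
    refine (rpow_le_one_add_sq (norm_nonneg _) hα).trans ?_
    gcongr
  · filter_upwards [ae_mem_Ioo hρ] with α hα
    exact continuous_norm.continuousAt.rpow_const (Or.inr hα.1.le)

/-- A nonzero ρ on (0,2) charges some half-line (β, ∞) with β = 1/(n+1), because these exhaust (0,
∞). On that half-line |ξ|^α ≥ |ξ|^β as soon as |ξ| ≥ 1, so c can be the mass of (β, ∞). -/
lemma exists_le_charExponent (hρ : ρ (Set.Ioo (0 : ℝ) 2)ᶜ = 0) (hρ0 : ρ ≠ 0) :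
    ∃ β c : ℝ, 0 < β ∧ 0 < c ∧ ∀ ξ : Space d, 1 ≤ ‖ξ‖ → c * ‖ξ‖ ^ β ≤ charExponent ρ ξ := by
  have h1 : ∃ n : ℕ, ρ (Set.Ioi (1 / ((n : ℝ) + 1))) ≠ 0 := by
    by_contra! h
    refine hρ0 ?_
    rw [← Measure.measure_univ_eq_zero]
    have hz : ρ (⋃ n : ℕ, Set.Ioi (1 / ((n : ℝ) + 1))) = 0 := measure_iUnion_null h
    refine measure_mono_null ?_ (measure_union_null hz hρ)
    intro α _
    by_cases hα : α ∈ Set.Ioo (0 : ℝ) 2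
    · obtain ⟨n, hn⟩ := exists_nat_one_div_lt hα.1
      exact Or.inl (Set.mem_iUnion.2 ⟨n, hn⟩)
    · exact Or.inr hα
  obtain ⟨n, hn⟩ := h1
  have hβ : (0 : ℝ) < 1 / ((n : ℝ) + 1) := by positivity
  set β : ℝ := 1 / ((n : ℝ) + 1) with hβdef
  refine ⟨β, ρ.real (Set.Ioi β), hβ, ENNReal.toReal_pos hn (measure_ne_top _ _), fun ξ hξ => ?_⟩
  have h2 : ∫ _α in Set.Ioi β, ‖ξ‖ ^ β ∂ρ = ρ.real (Set.Ioi β) * ‖ξ‖ ^ β := by simp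
  rw [← h2]
  refine (setIntegral_mono_on (integrable_const _).integrableOn
    (integrable_norm_rpow hρ ξ).integrableOn measurableSet_Ioi fun α hα => ?_).trans
    (setIntegral_le_integral (integrable_norm_rpow hρ ξ)
      (ae_of_all _ fun α => Real.rpow_nonneg (norm_nonneg ξ) α))
  exact Real.rpow_le_rpow_of_exponent_le hξ (le_of_lt hα)

lemma exists_pow_mul_exp_le (hρ : ρ (Set.Ioo (0 : ℝ) 2)ᶜ = 0) (hρ0 : ρ ≠ 0) (n : ℕ) {t : ℝ}
    (ht : 0 < t) :
    ∃ C : ℝ, 0 < C ∧ ∀ ξ : Space d, (1 + ‖ξ‖) ^ n * Real.exp (-t * charExponent ρ ξ) ≤ C := by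
  obtain ⟨β, c, hβ, hc, h⟩ := exists_le_charExponent (d := d) hρ hρ0
  -- With βk ≥ n, |ξ|^n ≤ s^k for s = |ξ|^β, and the k-th term of the exponential series gives s^k
  -- e^{-tcs} ≤ k! / (tc)^k.
  obtain ⟨k, hk⟩ := exists_nat_ge (n / β)
  have hk' : (n : ℝ) ≤ β * k := by rw [div_le_iff₀ hβ] at hk; linarith
  refine ⟨2 ^ n * (1 + k.factorial / (t * c) ^ k), by positivity, fun ξ => ?_⟩
  have hb := charExponent_nonneg ρ ξ
  have he : Real.exp (-t * charExponent ρ ξ) ≤ 1 := Real.exp_le_one_iff.2 (by nlinarith)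
  rcases le_total ‖ξ‖ 1 with h1 | h1
  · have e1 : (1 + ‖ξ‖) ^ n ≤ 2 ^ n := by gcongr; linarith
    calc (1 + ‖ξ‖) ^ n * Real.exp (-t * charExponent ρ ξ) ≤ 2 ^ n * 1 := by gcongr
      _ ≤ _ := by gcongr; simp; positivity
  · have e1 : (1 + ‖ξ‖) ^ n ≤ 2 ^ n * ‖ξ‖ ^ n := by
      rw [← mul_pow]; gcongr; linarith
    have e2 : ‖ξ‖ ^ n ≤ (‖ξ‖ ^ β) ^ k := by
      rw [← Real.rpow_natCast, ← Real.rpow_natCast, ← Real.rpow_mul (norm_nonneg _)]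
      exact Real.rpow_le_rpow_of_exponent_le h1 hk'
    have e3 : Real.exp (-t * charExponent ρ ξ) ≤ Real.exp (-(t * c * ‖ξ‖ ^ β)) := by
      refine Real.exp_le_exp.2 ?_
      have := mul_le_mul_of_nonneg_left (h ξ h1) ht.le
      linarith
    set s := ‖ξ‖ ^ β
    have hs : 0 < s := by positivity
    have e4 := Real.pow_div_factorial_le_exp (t * c * s) (by positivity) k
    have e5 : s ^ k * Real.exp (-(t * c * s)) ≤ k.factorial / (t * c) ^ k := by
      rw [Real.exp_neg, ← div_eq_mul_inv, div_le_div_iff₀ (Real.exp_pos _) (by positivity),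
        ← mul_pow, mul_comm s]
      rw [div_le_iff₀ (by positivity)] at e4
      linarith
    calc (1 + ‖ξ‖) ^ n * Real.exp (-t * charExponent ρ ξ)
        ≤ (2 ^ n * s ^ k) * Real.exp (-(t * c * s)) := by
          gcongr
          exact e1.trans (by gcongr)
      _ = 2 ^ n * (s ^ k * Real.exp (-(t * c * s))) := by ring
      _ ≤ 2 ^ n * (1 + k.factorial / (t * c) ^ k) := by gcongr; linarith

lemma integrable_pow_mul_exp (hρ : ρ (Set.Ioo (0 : ℝ) 2)ᶜ = 0) (hρ0 : ρ ≠ 0) (n : ℕ) {t : ℝ}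
    (ht : 0 < t) :
    Integrable (fun ξ : Space d => (1 + ‖ξ‖) ^ n * Real.exp (-t * charExponent ρ ξ)) := by
  -- The d + 1 extra powers are traded for the integrable weight (1 + |ξ|)^(-(d+1)).
  obtain ⟨C, hC, h⟩ := exists_pow_mul_exp_le (d := d) hρ hρ0 (n + (d + 1)) ht
  have hc := continuous_charExponent (d := d) hρ
  have hi : Integrable (fun ξ : Space d => (1 + ‖ξ‖) ^ (-((d : ℝ) + 1))) :=
    integrable_one_add_norm (by simp)
  refine (hi.const_mul C).mono' (by fun_prop) (ae_of_all _ fun ξ => ?_)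
  rw [Real.norm_of_nonneg (by positivity), Real.rpow_neg (by positivity), ← div_eq_mul_inv,
    le_div_iff₀ (by positivity)]
  have := h ξ
  rw [show (d : ℝ) + 1 = ((d + 1 : ℕ) : ℝ) by push_cast; ring, Real.rpow_natCast]
  rw [pow_add] at this
  linarith

/-! ### Oscillatory integrals against the symbol -/

lemma integrable_mul_exp_mul_cos (hρ : ρ (Set.Ioo (0 : ℝ) 2)ᶜ = 0) (hρ0 : ρ ≠ 0) {n : ℕ} {C : ℝ}
    {g : Space d → ℝ} (hg : Continuous g) (hgb : ∀ ξ, |g ξ| ≤ C * (1 + ‖ξ‖) ^ n) {t : ℝ}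
    (ht : 0 < t) (x : Space d) :
    Integrable (fun ξ => g ξ * Real.exp (-t * charExponent ρ ξ) * Real.cos ⟪x, ξ⟫) := by
  have hc := continuous_charExponent (d := d) hρ
  refine ((integrable_pow_mul_exp hρ hρ0 n ht).const_mul C).mono' (by fun_prop)
    (ae_of_all _ fun ξ => ?_)
  rw [norm_mul, norm_mul, Real.norm_of_nonneg (Real.exp_pos _).le, ← mul_assoc]
  refine (mul_le_of_le_one_right (by positivity) (Real.abs_cos_le_one _)).trans ?_
  exact mul_le_mul_of_nonneg_right (hgb ξ) (Real.exp_pos _).le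

lemma continuousOn_integral_mul_exp_mul_cos (hρ : ρ (Set.Ioo (0 : ℝ) 2)ᶜ = 0) (hρ0 : ρ ≠ 0)
    {n : ℕ} {C : ℝ} {g : Space d → ℝ} (hg : Continuous g)
    (hgb : ∀ ξ, |g ξ| ≤ C * (1 + ‖ξ‖) ^ n) :
    ContinuousOn (fun p : ℝ × Space d =>
      ∫ ξ, g ξ * Real.exp (-p.1 * charExponent ρ ξ) * Real.cos ⟪p.2, ξ⟫)
      (Set.Ioi 0 ×ˢ Set.univ) := by
  rintro ⟨t, x⟩ ⟨ht, -⟩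
  have ht : 0 < t := ht
  have hc := continuous_charExponent (d := d) hρ
  refine ContinuousAt.continuousWithinAt ?_
  -- Freezing the time at t/2 in the exponential gives one dominating function for all nearby times.
  have hev : ∀ᶠ p : ℝ × Space d in 𝓝 (t, x), t / 2 < p.1 :=
    continuous_fst.continuousAt.eventually (lt_mem_nhds (half_lt_self ht))
  refine continuousAt_of_dominated
    (bound := fun ξ => C * ((1 + ‖ξ‖) ^ n * Real.exp (-(t / 2) * charExponent ρ ξ))) ?_ ?_
    ((integrable_pow_mul_exp hρ hρ0 n (half_pos ht)).const_mul C) ?_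
  · exact Eventually.of_forall fun p => by fun_prop
  · filter_upwards [hev] with p hp
    refine ae_of_all _ fun ξ => ?_
    rw [norm_mul, norm_mul, Real.norm_of_nonneg (Real.exp_pos _).le, ← mul_assoc]
    refine (mul_le_of_le_one_right (by positivity) (Real.abs_cos_le_one _)).trans ?_
    have := charExponent_nonneg ρ ξ
    refine mul_le_mul (hgb ξ) (Real.exp_le_exp.2 (by nlinarith)) (Real.exp_pos _).le
      ((abs_nonneg _).trans (hgb ξ))
  · exact ae_of_all _ fun ξ => by fun_prop

lemma hasDerivAt_integral_mul_exp_mul_cos (hρ : ρ (Set.Ioo (0 : ℝ) 2)ᶜ = 0) (hρ0 : ρ ≠ 0) {t : ℝ}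
    (ht : 0 < t) (x : Space d) :
    HasDerivAt (fun s => ∫ ξ, Real.exp (-s * charExponent ρ ξ) * Real.cos ⟪x, ξ⟫)
      (∫ ξ, -charExponent ρ ξ * Real.exp (-t * charExponent ρ ξ) * Real.cos ⟪x, ξ⟫) t := by
  have hc := continuous_charExponent (d := d) hρ
  have hi := integrable_mul_exp_mul_cos hρ hρ0 (n := 0) (C := 1) (g := fun _ : Space d => 1)
    continuous_const (by simp) ht x
  simp only [one_mul] at hi
  refine (hasDerivAt_integral_of_dominated_loc_of_deriv_le (s := Set.Ioi (t / 2))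
    (bound := fun ξ => ρ.real Set.univ *
      ((1 + ‖ξ‖) ^ 2 * Real.exp (-(t / 2) * charExponent ρ ξ)))
    (F' := fun s ξ => -charExponent ρ ξ * Real.exp (-s * charExponent ρ ξ) * Real.cos ⟪x, ξ⟫)
    (Ioi_mem_nhds (half_lt_self ht)) ?_ hi ?_ ?_
    ((integrable_pow_mul_exp hρ hρ0 2 (half_pos ht)).const_mul _) ?_).2
  · exact Eventually.of_forall fun p => by fun_prop
  · fun_prop
  · refine ae_of_all _ fun ξ s hs => ?_
    have hs : t / 2 < s := hs
    have h0 := charExponent_nonneg ρ ξ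
    rw [norm_mul, norm_mul, Real.norm_of_nonneg (Real.exp_pos _).le, ← mul_assoc, norm_neg,
      Real.norm_of_nonneg h0]
    refine (mul_le_of_le_one_right (by positivity) (Real.abs_cos_le_one _)).trans ?_
    refine mul_le_mul (charExponent_le hρ ξ) (Real.exp_le_exp.2 (by nlinarith))
      (Real.exp_pos _).le (by positivity)
  · refine ae_of_all _ fun ξ s _ => ?_
    have h1 : HasDerivAt (fun s : ℝ => -s * charExponent ρ ξ) (-1 * charExponent ρ ξ) s :=
      (hasDerivAt_id s).neg.mul_const _
    exact (h1.exp.mul_const (Real.cos ⟪x, ξ⟫)).congr_deriv (by ring)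

end Symbol


/-! ### The kernel as an oscillatory integral -/

section Kernel

open scoped FourierTransform

variable {d : ℕ} {ρ : Measure ℝ}

lemma kernelIntegrand_eq (t : ℝ) (x ξ : Space d) :
    kernelIntegrand ρ t x ξ = ((Real.exp (-t * charExponent ρ ξ) * Real.cos ⟪x, ξ⟫ : ℝ) : ℂ) -
      ((Real.exp (-t * charExponent ρ ξ) * Real.sin ⟪x, ξ⟫ : ℝ) : ℂ) * Complex.I := by
  rw [kernelIntegrand, levySymbol_eq, Complex.exp_sub, mul_comm Complex.I, Complex.exp_mul_I,
    ← Complex.ofReal_exp, ← Complex.ofReal_cos, ← Complex.ofReal_sin,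
    show t * -charExponent ρ ξ = -t * charExponent ρ ξ by ring]
  have h : ((Real.cos ⟪x, ξ⟫ : ℝ) : ℂ) + ((Real.sin ⟪x, ξ⟫ : ℝ) : ℂ) * Complex.I ≠ 0 := by
    rw [Complex.ofReal_cos, Complex.ofReal_sin, ← Complex.exp_mul_I]; exact Complex.exp_ne_zero _
  rw [div_eq_iff h]
  have h1 : ((Real.cos ⟪x, ξ⟫ : ℝ) : ℂ) ^ 2 + ((Real.sin ⟪x, ξ⟫ : ℝ) : ℂ) ^ 2 = 1 := by
    norm_cast; exact Real.cos_sq_add_sin_sq _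
  push_cast
  push_cast at h1
  linear_combination (-(Complex.exp (-(t : ℂ) * charExponent ρ ξ))) * h1 +
    Complex.exp (-(t : ℂ) * charExponent ρ ξ) * Complex.sin (⟪x, ξ⟫ : ℝ) ^ 2 * Complex.I_sq

lemma norm_kernelIntegrand (t : ℝ) (x ξ : Space d) :
    ‖kernelIntegrand ρ t x ξ‖ = Real.exp (-t * charExponent ρ ξ) := by
  rw [kernelIntegrand, Complex.norm_exp, levySymbol_eq]
  simp

variable [IsFiniteMeasure ρ]

lemma integrable_exp_neg_mul_charExponent (hρ : ρ (Set.Ioo (0 : ℝ) 2)ᶜ = 0) (hρ0 : ρ ≠ 0) {t : ℝ}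
    (ht : 0 < t) : Integrable (fun ξ : Space d => Real.exp (-t * charExponent ρ ξ)) := by
  simpa using integrable_pow_mul_exp (d := d) hρ hρ0 0 ht

lemma continuous_kernelIntegrand (hρ : ρ (Set.Ioo (0 : ℝ) 2)ᶜ = 0) (t : ℝ) (x : Space d) :
    Continuous (kernelIntegrand ρ t x) := by
  have hc := continuous_charExponent (d := d) hρ
  unfold kernelIntegrand
  simp only [levySymbol_eq]
  fun_prop

lemma integrable_kernelIntegrand (hρ : ρ (Set.Ioo (0 : ℝ) 2)ᶜ = 0) (hρ0 : ρ ≠ 0) {t : ℝ}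
    (ht : 0 < t) (x : Space d) : Integrable (kernelIntegrand ρ t x) :=
  (integrable_exp_neg_mul_charExponent hρ hρ0 ht).mono'
    (continuous_kernelIntegrand hρ t x).aestronglyMeasurable
    (ae_of_all _ fun ξ => (norm_kernelIntegrand t x ξ).le)

/-- The exponent ψ is even, so the sine part of the integrand is odd and integrates to zero. -/
lemma kernelC_eq (hρ : ρ (Set.Ioo (0 : ℝ) 2)ᶜ = 0) (hρ0 : ρ ≠ 0) {t : ℝ} (ht : 0 < t)
    (x : Space d) :
    kernelC ρ t x = ((((2 * Real.pi) ^ d)⁻¹ *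
      ∫ ξ : Space d, Real.exp (-t * charExponent ρ ξ) * Real.cos ⟪x, ξ⟫ : ℝ) : ℂ) := by
  have hc := continuous_charExponent (d := d) hρ
  have hi := integrable_exp_neg_mul_charExponent (d := d) hρ hρ0 ht
  have hcos : Integrable fun ξ : Space d =>
      Real.exp (-t * charExponent ρ ξ) * Real.cos ⟪x, ξ⟫ := by
    refine hi.mono (by fun_prop) (ae_of_all _ fun ξ => ?_)
    rw [norm_mul]
    exact mul_le_of_le_one_right (norm_nonneg _) (Real.abs_cos_le_one _)
  have hsin : Integrable fun ξ : Space d =>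
      Real.exp (-t * charExponent ρ ξ) * Real.sin ⟪x, ξ⟫ := by
    refine hi.mono (by fun_prop) (ae_of_all _ fun ξ => ?_)
    rw [norm_mul]
    exact mul_le_of_le_one_right (norm_nonneg _) (Real.abs_sin_le_one _)
  have h0 : ∫ ξ : Space d, Real.exp (-t * charExponent ρ ξ) * Real.sin ⟪x, ξ⟫ = 0 := by
    have h := integral_neg_eq_self
      (fun ξ : Space d => Real.exp (-t * charExponent ρ ξ) * Real.sin ⟪x, ξ⟫) volume
    simp only [charExponent_neg, inner_neg_right, Real.sin_neg, mul_neg, integral_neg] at h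
    linarith
  rw [kernelC]
  simp_rw [kernelIntegrand_eq]
  rw [integral_sub hcos.ofReal (hsin.ofReal.mul_const _), integral_mul_const, integral_complex_ofReal,
    integral_complex_ofReal, h0]
  simp

lemma kernelG_eq (hρ : ρ (Set.Ioo (0 : ℝ) 2)ᶜ = 0) (hρ0 : ρ ≠ 0) {t : ℝ} (ht : 0 < t)
    (x : Space d) :
    kernelG ρ t x = ((2 * Real.pi) ^ d)⁻¹ *
      ∫ ξ : Space d, Real.exp (-t * charExponent ρ ξ) * Real.cos ⟪x, ξ⟫ := by
  rw [kernelG, kernelC_eq hρ hρ0 ht, Complex.ofReal_re]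

lemma kernelC_eq_kernelG (hρ : ρ (Set.Ioo (0 : ℝ) 2)ᶜ = 0) (hρ0 : ρ ≠ 0) {t : ℝ} (ht : 0 < t)
    (x : Space d) : kernelC ρ t x = ((kernelG ρ t x : ℝ) : ℂ) := by
  rw [kernelG_eq hρ hρ0 ht, kernelC_eq hρ hρ0 ht]

lemma continuousOn_kernelG (hρ : ρ (Set.Ioo (0 : ℝ) 2)ᶜ = 0) (hρ0 : ρ ≠ 0) :
    ContinuousOn (fun p : ℝ × Space d => kernelG ρ p.1 p.2) (Set.Ioi 0 ×ˢ Set.univ) := by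
  have h := (continuousOn_integral_mul_exp_mul_cos hρ hρ0 (n := 0) (C := 1)
    (g := fun _ : Space d => 1) continuous_const (by simp)).const_smul ((2 * Real.pi) ^ d)⁻¹
  refine h.congr fun p hp => ?_
  simp only [kernelG_eq hρ hρ0 hp.1, one_mul, Pi.smul_apply, smul_eq_mul]

lemma continuous_kernelG (hρ : ρ (Set.Ioo (0 : ℝ) 2)ᶜ = 0) (hρ0 : ρ ≠ 0) {t : ℝ} (ht : 0 < t) :
    Continuous (kernelG (d := d) ρ t) := by
  refine (continuousOn_kernelG hρ hρ0).comp_continuous (f := fun x : Space d => (t, x))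
    (by fun_prop) fun x => ⟨ht, trivial⟩

lemma hasDerivAt_kernelG (hρ : ρ (Set.Ioo (0 : ℝ) 2)ᶜ = 0) (hρ0 : ρ ≠ 0) {t : ℝ} (ht : 0 < t)
    (x : Space d) :
    HasDerivAt (fun s => kernelG ρ s x) (((2 * Real.pi) ^ d)⁻¹ *
      ∫ ξ, -charExponent ρ ξ * Real.exp (-t * charExponent ρ ξ) * Real.cos ⟪x, ξ⟫) t := by
  refine ((hasDerivAt_integral_mul_exp_mul_cos hρ hρ0 ht x).const_mul
    ((2 * Real.pi) ^ d)⁻¹).congr_of_eventuallyEq ?_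
  filter_upwards [Ioi_mem_nhds ht] with s hs using kernelG_eq hρ hρ0 hs x

lemma continuousOn_deriv_kernelG (hρ : ρ (Set.Ioo (0 : ℝ) 2)ᶜ = 0) (hρ0 : ρ ≠ 0) :
    ContinuousOn (fun p : ℝ × Space d => deriv (fun s => kernelG ρ s p.2) p.1)
      (Set.Ioi 0 ×ˢ Set.univ) := by
  have h := (continuousOn_integral_mul_exp_mul_cos hρ hρ0 (n := 2) (C := ρ.real Set.univ)
    (g := fun ξ : Space d => -charExponent ρ ξ) (continuous_charExponent hρ).neg
    (fun ξ => by rw [abs_neg, abs_of_nonneg (charExponent_nonneg ρ ξ)]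
                 exact charExponent_le hρ ξ)).const_smul ((2 * Real.pi) ^ d)⁻¹
  refine h.congr fun p hp => ?_
  simp only [(hasDerivAt_kernelG hρ hρ0 hp.1 p.2).deriv, Pi.smul_apply, smul_eq_mul]

/-- Dictionary with the transform `𝓕`, whose phase is e^{-2πi⟨·,·⟩}: hence the dilation by 2π and
the factor (2π)^d. -/
lemma fourier_exp_neg_mul_charExponent (hρ : ρ (Set.Ioo (0 : ℝ) 2)ᶜ = 0) (hρ0 : ρ ≠ 0) {t : ℝ}
    (ht : 0 < t) (w : Space d) :
    𝓕 (fun ξ : Space d => ((Real.exp (-t * charExponent ρ ξ) : ℝ) : ℂ)) w =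
      (((2 * Real.pi) ^ d * kernelG ρ t ((2 * Real.pi) • w) : ℝ) : ℂ) := by
  rw [Complex.ofReal_mul, ← kernelC_eq_kernelG hρ hρ0 ht, kernelC, ← mul_assoc, one_div,
    Complex.ofReal_pow, mul_inv_cancel₀ (by simp [Real.pi_ne_zero]), one_mul, Real.fourier_eq']
  refine integral_congr_ae (ae_of_all _ fun ξ => ?_)
  simp only [kernelIntegrand, levySymbol_eq, smul_eq_mul]
  rw [Complex.ofReal_exp, ← Complex.exp_add, inner_smul_left, real_inner_comm w ξ]
  congr 1
  simp only [RCLike.conj_to_real]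
  push_cast
  ring

/-- The moments of e^{-tψ} up to order 2 are finite, so its Fourier transform is C²; the kernel is a
dilate of that transform. -/
lemma contDiff_kernelG (hρ : ρ (Set.Ioo (0 : ℝ) 2)ᶜ = 0) (hρ0 : ρ ≠ 0) {t : ℝ} (ht : 0 < t) :
    ContDiff ℝ 2 (kernelG (d := d) ρ t) := by
  have hc := continuous_charExponent (d := d) hρ
  have h : ContDiff ℝ ((2 : ℕ∞) : WithTop ℕ∞)
      (𝓕 (fun ξ : Space d => ((Real.exp (-t * charExponent ρ ξ) : ℝ) : ℂ))) := by
    refine Real.contDiff_fourier fun n _ => ?_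
    refine (integrable_pow_mul_exp (d := d) hρ hρ0 n ht).mono' (by fun_prop)
      (ae_of_all _ fun ξ => ?_)
    rw [norm_mul, norm_pow, norm_norm, norm_norm, Complex.norm_real,
      Real.norm_of_nonneg (Real.exp_pos _).le]
    gcongr
    linarith [norm_nonneg ξ]
  have h2 : ContDiff ℝ 2 (fun x : Space d => ((2 * Real.pi) ^ d)⁻¹ *
      Complex.reCLM (𝓕 (fun ξ : Space d => ((Real.exp (-t * charExponent ρ ξ) : ℝ) : ℂ))
        ((2 * Real.pi)⁻¹ • x))) := by
    have h' : ContDiff ℝ 2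
      (𝓕 (fun ξ : Space d => ((Real.exp (-t * charExponent ρ ξ) : ℝ) : ℂ))) := h
    exact contDiff_const.mul (Complex.reCLM.contDiff.comp (h'.comp (contDiff_const_smul _)))
  convert h2 using 2 with x
  rw [fourier_exp_neg_mul_charExponent hρ hρ0 ht, Complex.reCLM_apply, Complex.ofReal_re,
    smul_smul, mul_inv_cancel₀ (by simp [Real.pi_ne_zero]), one_smul, ← mul_assoc,
    inv_mul_cancel₀ (by simp [Real.pi_ne_zero]), one_mul]

end Kernel


/-! ### Positivity of Gaussian-smoothed inverse Fourier transforms -/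

lemma integral_gaussian_mul_cexp {d : ℕ} {δ : ℝ} (hδ : 0 < δ) (z : Space d) :
    ∫ ξ : Space d, ((Real.exp (-δ * ‖ξ‖ ^ 2) : ℝ) : ℂ) *
      Complex.exp (((⟪z, ξ⟫ : ℝ) : ℂ) * Complex.I) =
    (((Real.pi / δ) ^ ((d : ℝ) / 2) * Real.exp (-‖z‖ ^ 2 / (4 * δ)) : ℝ) : ℂ) := by
  have h := GaussianFourier.integral_cexp_neg_mul_sq_norm_add (V := Space d) (b := (δ : ℂ))
    (by simpa using hδ) Complex.I z
  have e : ((Real.pi : ℂ) / δ) ^ (Module.finrank ℝ (Space d) / 2 : ℂ) *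
        Complex.exp (Complex.I ^ 2 * ‖z‖ ^ 2 / (4 * δ)) =
        (((Real.pi / δ) ^ ((d : ℝ) / 2) * Real.exp (-‖z‖ ^ 2 / (4 * δ)) : ℝ) : ℂ) := by
    rw [Complex.ofReal_mul, Complex.ofReal_cpow (by positivity)]
    push_cast
    simp
  rw [← e, ← h]
  congr 1; ext ξ
  rw [Complex.ofReal_exp, ← Complex.exp_add]
  congr 1
  push_cast
  ring

/-- A bounded function whose Gaussian-smoothed inverse Fourier transforms have nonnegative real
part. -/
structure IsFourierPositive {d : ℕ} (φ : Space d → ℂ) : Prop where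
  measurable : Measurable φ
  norm_le : ∀ ξ, ‖φ ξ‖ ≤ 1
  nonneg : ∀ δ : ℝ, 0 < δ → ∀ x : Space d,
    0 ≤ (∫ ξ : Space d, ((Real.exp (-δ * ‖ξ‖ ^ 2) : ℝ) : ℂ) * φ ξ *
      Complex.exp (-((⟪x, ξ⟫ : ℝ) : ℂ) * Complex.I)).re

lemma norm_cexp_neg_inner_mul_I {d : ℕ} (x ξ : Space d) :
    ‖Complex.exp (-((⟪x, ξ⟫ : ℝ) : ℂ) * Complex.I)‖ = 1 := by
  rw [← Complex.ofReal_neg]; exact Complex.norm_exp_ofReal_mul_I _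

/-- The Gaussian factor dominates every integral, so pointwise convergence suffices even when the
functions themselves are not integrable. This closure property is the reason for smoothing. -/
lemma IsFourierPositive.of_tendsto {d : ℕ} {φ : ℕ → Space d → ℂ} {ψ : Space d → ℂ}
    (h : ∀ᶠ n in atTop, IsFourierPositive (φ n))
    (hl : ∀ ξ, Tendsto (fun n => φ n ξ) atTop (𝓝 (ψ ξ))) : IsFourierPositive ψ := by
  obtain ⟨N, hN⟩ := eventually_atTop.1 h
  have hl' : ∀ ξ, Tendsto (fun n => φ (n + N) ξ) atTop (𝓝 (ψ ξ)) := fun ξ =>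
    (hl ξ).comp (tendsto_add_atTop_nat N)
  have hφ : ∀ n, IsFourierPositive (φ (n + N)) := fun n => hN _ (Nat.le_add_left _ _)
  refine ⟨measurable_of_tendsto_metrizable (fun n => (hφ n).measurable) (tendsto_pi_nhds.2 hl'),
    fun ξ => le_of_tendsto (hl' ξ).norm (Eventually.of_forall fun n => (hφ n).norm_le ξ),
    fun δ hδ x => ?_⟩
  have ht : Tendsto (fun n => ∫ ξ : Space d, ((Real.exp (-δ * ‖ξ‖ ^ 2) : ℝ) : ℂ) * φ (n + N) ξ *
      Complex.exp (-((⟪x, ξ⟫ : ℝ) : ℂ) * Complex.I)) atTop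
      (𝓝 (∫ ξ : Space d, ((Real.exp (-δ * ‖ξ‖ ^ 2) : ℝ) : ℂ) * ψ ξ *
      Complex.exp (-((⟪x, ξ⟫ : ℝ) : ℂ) * Complex.I))) := by
    refine tendsto_integral_of_dominated_convergence _ (fun n => ?_)
      (integrable_exp_neg_mul_sq_norm hδ) (fun n => ae_of_all _ fun ξ => ?_)
      (ae_of_all _ fun ξ => ((hl' ξ).const_mul _).mul_const _)
    · have := (hφ n).measurable
      fun_prop
    · rw [norm_mul, norm_mul, norm_cexp_neg_inner_mul_I, mul_one, Complex.norm_real,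
        Real.norm_of_nonneg (Real.exp_pos _).le]
      exact mul_le_of_le_one_right (Real.exp_pos _).le ((hφ n).norm_le ξ)
  exact ge_of_tendsto ((Complex.continuous_re.tendsto _).comp ht)
    (Eventually.of_forall fun n => (hφ n).nonneg δ hδ x)

/-- By Fubini the smoothed inverse transform at x is the μ-average of a positive Gaussian in y - x.
-/
lemma isFourierPositive_charFun {d : ℕ} (μ : Measure (Space d)) [IsProbabilityMeasure μ] :
    IsFourierPositive (charFun μ) := by
  refine ⟨measurable_charFun, fun ξ => norm_charFun_le_one ξ, fun δ hδ x => ?_⟩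
  have hI : Integrable (fun p : Space d × Space d => ((Real.exp (-δ * ‖p.1‖ ^ 2) : ℝ) : ℂ) *
      Complex.exp (((⟪p.2 - x, p.1⟫ : ℝ) : ℂ) * Complex.I)) (volume.prod μ) := by
    have h0 : Integrable (fun p : Space d × Space d => Real.exp (-δ * ‖p.1‖ ^ 2))
        (volume.prod μ) := (integrable_exp_neg_mul_sq_norm hδ).comp_fst μ
    refine h0.mono' (by fun_prop) (ae_of_all _ fun p => ?_)
    rw [norm_mul, Complex.norm_exp_ofReal_mul_I, mul_one, Complex.norm_real,
      Real.norm_of_nonneg (Real.exp_pos _).le]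
  have h1 : ∀ ξ : Space d, ((Real.exp (-δ * ‖ξ‖ ^ 2) : ℝ) : ℂ) * charFun μ ξ *
      Complex.exp (-((⟪x, ξ⟫ : ℝ) : ℂ) * Complex.I) =
      ∫ y, ((Real.exp (-δ * ‖ξ‖ ^ 2) : ℝ) : ℂ) *
        Complex.exp (((⟪y - x, ξ⟫ : ℝ) : ℂ) * Complex.I) ∂μ := by
    intro ξ
    rw [charFun_apply, ← integral_const_mul, ← integral_mul_const]
    congr 1; ext y
    rw [mul_assoc, ← Complex.exp_add, inner_sub_left]
    push_cast
    ring_nf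
  simp_rw [h1]
  rw [integral_integral_swap hI]
  simp_rw [integral_gaussian_mul_cexp hδ]
  rw [integral_complex_ofReal, Complex.ofReal_re]
  exact integral_nonneg fun y => by positivity

lemma exists_charFun_eq_pow {d : ℕ} (μ : Measure (Space d)) [IsProbabilityMeasure μ] (n : ℕ) :
    ∃ ν : Measure (Space d), IsProbabilityMeasure ν ∧ ∀ ξ, charFun ν ξ = charFun μ ξ ^ n := by
  induction n with
  | zero => exact ⟨Measure.dirac 0, inferInstance, fun ξ => by simp⟩
  | succ n ih =>
    obtain ⟨ν, hν, h⟩ := ih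
    exact ⟨ν.conv μ, inferInstance, fun ξ => by rw [charFun_conv, h, pow_succ]⟩

/-- The compound Poisson exponent of a finite measure gives a Fourier positive function. -/
lemma isFourierPositive_exp_charFun_sub {d : ℕ} (ν : Measure (Space d)) [IsFiniteMeasure ν] {t : ℝ}
    (ht : 0 < t) :
    IsFourierPositive fun ξ => Complex.exp (t * (charFun ν ξ - ν.real Set.univ)) := by
  set l := ν.real Set.univ with hl
  have hl0 : 0 ≤ l := measureReal_nonneg
  refine IsFourierPositive.of_tendsto
    (φ := fun n ξ => (1 + (t * (charFun ν ξ - l)) / n) ^ n) ?_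
    fun ξ => Complex.tendsto_one_add_div_pow_exp _
  filter_upwards [eventually_ge_atTop ⌈t * l⌉₊, eventually_ge_atTop 1] with n hn hn1
  have hn0 : (0 : ℝ) < n := by exact_mod_cast hn1
  have hle : t * l / n ≤ 1 := by
    rw [div_le_one hn0]; exact (Nat.le_ceil _).trans (by exact_mod_cast hn)
  -- A step that jumps with probability tl/n: it is a probability measure once n ≥ tl, and its
  -- characteristic function is 1 + t(ν̂ - l)/n. The n-th power belongs to an n-fold convolution and
  -- tends to the compound Poisson exponential.
  set μ : Measure (Space d) := ENNReal.ofReal (1 - t * l / n) • Measure.dirac 0 +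
    ENNReal.ofReal (t / n) • ν with hμ
  have hp : IsProbabilityMeasure μ := by
    constructor
    rw [hμ]
    simp only [Measure.add_apply, Measure.smul_apply, measure_univ, smul_eq_mul, mul_one]
    rw [← ofReal_measureReal (μ := ν) (s := Set.univ), ← hl, ← ENNReal.ofReal_mul (by positivity),
      ← ENNReal.ofReal_add (by linarith) (by positivity), ← ENNReal.ofReal_one]
    congr 1; ring
  have hc : ∀ ξ, charFun μ ξ = 1 + (t * (charFun ν ξ - l)) / n := by
    intro ξ
    have hb : ∀ m : Measure (Space d), IsFiniteMeasure m →
        Integrable (fun x : Space d => Complex.exp (((⟪x, ξ⟫ : ℝ) : ℂ) * Complex.I)) m := by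
      intro m hm
      refine (integrable_const (1 : ℝ)).mono' (by fun_prop) (ae_of_all _ fun x => ?_)
      rw [Complex.norm_exp_ofReal_mul_I]
    rw [charFun_apply, hμ, integral_add_measure
      ((hb _ inferInstance).smul_measure ENNReal.ofReal_ne_top)
      ((hb _ inferInstance).smul_measure ENNReal.ofReal_ne_top),
      integral_smul_measure, integral_smul_measure, ← charFun_apply, ← charFun_apply, charFun_dirac,
      ENNReal.toReal_ofReal (by linarith), ENNReal.toReal_ofReal (by positivity)]
    simp only [inner_zero_left, Complex.ofReal_zero, zero_mul, Complex.exp_zero,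
      Complex.real_smul, mul_one]
    push_cast
    ring
  obtain ⟨ν', hν', h⟩ := exists_charFun_eq_pow μ n
  have := isFourierPositive_charFun ν'
  convert this using 1
  ext ξ
  rw [h, hc]

lemma charExponent_zero {d : ℕ} {ρ : Measure ℝ} (hρ : ρ (Set.Ioo (0 : ℝ) 2)ᶜ = 0) :
    charExponent ρ (0 : Space d) = 0 := by
  refine integral_eq_zero_of_ae ?_
  filter_upwards [ae_mem_Ioo hρ] with α hα
  simp [Real.zero_rpow hα.1.ne']

/-! ### Positivity of the kernel -/

section Positivity

open scoped FourierTransform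

variable {d : ℕ} {ρ : Measure ℝ} [IsFiniteMeasure ρ]

lemma integrableOn_levyDensity (hd : 1 ≤ d) (hρ : ρ (Set.Ioo (0 : ℝ) 2)ᶜ = 0) {ε : ℝ}
    (hε : 0 < ε) : IntegrableOn (levyDensity (d := d) ρ) {y | ε ≤ ‖y‖} := by
  have hm : MeasurableSet {y : Space d | ε ≤ ‖y‖} := measurableSet_le (by fun_prop) (by fun_prop)
  refine ((integrable_truncSq_mul_levyDensity (d := d) hρ).integrableOn.const_mul
    (min 1 (ε ^ 2))⁻¹).mono' (measurable_levyDensity hd hρ).aestronglyMeasurable ?_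
  filter_upwards [ae_restrict_mem hm] with y hy
  have hy : ε ≤ ‖y‖ := hy
  have h0 := levyDensity_nonneg hρ y
  have hpos : 0 < min 1 (ε ^ 2) := by positivity
  rw [Real.norm_of_nonneg h0, inv_mul_eq_div, le_div_iff₀ hpos, mul_comm]
  refine mul_le_mul_of_nonneg_right ?_ h0
  exact min_le_min le_rfl (by gcongr)

/-- Outside a ball K is integrable, so it defines a finite jump measure and the compound Poisson
case applies; the measure is symmetric, which makes its characteristic function a cosine integral.
-/
lemma isFourierPositive_truncated (hd : 1 ≤ d) (hρ : ρ (Set.Ioo (0 : ℝ) 2)ᶜ = 0) {t ε : ℝ}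
    (ht : 0 < t) (hε : 0 < ε) :
    IsFourierPositive fun ξ : Space d => ((Real.exp (-t *
      ∫ y in {y : Space d | ε ≤ ‖y‖}, (2 * (1 - Real.cos ⟪ξ, y⟫)) * levyDensity ρ y) : ℝ) : ℂ) := by
  set A : Set (Space d) := {y | ε ≤ ‖y‖} with hA
  have hm : MeasurableSet A := measurableSet_le (by fun_prop) (by fun_prop)
  have hK := integrableOn_levyDensity (d := d) hd hρ hε
  have hKm := measurable_levyDensity (d := d) hd hρ
  have hK0 : ∀ᵐ y ∂(volume.restrict A), 0 ≤ levyDensity ρ y :=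
    ae_of_all _ fun y => levyDensity_nonneg hρ y
  set ν : Measure (Space d) :=
    (volume.restrict A).withDensity fun y => ENNReal.ofReal (levyDensity ρ y) with hν
  have hfin : IsFiniteMeasure ν := isFiniteMeasure_withDensity_ofReal hK.2
  have hint : ∀ f : Space d → ℂ, ∫ y, f y ∂ν = ∫ y in A, (levyDensity ρ y : ℂ) * f y := by
    intro f
    rw [hν, integral_withDensity_eq_integral_toReal_smul (by fun_prop)
      (ae_of_all _ fun _ => ENNReal.ofReal_lt_top)]
    refine integral_congr_ae (ae_of_all _ fun y => ?_)
    simp only [ENNReal.toReal_ofReal (levyDensity_nonneg hρ y), Complex.real_smul]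
  have hmass : ((ν.real Set.univ : ℝ) : ℂ) = ((∫ y in A, levyDensity ρ y : ℝ) : ℂ) := by
    have := hint fun _ => 1
    simp only [integral_const, mul_one, Complex.real_smul] at this
    rw [this, integral_complex_ofReal]
  have hbdd : ∀ g : Space d → ℝ, Continuous g → (∀ y, |g y| ≤ 1) →
      IntegrableOn (fun y => levyDensity ρ y * g y) A := fun g hg hg1 => by
    refine Integrable.mono hK (hKm.mul hg.measurable).aestronglyMeasurable
      (ae_of_all _ fun y => ?_)
    rw [norm_mul]
    exact mul_le_of_le_one_right (norm_nonneg _) (hg1 y)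
  have hchar : ∀ ξ, charFun ν ξ = ((∫ y in A, levyDensity ρ y * Real.cos ⟪ξ, y⟫ : ℝ) : ℂ) := by
    intro ξ
    have h0 : ∫ y in A, levyDensity ρ y * Real.sin ⟪ξ, y⟫ = 0 := by
      have h := integral_neg_eq_self
        (fun y : Space d => A.indicator (fun y => levyDensity ρ y * Real.sin ⟪ξ, y⟫) y) volume
      have e : (fun y : Space d => A.indicator (fun y => levyDensity ρ y * Real.sin ⟪ξ, y⟫) (-y)) =
          fun y => -(A.indicator (fun y => levyDensity ρ y * Real.sin ⟪ξ, y⟫) y) := by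
        ext y
        by_cases hy : y ∈ A
        · have : -y ∈ A := by simpa [hA] using hy
          simp [hy, this, levyDensity]
        · have : -y ∉ A := by simpa [hA] using hy
          simp [hy, this]
      rw [e, integral_neg, integral_indicator hm] at h
      linarith
    rw [charFun_apply, hint]
    have e : ∀ y : Space d, (levyDensity ρ y : ℂ) *
        Complex.exp (((⟪y, ξ⟫ : ℝ) : ℂ) * Complex.I) =
        ((levyDensity ρ y * Real.cos ⟪ξ, y⟫ : ℝ) : ℂ) +
        ((levyDensity ρ y * Real.sin ⟪ξ, y⟫ : ℝ) : ℂ) * Complex.I := by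
      intro y
      rw [Complex.exp_mul_I, real_inner_comm]
      push_cast
      ring
    simp_rw [e]
    rw [integral_add (hbdd _ (by fun_prop) fun y => Real.abs_cos_le_one _).ofReal
      ((hbdd _ (by fun_prop) fun y => Real.abs_sin_le_one _).ofReal.mul_const _),
      integral_mul_const, integral_complex_ofReal, integral_complex_ofReal, h0]
    simp
  -- Running for time 2t accounts for the factor 2 in 2(1 - cos).
  have h := isFourierPositive_exp_charFun_sub ν (t := 2 * t) (by positivity)
  convert h using 1
  ext ξ
  rw [hmass, hchar, ← Complex.ofReal_sub, ← Complex.ofReal_mul, ← Complex.ofReal_exp]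
  congr 2
  have e : ∀ y : Space d, (2 * (1 - Real.cos ⟪ξ, y⟫)) * levyDensity ρ y =
      2 * (levyDensity ρ y - levyDensity ρ y * Real.cos ⟪ξ, y⟫) := fun y => by ring
  simp_rw [e]
  rw [integral_const_mul, integral_sub hK (hbdd _ (by fun_prop) fun y => Real.abs_cos_le_one _)]
  ring

/-- Let the truncation radius 1/(n+1) tend to 0. For each y ≠ 0 the truncated integrand is
eventually the full one, and the full one dominates. -/
lemma isFourierPositive_exp_neg_mul_charExponent (hd : 1 ≤ d)
    (hρ : ρ (Set.Ioo (0 : ℝ) 2)ᶜ = 0) {t : ℝ} (ht : 0 < t) :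
    IsFourierPositive fun ξ : Space d => ((Real.exp (-t * charExponent ρ ξ) : ℝ) : ℂ) := by
  refine IsFourierPositive.of_tendsto (φ := fun n ξ => ((Real.exp (-t *
      ∫ y in {y : Space d | 1 / ((n : ℝ) + 1) ≤ ‖y‖},
        (2 * (1 - Real.cos ⟪ξ, y⟫)) * levyDensity ρ y) : ℝ) : ℂ))
    (Eventually.of_forall fun n => isFourierPositive_truncated hd hρ ht (by positivity))
    fun ξ => ?_
  have hI := integrable_one_sub_cos_mul_levyDensity hd hρ ξ
  have hlim : Tendsto (fun n : ℕ => ∫ y in {y : Space d | 1 / ((n : ℝ) + 1) ≤ ‖y‖},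
        (2 * (1 - Real.cos ⟪ξ, y⟫)) * levyDensity ρ y) atTop (𝓝 (charExponent ρ ξ)) := by
    rw [charExponent, ← integral_one_sub_cos_mul_levyDensity hd hρ ξ]
    have hms : ∀ n : ℕ, MeasurableSet {y : Space d | 1 / ((n : ℝ) + 1) ≤ ‖y‖} := fun n =>
      measurableSet_le (by fun_prop) (by fun_prop)
    simp_rw [← integral_indicator (hms _)]
    refine tendsto_integral_of_dominated_convergence _ (fun n => ?_) hI.norm
      (fun n => ae_of_all _ fun y => norm_indicator_le_norm_self _ _) ?_
    · exact (hI.1.indicator (hms n))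
    · filter_upwards [ae_ne_zero hd] with y hy
      refine tendsto_const_nhds.congr' ?_
      obtain ⟨N, hN⟩ := exists_nat_one_div_lt (norm_pos_iff.2 hy)
      filter_upwards [eventually_ge_atTop N] with n hn
      rw [Set.indicator_of_mem]
      refine le_trans ?_ hN.le
      simp only [one_div]
      gcongr
  exact (Complex.continuous_ofReal.tendsto _).comp
    ((Real.continuous_exp.tendsto _).comp (hlim.const_mul (-t)))

/-- Since e^{-tψ} is itself integrable, the Gaussian smoothing can be removed by letting δ = 1/(n+1)
tend to 0. -/
lemma kernelG_nonneg (hd : 1 ≤ d) (hρ : ρ (Set.Ioo (0 : ℝ) 2)ᶜ = 0) (hρ0 : ρ ≠ 0) {t : ℝ}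
    (ht : 0 < t) (x : Space d) : 0 ≤ kernelG ρ t x := by
  have hpos := isFourierPositive_exp_neg_mul_charExponent (d := d) hd hρ ht
  have hc := continuous_charExponent (d := d) hρ
  have hlim : Tendsto (fun n : ℕ => ∫ ξ : Space d,
      ((Real.exp (-(1 / ((n : ℝ) + 1)) * ‖ξ‖ ^ 2) : ℝ) : ℂ) *
      ((Real.exp (-t * charExponent ρ ξ) : ℝ) : ℂ) *
      Complex.exp (-((⟪x, ξ⟫ : ℝ) : ℂ) * Complex.I)) atTop
      (𝓝 (∫ ξ : Space d, kernelIntegrand ρ t x ξ)) := by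
    refine tendsto_integral_of_dominated_convergence _ (fun n => by fun_prop)
      (integrable_exp_neg_mul_charExponent hρ hρ0 ht) (fun n => ae_of_all _ fun ξ => ?_)
      (ae_of_all _ fun ξ => ?_)
    · rw [norm_mul, norm_mul, norm_cexp_neg_inner_mul_I, mul_one, Complex.norm_real,
        Complex.norm_real, Real.norm_of_nonneg (Real.exp_pos _).le,
        Real.norm_of_nonneg (Real.exp_pos _).le]
      refine mul_le_of_le_one_left (Real.exp_pos _).le (Real.exp_le_one_iff.2 ?_)
      have : 0 ≤ 1 / ((n : ℝ) + 1) * ‖ξ‖ ^ 2 := by positivity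
      linarith
    · have e : kernelIntegrand ρ t x ξ = ((Real.exp (-0 * ‖ξ‖ ^ 2) : ℝ) : ℂ) *
          ((Real.exp (-t * charExponent ρ ξ) : ℝ) : ℂ) *
          Complex.exp (-((⟪x, ξ⟫ : ℝ) : ℂ) * Complex.I) := by
        rw [kernelIntegrand, levySymbol_eq]
        simp only [neg_zero, zero_mul, Real.exp_zero, Complex.ofReal_one, one_mul]
        rw [Complex.ofReal_exp, ← Complex.exp_add]
        congr 1; push_cast; ring
      rw [e]
      refine Tendsto.mul_const _ (Tendsto.mul_const _ ?_)
      have hc2 : Continuous fun r : ℝ => ((Real.exp (-r * ‖ξ‖ ^ 2) : ℝ) : ℂ) := by fun_prop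
      exact (hc2.tendsto 0).comp tendsto_one_div_add_atTop_nhds_zero_nat
  have h1 : 0 ≤ (∫ ξ : Space d, kernelIntegrand ρ t x ξ).re :=
    ge_of_tendsto ((Complex.continuous_re.tendsto _).comp hlim)
      (Eventually.of_forall fun n => hpos.nonneg _ (by positivity) x)
  have h3 : kernelG ρ t x = ((2 * Real.pi) ^ d)⁻¹ * (∫ ξ : Space d, kernelIntegrand ρ t x ξ).re := by
    rw [kernelG, kernelC, one_div, ← Complex.ofReal_inv, Complex.re_ofReal_mul]
  rw [h3]
  positivity

/-! ### Integrability and Fourier transform of the kernel -/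

lemma abs_kernelG_le (hρ : ρ (Set.Ioo (0 : ℝ) 2)ᶜ = 0) (hρ0 : ρ ≠ 0) {t : ℝ} (ht : 0 < t) :
    ∃ C, ∀ x : Space d, |kernelG ρ t x| ≤ C := by
  have hi := integrable_exp_neg_mul_charExponent (d := d) hρ hρ0 ht
  refine ⟨((2 * Real.pi) ^ d)⁻¹ * ∫ ξ : Space d, Real.exp (-t * charExponent ρ ξ), fun x => ?_⟩
  rw [kernelG_eq hρ hρ0 ht, abs_mul, abs_of_pos (by positivity)]
  refine mul_le_mul_of_nonneg_left ?_ (by positivity)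
  rw [← Real.norm_eq_abs]
  refine norm_integral_le_of_norm_le hi (ae_of_all _ fun ξ => ?_)
  rw [norm_mul, Real.norm_of_nonneg (Real.exp_pos _).le]
  exact mul_le_of_le_one_right (Real.exp_pos _).le (Real.abs_cos_le_one _)

/-- Fubini moves the Gaussian to the frequency side, where it becomes a Gaussian of total mass
(2π)^d; then e^{-tψ} ≤ 1. The bound is independent of δ. -/
lemma lintegral_kernelG_mul_gaussian_le (hd : 1 ≤ d) (hρ : ρ (Set.Ioo (0 : ℝ) 2)ᶜ = 0)
    (hρ0 : ρ ≠ 0) {t δ : ℝ} (ht : 0 < t) (hδ : 0 < δ) :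
    ∫⁻ x : Space d, ENNReal.ofReal (kernelG ρ t x * Real.exp (-δ * ‖x‖ ^ 2)) ≤ 1 := by
  have hc := continuous_charExponent (d := d) hρ
  have hG := continuous_kernelG (d := d) hρ hρ0 ht
  have hn := fun x : Space d => kernelG_nonneg hd hρ hρ0 ht x
  have hi := integrable_exp_neg_mul_charExponent (d := d) hρ hρ0 ht
  have hg := integrable_exp_neg_mul_sq_norm (d := d) hδ
  obtain ⟨C, hC⟩ := abs_kernelG_le (d := d) hρ hρ0 ht
  have hint : Integrable fun x : Space d => kernelG ρ t x * Real.exp (-δ * ‖x‖ ^ 2) := by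
    refine (hg.const_mul C).mono' (by fun_prop) (ae_of_all _ fun x => ?_)
    rw [norm_mul, Real.norm_of_nonneg (Real.exp_pos _).le]
    exact mul_le_mul_of_nonneg_right (hC x) (Real.exp_pos _).le
  rw [← ofReal_integral_eq_lintegral_ofReal hint
    (ae_of_all _ fun x => mul_nonneg (hn x) (Real.exp_pos _).le), ← ENNReal.ofReal_one]
  refine ENNReal.ofReal_le_ofReal ?_
  have hI : Integrable (fun p : Space d × Space d => (Real.exp (-δ * ‖p.1‖ ^ 2) *
      Real.exp (-t * charExponent ρ p.2)) * Real.cos ⟪p.1, p.2⟫) (volume.prod volume) := by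
    refine (hg.mul_prod hi).mono (by fun_prop) (ae_of_all _ fun p => ?_)
    rw [norm_mul]
    exact mul_le_of_le_one_right (norm_nonneg _) (Real.abs_cos_le_one _)
  have e1 : ∀ x : Space d, kernelG ρ t x * Real.exp (-δ * ‖x‖ ^ 2) =
      ((2 * Real.pi) ^ d)⁻¹ * ∫ ξ : Space d, (Real.exp (-δ * ‖x‖ ^ 2) *
      Real.exp (-t * charExponent ρ ξ)) * Real.cos ⟪x, ξ⟫ := by
    intro x
    simp_rw [mul_assoc (Real.exp (-δ * ‖x‖ ^ 2))]
    rw [kernelG_eq hρ hρ0 ht, integral_const_mul]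
    ring
  simp_rw [e1]
  rw [integral_const_mul, integral_integral_swap (f := fun x ξ : Space d =>
    (Real.exp (-δ * ‖x‖ ^ 2) * Real.exp (-t * charExponent ρ ξ)) * Real.cos ⟪x, ξ⟫) hI]
  have e2 : ∀ ξ : Space d, ∫ x : Space d, (Real.exp (-δ * ‖x‖ ^ 2) *
      Real.exp (-t * charExponent ρ ξ)) * Real.cos ⟪x, ξ⟫ =
      Real.exp (-t * charExponent ρ ξ) *
      ((Real.pi / δ) ^ ((d : ℝ) / 2) * Real.exp (-‖ξ‖ ^ 2 / (4 * δ))) := by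
    intro ξ
    rw [← integral_exp_neg_mul_sq_norm_mul_cos hδ, ← integral_const_mul]
    congr 1; ext x
    rw [real_inner_comm]; ring
  simp_rw [e2]
  have hg' := integrable_exp_neg_mul_sq_norm (d := d) (s := 1 / (4 * δ)) (by positivity)
  have e3 : ∫ ξ : Space d, (Real.pi / δ) ^ ((d : ℝ) / 2) * Real.exp (-(1 / (4 * δ)) * ‖ξ‖ ^ 2) =
      (2 * Real.pi) ^ d := by
    rw [integral_const_mul, integral_exp_neg_mul_sq_norm (by positivity),
      ← Real.mul_rpow (by positivity) (by positivity),
      show Real.pi / δ * (Real.pi / (1 / (4 * δ))) = (2 * Real.pi) ^ 2 by field_simp; ring,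
      ← Real.rpow_natCast, ← Real.rpow_mul (by positivity), ← Real.rpow_natCast]
    congr 1; push_cast; ring
  rw [inv_mul_le_iff₀ (by positivity), mul_one, ← e3]
  have hle : ∀ ξ : Space d, Real.exp (-t * charExponent ρ ξ) *
      ((Real.pi / δ) ^ ((d : ℝ) / 2) * Real.exp (-‖ξ‖ ^ 2 / (4 * δ))) ≤
      (Real.pi / δ) ^ ((d : ℝ) / 2) * Real.exp (-(1 / (4 * δ)) * ‖ξ‖ ^ 2) := by
    intro ξ
    have := charExponent_nonneg ρ ξ
    rw [show -(1 / (4 * δ)) * ‖ξ‖ ^ 2 = -‖ξ‖ ^ 2 / (4 * δ) by ring]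
    exact mul_le_of_le_one_left (by positivity) (Real.exp_le_one_iff.2 (by nlinarith))
  refine integral_mono_of_nonneg (ae_of_all _ fun ξ => ?_) (hg'.const_mul _) (ae_of_all _ hle)
  simp only [Pi.zero_apply]; positivity

/-- Fatou's lemma as δ → 0, using that the kernel is nonnegative. -/
lemma integrable_kernelG (hd : 1 ≤ d) (hρ : ρ (Set.Ioo (0 : ℝ) 2)ᶜ = 0)
    (hρ0 : ρ ≠ 0) {t : ℝ} (ht : 0 < t) : Integrable (kernelG (d := d) ρ t) := by
  have hG := continuous_kernelG (d := d) hρ hρ0 ht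
  have hn := fun x : Space d => kernelG_nonneg hd hρ hρ0 ht x
  refine ⟨hG.aestronglyMeasurable, ?_⟩
  rw [hasFiniteIntegral_iff_ofReal (ae_of_all _ hn)]
  have hl : ∀ x : Space d, Tendsto (fun n : ℕ => ENNReal.ofReal (kernelG ρ t x *
      Real.exp (-(1 / ((n : ℝ) + 1)) * ‖x‖ ^ 2))) atTop (𝓝 (ENNReal.ofReal (kernelG ρ t x))) := by
    intro x
    have hc2 : Continuous fun r : ℝ => ENNReal.ofReal (kernelG ρ t x * Real.exp (-r * ‖x‖ ^ 2)) :=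
      ENNReal.continuous_ofReal.comp (by fun_prop)
    have := (hc2.tendsto 0).comp tendsto_one_div_add_atTop_nhds_zero_nat
    simpa [Function.comp_def] using this
  have h1 : ∫⁻ x : Space d, ENNReal.ofReal (kernelG ρ t x) ≤ 1 := by
    rw [lintegral_congr fun x => ((hl x).liminf_eq).symm]
    refine (lintegral_liminf_le fun n => by fun_prop).trans ?_
    refine liminf_le_of_le (by isBoundedDefault) fun b hb => ?_
    obtain ⟨n, hn⟩ := hb.exists
    exact hn.trans (lintegral_kernelG_mul_gaussian_le hd hρ hρ0 ht (by positivity))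
  exact h1.trans_lt ENNReal.one_lt_top

/-- Fourier inversion: e^{-tψ} is continuous and integrable, and so is its transform, a dilated
kernel. -/
lemma integral_cexp_mul_kernelG (hd : 1 ≤ d) (hρ : ρ (Set.Ioo (0 : ℝ) 2)ᶜ = 0)
    (hρ0 : ρ ≠ 0) {t : ℝ} (ht : 0 < t) (ξ : Space d) :
    ∫ x : Space d, Complex.exp (Complex.I * ((⟪ξ, x⟫ : ℝ) : ℂ)) * ((kernelG ρ t x : ℝ) : ℂ) =
        ((Real.exp (-t * charExponent ρ ξ) : ℝ) : ℂ) := by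
  have hc := continuous_charExponent (d := d) hρ
  have hi := integrable_exp_neg_mul_charExponent (d := d) hρ hρ0 ht
  have hG := integrable_kernelG (d := d) hd hρ hρ0 ht
  have h2π : (0 : ℝ) < 2 * Real.pi := by positivity
  set f : Space d → ℂ := fun ξ => ((Real.exp (-t * charExponent ρ ξ) : ℝ) : ℂ) with hf
  have hF : 𝓕 f = fun w => (((2 * Real.pi) ^ d * kernelG ρ t ((2 * Real.pi) • w) : ℝ) : ℂ) :=
    funext fun w => fourier_exp_neg_mul_charExponent hρ hρ0 ht w
  have hFi : Integrable (𝓕 f) := by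
    rw [hF]
    exact ((hG.comp_smul h2π.ne').const_mul _).ofReal
  have hinv := hi.ofReal.fourierInv_fourier_eq (f := f) hFi (v := ξ)
    (by rw [hf]; fun_prop)
  rw [← show f ξ = ((Real.exp (-t * charExponent ρ ξ) : ℝ) : ℂ) from rfl, ← hinv,
    Real.fourierInv_eq', hF]
  have hs := Measure.integral_comp_smul volume (fun x : Space d => (((2 * Real.pi) ^ d : ℝ) : ℂ) *
    (Complex.exp (Complex.I * ((⟪ξ, x⟫ : ℝ) : ℂ)) * ((kernelG ρ t x : ℝ) : ℂ))) (2 * Real.pi)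
  have e : ∀ v : Space d, Complex.exp (((2 * Real.pi * ⟪v, ξ⟫ : ℝ) : ℂ) * Complex.I) •
      (((2 * Real.pi) ^ d * kernelG ρ t ((2 * Real.pi) • v) : ℝ) : ℂ) =
      (((2 * Real.pi) ^ d : ℝ) : ℂ) *
      (Complex.exp (Complex.I * ((⟪ξ, (2 * Real.pi) • v⟫ : ℝ) : ℂ)) *
        ((kernelG ρ t ((2 * Real.pi) • v) : ℝ) : ℂ)) := by
    intro v
    rw [inner_smul_right, real_inner_comm, smul_eq_mul, mul_comm Complex.I]
    push_cast
    ring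
  simp_rw [e]
  rw [hs, integral_const_mul]
  simp only [finrank_euclideanSpace, Fintype.card_fin, Complex.real_smul]
  rw [← mul_assoc, abs_of_pos (by positivity), ← Complex.ofReal_mul,
    inv_mul_cancel₀ (by positivity), Complex.ofReal_one, one_mul]

lemma integral_kernelG (hd : 1 ≤ d) (hρ : ρ (Set.Ioo (0 : ℝ) 2)ᶜ = 0)
    (hρ0 : ρ ≠ 0) {t : ℝ} (ht : 0 < t) : ∫ x : Space d, kernelG ρ t x = 1 := by
  have h := integral_cexp_mul_kernelG hd hρ hρ0 ht (0 : Space d)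
  have h0 := charExponent_zero (d := d) hρ
  simp only [inner_zero_left, Complex.ofReal_zero, mul_zero, Complex.exp_zero, one_mul, h0,
    Real.exp_zero] at h
  rw [integral_complex_ofReal] at h
  exact_mod_cast h

end Positivity


/-! ### The law with density the kernel -/

section KernelMeasure

variable {d : ℕ} {ρ : Measure ℝ} [IsFiniteMeasure ρ]

/-- The law on `ℝ^d` with density `G^ρ(t,·)`. -/
noncomputable def kernelMeasure (d : ℕ) (ρ : Measure ℝ) (t : ℝ) : Measure (Space d) :=
  volume.withDensity fun x => ENNReal.ofReal (kernelG ρ t x)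

lemma isProbabilityMeasure_kernelMeasure (hd : 1 ≤ d) (hρ : ρ (Set.Ioo (0 : ℝ) 2)ᶜ = 0)
    (hρ0 : ρ ≠ 0) {t : ℝ} (ht : 0 < t) : IsProbabilityMeasure (kernelMeasure d ρ t) := by
  constructor
  rw [kernelMeasure, withDensity_apply _ MeasurableSet.univ, Measure.restrict_univ,
    ← ofReal_integral_eq_lintegral_ofReal (integrable_kernelG hd hρ hρ0 ht)
      (ae_of_all _ (kernelG_nonneg hd hρ hρ0 ht)), integral_kernelG hd hρ hρ0 ht,
    ENNReal.ofReal_one]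

lemma integral_kernelMeasure {F : Type*} [NormedAddCommGroup F] [NormedSpace ℝ F] (hd : 1 ≤ d)
    (hρ : ρ (Set.Ioo (0 : ℝ) 2)ᶜ = 0) (hρ0 : ρ ≠ 0) {t : ℝ} (ht : 0 < t) (f : Space d → F) :
    ∫ x, f x ∂(kernelMeasure d ρ t) = ∫ x, kernelG ρ t x • f x := by
  have := (continuous_kernelG (d := d) hρ hρ0 ht).measurable
  rw [kernelMeasure, integral_withDensity_eq_integral_toReal_smul (by fun_prop)
    (ae_of_all _ fun _ => ENNReal.ofReal_lt_top)]
  refine integral_congr_ae (ae_of_all _ fun x => ?_)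
  simp only [ENNReal.toReal_ofReal (kernelG_nonneg hd hρ hρ0 ht x)]

lemma charFun_kernelMeasure (hd : 1 ≤ d) (hρ : ρ (Set.Ioo (0 : ℝ) 2)ᶜ = 0)
    (hρ0 : ρ ≠ 0) {t : ℝ} (ht : 0 < t) (ξ : Space d) :
    charFun (kernelMeasure d ρ t) ξ = ((Real.exp (-t * charExponent ρ ξ) : ℝ) : ℂ) := by
  rw [charFun_apply, integral_kernelMeasure hd hρ hρ0 ht, ← integral_cexp_mul_kernelG hd hρ hρ0 ht]
  congr 1; ext x
  rw [real_inner_comm, Complex.real_smul, mul_comm, mul_comm Complex.I]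

lemma tendsto_integral_mul_kernelG (hd : 1 ≤ d) (hρ : ρ (Set.Ioo (0 : ℝ) 2)ᶜ = 0)
    (hρ0 : ρ ≠ 0) (φ : BoundedContinuousFunction (Space d) ℝ) :
    Tendsto (fun t => ∫ x, φ x * kernelG ρ t x) (𝓝[>] 0) (𝓝 (φ 0)) := by
  refine tendsto_of_seq_tendsto fun u hu => ?_
  have hu0 : Tendsto u atTop (𝓝 0) := tendsto_nhds_of_tendsto_nhdsWithin hu
  have hev : ∀ᶠ n in atTop, 0 < u n := hu.eventually self_mem_nhdsWithin
  -- The finitely many nonpositive times are replaced by 1, so that every term of the sequence is a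
  -- probability measure.
  set v : ℕ → ℝ := fun n => if 0 < u n then u n else 1 with hv
  have hvpos : ∀ n, 0 < v n := fun n => by
    simp only [hv]; split_ifs with h
    · exact h
    · exact one_pos
  have hvu : v =ᶠ[atTop] u := by
    filter_upwards [hev] with n hn
    simp [hv, hn]
  have hv0 : Tendsto v atTop (𝓝 0) := hu0.congr' hvu.symm
  let μ : ℕ → ProbabilityMeasure (Space d) := fun n =>
    ⟨kernelMeasure d ρ (v n), isProbabilityMeasure_kernelMeasure hd hρ hρ0 (hvpos n)⟩
  let μ₀ : ProbabilityMeasure (Space d) := ⟨Measure.dirac 0, inferInstance⟩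
  have hlim : Tendsto μ atTop (𝓝 μ₀) := by
    refine ProbabilityMeasure.tendsto_of_tendsto_charFun fun ξ => ?_
    have e : ∀ n, charFun (μ n : Measure (Space d)) ξ =
        ((Real.exp (-v n * charExponent ρ ξ) : ℝ) : ℂ) := fun n =>
      charFun_kernelMeasure hd hρ hρ0 (hvpos n) ξ
    simp_rw [e]
    have e0 : charFun (μ₀ : Measure (Space d)) ξ =
        ((Real.exp (-0 * charExponent ρ ξ) : ℝ) : ℂ) := by
      simp [μ₀]
    rw [e0]
    have hc : Continuous fun r : ℝ => ((Real.exp (-r * charExponent ρ ξ) : ℝ) : ℂ) := by fun_prop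
    exact (hc.tendsto 0).comp hv0
  have h := (ProbabilityMeasure.tendsto_iff_forall_integral_tendsto.1 hlim) φ
  have e0 : ∫ x, φ x ∂(μ₀ : Measure (Space d)) = φ 0 := by
    simp [μ₀]
  rw [e0] at h
  refine h.congr' ?_
  filter_upwards [hvu] with n hn
  have : ∫ x, φ x ∂(μ n : Measure (Space d)) = ∫ x, kernelG ρ (v n) x • φ x :=
    integral_kernelMeasure hd hρ hρ0 (hvpos n) _
  rw [this, hn]
  exact integral_congr_ae (ae_of_all _ fun x => mul_comm _ _)

end KernelMeasure

/-! ### The kernel solves the equation -/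

section Equation

variable {d : ℕ} {ρ : Measure ℝ} [IsFiniteMeasure ρ]

/-- Under the Fourier integral the second difference acts as the multiplier -2(1 - cos ξ·y). Fubini
in (y, ξ) then turns the y-integral into |ξ|^α / b(α); it is justified by integrability of |ξ|^α
e^{-tψ}. -/
lemma hypersingular_kernelG (hρ : ρ (Set.Ioo (0 : ℝ) 2)ᶜ = 0)
    (hρ0 : ρ ≠ 0) {t : ℝ} (ht : 0 < t) (x : Space d) {α : ℝ} (hα : α ∈ Set.Ioo (0 : ℝ) 2) :
    Integrable (hypersingularIntegrand α (kernelG ρ t) x) ∧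
    hypersingular α (kernelG ρ t) x = ((2 * Real.pi) ^ d)⁻¹ *
      ∫ ξ : Space d, -‖ξ‖ ^ α * Real.exp (-t * charExponent ρ ξ) * Real.cos ⟪x, ξ⟫ := by
  have hc := continuous_charExponent (d := d) hρ
  have hb := normConst_pos (d := d) hα
  have hα0 := hα.1
  have hnn : ∀ y ξ : Space d, 0 ≤ 2 * (1 - Real.cos ⟪ξ, y⟫) / ‖y‖ ^ ((d : ℝ) + α) := fun y ξ => by
    have : 0 ≤ 1 - Real.cos ⟪ξ, y⟫ := by linarith [Real.cos_le_one ⟪ξ, y⟫]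
    positivity
  have hpow : Integrable fun ξ : Space d => ‖ξ‖ ^ α * Real.exp (-t * charExponent ρ ξ) := by
    refine (integrable_pow_mul_exp (d := d) hρ hρ0 2 ht).mono'
      (Measurable.aestronglyMeasurable (by fun_prop)) (ae_of_all _ fun ξ => ?_)
    rw [Real.norm_of_nonneg (by positivity)]
    gcongr
    refine (rpow_le_one_add_sq (norm_nonneg _) hα).trans ?_
    nlinarith [norm_nonneg ξ]
  have hH : Integrable (fun p : Space d × Space d => Real.exp (-t * charExponent ρ p.2) *
      (2 * (1 - Real.cos ⟪p.2, p.1⟫) / ‖p.1‖ ^ ((d : ℝ) + α))) (volume.prod volume) := by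
    rw [integrable_prod_iff' (Measurable.aestronglyMeasurable (by fun_prop))]
    refine ⟨ae_of_all _ fun ξ => (integral_normConst_mul_one_sub_cos hα ξ).1.const_mul
      (Real.exp (-t * charExponent ρ ξ)), ?_⟩
    refine (hpow.const_mul (normConst d α)⁻¹).congr (ae_of_all _ fun ξ => ?_)
    simp only
    rw [← (integral_normConst_mul_one_sub_cos hα ξ).2]
    have e : ∀ y : Space d, ‖Real.exp (-t * charExponent ρ ξ) *
      (2 * (1 - Real.cos ⟪ξ, y⟫) / ‖y‖ ^ ((d : ℝ) + α))‖ = Real.exp (-t * charExponent ρ ξ) *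
      (2 * (1 - Real.cos ⟪ξ, y⟫) / ‖y‖ ^ ((d : ℝ) + α)) := fun y =>
      Real.norm_of_nonneg (mul_nonneg (Real.exp_pos _).le (hnn y ξ))
    simp_rw [e]
    rw [integral_const_mul]
    field_simp
  have hF : Integrable (fun p : Space d × Space d => Real.exp (-t * charExponent ρ p.2) *
      (2 * (1 - Real.cos ⟪p.2, p.1⟫) / ‖p.1‖ ^ ((d : ℝ) + α)) * Real.cos ⟪x, p.2⟫)
      (volume.prod volume) := by
    refine hH.mono (Measurable.aestronglyMeasurable (by fun_prop)) (ae_of_all _ fun p => ?_)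
    rw [norm_mul]
    exact mul_le_of_le_one_right (norm_nonneg _) (Real.abs_cos_le_one _)
  have hint : ∀ z : Space d, Integrable fun ξ : Space d =>
      Real.exp (-t * charExponent ρ ξ) * Real.cos ⟪z, ξ⟫ := fun z => by
    refine (integrable_exp_neg_mul_charExponent (d := d) hρ hρ0 ht).mono (by fun_prop)
      (ae_of_all _ fun ξ => ?_)
    rw [norm_mul]
    exact mul_le_of_le_one_right (norm_nonneg _) (Real.abs_cos_le_one _)
  have e1 : ∀ y : Space d, hypersingularIntegrand α (kernelG ρ t) x y =
      -((2 * Real.pi) ^ d)⁻¹ * ∫ ξ : Space d, Real.exp (-t * charExponent ρ ξ) *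
      (2 * (1 - Real.cos ⟪ξ, y⟫) / ‖y‖ ^ ((d : ℝ) + α)) * Real.cos ⟪x, ξ⟫ := by
    intro y
    rw [hypersingularIntegrand, kernelG_eq hρ hρ0 ht, kernelG_eq hρ hρ0 ht, kernelG_eq hρ hρ0 ht]
    have e : ∫ ξ : Space d, Real.exp (-t * charExponent ρ ξ) *
      (2 * (1 - Real.cos ⟪ξ, y⟫) / ‖y‖ ^ ((d : ℝ) + α)) * Real.cos ⟪x, ξ⟫ =
      -(‖y‖ ^ ((d : ℝ) + α))⁻¹ *
      ((∫ ξ : Space d, Real.exp (-t * charExponent ρ ξ) * Real.cos ⟪x + y, ξ⟫) -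
      2 * (∫ ξ : Space d, Real.exp (-t * charExponent ρ ξ) * Real.cos ⟪x, ξ⟫) +
      ∫ ξ : Space d, Real.exp (-t * charExponent ρ ξ) * Real.cos ⟪x - y, ξ⟫) := by
      have h2 := (hint x).const_mul 2
      have h3 : Integrable fun ξ : Space d => Real.exp (-t * charExponent ρ ξ) *
          Real.cos ⟪x + y, ξ⟫ - 2 * (Real.exp (-t * charExponent ρ ξ) * Real.cos ⟪x, ξ⟫) :=
        (hint (x + y)).sub h2
      rw [← integral_const_mul, ← integral_sub (hint _) h2, ← integral_add h3 (hint _),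
        ← integral_const_mul]
      congr 1; ext ξ
      rw [inner_add_left, inner_sub_left, Real.cos_add, Real.cos_sub, real_inner_comm ξ y]
      ring
    rw [e]
    ring
  constructor
  · refine (hF.integral_prod_left.const_mul (-((2 * Real.pi) ^ d)⁻¹)).congr
      (ae_of_all _ fun y => (e1 y).symm)
  · rw [hypersingular]
    simp_rw [e1]
    rw [integral_const_mul, integral_integral_swap (f := fun y ξ : Space d =>
      Real.exp (-t * charExponent ρ ξ) *
      (2 * (1 - Real.cos ⟪ξ, y⟫) / ‖y‖ ^ ((d : ℝ) + α)) * Real.cos ⟪x, ξ⟫) hF,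
      mul_left_comm, neg_mul, ← mul_neg, ← integral_const_mul, ← integral_neg]
    congr 2; ext ξ
    rw [integral_mul_const, integral_const_mul, ← (integral_normConst_mul_one_sub_cos hα ξ).2]
    ring

/-- Fubini in (α, ξ) averages the multipliers -|ξ|^α to -ψ(ξ), which is exactly what differentiating
e^{-tψ} in time produces. -/
lemma integral_hypersingular_kernelG (hρ : ρ (Set.Ioo (0 : ℝ) 2)ᶜ = 0)
    (hρ0 : ρ ≠ 0) {t : ℝ} (ht : 0 < t) (x : Space d) :
    Integrable (fun α => hypersingular α (kernelG ρ t) x) ρ ∧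
    ∫ α, hypersingular α (kernelG ρ t) x ∂ρ = ((2 * Real.pi) ^ d)⁻¹ *
      ∫ ξ, -charExponent ρ ξ * Real.exp (-t * charExponent ρ ξ) * Real.cos ⟪x, ξ⟫ := by
  have hc := continuous_charExponent (d := d) hρ
  have hF : Integrable (fun p : ℝ × Space d => -‖p.2‖ ^ p.1 *
      Real.exp (-t * charExponent ρ p.2) * Real.cos ⟪x, p.2⟫) (ρ.prod volume) := by
    refine Integrable.mono' ((integrable_pow_mul_exp (d := d) hρ hρ0 2 ht).comp_snd ρ)
      (Measurable.aestronglyMeasurable (by fun_prop)) ?_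
    have hm : ∀ᵐ p ∂(ρ.prod (volume : Measure (Space d))), p.1 ∈ Set.Ioo (0 : ℝ) 2 :=
      Measure.quasiMeasurePreserving_fst.ae (ae_mem_Ioo hρ)
    filter_upwards [hm] with p hp
    rw [norm_mul, norm_mul, norm_neg, Real.norm_of_nonneg (by positivity),
      Real.norm_of_nonneg (Real.exp_pos _).le]
    refine (mul_le_of_le_one_right (by positivity) (Real.abs_cos_le_one _)).trans ?_
    gcongr
    refine (rpow_le_one_add_sq (norm_nonneg _) hp).trans ?_
    nlinarith [norm_nonneg p.2]
  have hae : (fun α => ((2 * Real.pi) ^ d)⁻¹ *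
      ∫ ξ : Space d, -‖ξ‖ ^ α * Real.exp (-t * charExponent ρ ξ) * Real.cos ⟪x, ξ⟫) =ᵐ[ρ]
      fun α => hypersingular α (kernelG ρ t) x := by
    filter_upwards [ae_mem_Ioo hρ] with α hα using (hypersingular_kernelG hρ hρ0 ht x hα).2.symm
  refine ⟨(hF.integral_prod_left.const_mul _).congr hae, ?_⟩
  rw [← integral_congr_ae hae, integral_const_mul, integral_integral_swap
    (f := fun (α : ℝ) (ξ : Space d) =>
      -‖ξ‖ ^ α * Real.exp (-t * charExponent ρ ξ) * Real.cos ⟪x, ξ⟫) hF]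
  congr 2; ext ξ
  simp only [integral_mul_const, integral_neg, charExponent]

theorem isSolution_kernelG (hd : 1 ≤ d) (hρ : ρ (Set.Ioo (0 : ℝ) 2)ᶜ = 0) (hρ0 : ρ ≠ 0) :
    IsSolution (d := d) ρ (kernelG ρ) where
  continuousOn := continuousOn_kernelG hρ hρ0
  contDiff_space _ ht := contDiff_kernelG hρ hρ0 ht
  continuousOn_deriv := continuousOn_deriv_kernelG hρ hρ0
  nonneg _ ht := kernelG_nonneg hd hρ hρ0 ht
  integrable _ ht := integrable_kernelG hd hρ hρ0 ht
  integral_eq_one _ ht := integral_kernelG hd hρ hρ0 ht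
  integrable_hypersingularIntegrand _ ht x _ hα := (hypersingular_kernelG hρ hρ0 ht x hα).1
  integrable_hypersingular _ ht x := (integral_hypersingular_kernelG hρ hρ0 ht x).1
  equation t ht x := by
    rw [(integral_hypersingular_kernelG hρ hρ0 ht x).2]
    exact hasDerivAt_kernelG hρ hρ0 ht x
  initial := tendsto_integral_mul_kernelG hd hρ hρ0

end Equation


/-! ### Second differences -/

/-- The centered second difference `f(x+y) - 2 f(x) + f(x-y)`. -/
def secondDiff {d : ℕ} (f : Space d → ℝ) (x y : Space d) : ℝ := f (x + y) - 2 * f x + f (x - y)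

/-- The function s ↦ f(x+sy) + f(x-sy) has derivative (f'(x+sy) - f'(x-sy)) y on [0,1], at most
2L|y|² where L bounds the second derivative on the ball of radius R + 1. The mean value inequality
concludes. -/
lemma exists_abs_secondDiff_le {d : ℕ} {f : Space d → ℝ} (hf : ContDiff ℝ 2 f) (R : ℝ) :
    ∃ C : ℝ, 0 ≤ C ∧ ∀ x y : Space d, ‖x‖ ≤ R → ‖y‖ ≤ 1 → |secondDiff f x y| ≤ C * ‖y‖ ^ 2 := by
  have hf1 : ContDiff ℝ 1 (fderiv ℝ f) := hf.fderiv_right (m := 1) (by norm_num)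
  have hcpt : IsCompact (Metric.closedBall (0 : Space d) (R + 1)) := isCompact_closedBall _ _
  obtain ⟨L, hL⟩ := hcpt.exists_bound_of_continuousOn
    (hf1.continuous_fderiv one_ne_zero).continuousOn
  refine ⟨2 * |L|, by positivity, fun x y hx hy => ?_⟩
  have hmem : ∀ s ∈ Set.Icc (-1 : ℝ) 1, x + s • y ∈ Metric.closedBall (0 : Space d) (R + 1) := by
    intro s hs
    rw [mem_closedBall_zero_iff]
    refine (norm_add_le _ _).trans (add_le_add hx ?_)
    rw [norm_smul, Real.norm_eq_abs]
    exact mul_le_one₀ (abs_le.2 hs) (norm_nonneg _) hy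
  have hlip : ∀ s ∈ Set.Icc (0 : ℝ) 1,
      ‖fderiv ℝ f (x + s • y) - fderiv ℝ f (x + (-s) • y)‖ ≤ 2 * |L| * ‖y‖ := by
    intro s hs
    have h := (convex_closedBall (0 : Space d) (R + 1)).norm_image_sub_le_of_norm_fderiv_le
      (f := fderiv ℝ f) (𝕜 := ℝ) (C := |L|)
      (fun z _ => (hf1.differentiable one_ne_zero).differentiableAt)
      (fun z hz => (hL z hz).trans (le_abs_self L))
      (hmem (-s) ⟨by linarith [hs.2], by linarith [hs.1]⟩) (hmem s ⟨by linarith [hs.1], hs.2⟩)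
    refine h.trans ?_
    have e : x + s • y - (x + -s • y) = (2 * s) • y := by module
    rw [e, norm_smul, Real.norm_of_nonneg (by linarith [hs.1])]
    have : 2 * s * ‖y‖ ≤ 2 * ‖y‖ := by nlinarith [hs.2, norm_nonneg y]
    nlinarith [abs_nonneg L]
  have hder : ∀ s : ℝ, HasDerivAt (fun s : ℝ => f (x + s • y) + f (x + (-s) • y))
      ((fderiv ℝ f (x + s • y) - fderiv ℝ f (x + (-s) • y)) y) s := by
    intro s
    have hd : ∀ z, HasFDerivAt f (fderiv ℝ f z) z := fun z =>
      (hf.differentiable two_ne_zero).differentiableAt.hasFDerivAt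
    have h1 : HasDerivAt (fun s : ℝ => x + s • y) y s := by
      simpa using ((hasDerivAt_id s).smul_const y).const_add x
    have h2 : HasDerivAt (fun s : ℝ => x + (-s) • y) (-y) s := by
      simpa using ((hasDerivAt_id s).neg.smul_const y).const_add x
    have h3 := ((hd _).comp_hasDerivAt s h1).add ((hd _).comp_hasDerivAt s h2)
    refine h3.congr_deriv ?_
    simp [sub_eq_add_neg]
  have hmv := norm_image_sub_le_of_norm_deriv_le_segment_01'
    (f := fun s : ℝ => f (x + s • y) + f (x + (-s) • y)) (C := 2 * |L| * ‖y‖ * ‖y‖)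
    (fun s _ => (hder s).hasDerivWithinAt) (fun s hs => by
      refine (ContinuousLinearMap.le_opNorm _ _).trans ?_
      exact mul_le_mul_of_nonneg_right (hlip s ⟨hs.1, hs.2.le⟩) (norm_nonneg _))
  have e : secondDiff f x y = f (x + (1 : ℝ) • y) + f (x + (-1 : ℝ) • y) -
      (f (x + (0 : ℝ) • y) + f (x + (-0 : ℝ) • y)) := by
    simp only [secondDiff, one_smul, neg_smul, zero_smul, neg_zero, add_zero, ← sub_eq_add_neg]
    ring
  rw [e, ← Real.norm_eq_abs]
  refine hmv.trans (le_of_eq ?_)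
  ring

/-- `f` is bounded and has first and second differences of the natural order, with constant `C`. -/
structure HasDiffBound {d : ℕ} (f : Space d → ℝ) (C : ℝ) : Prop where
  nonneg : 0 ≤ C
  bound : ∀ x, |f x| ≤ C
  first : ∀ x y, |f (x + y) - f x| ≤ C * min 1 ‖y‖
  second : ∀ x y, |secondDiff f x y| ≤ C * truncSq y

lemma min_one_norm_sq {d : ℕ} (y : Space d) : min 1 ‖y‖ * min 1 ‖y‖ = truncSq y := by
  unfold truncSq
  rcases le_total 1 ‖y‖ with h | h
  · rw [min_eq_left h, min_eq_left (by nlinarith)]; ring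
  · rw [min_eq_right h, min_eq_right (by nlinarith [norm_nonneg y])]; ring

/-- Leibniz rule for second differences: besides the two expected terms there are two products of
first differences, each of order min(1,|y|)² = min(1,|y|²). The four terms give the constant 4CD. -/
lemma HasDiffBound.mul {d : ℕ} {f g : Space d → ℝ} {C D : ℝ} (hf : HasDiffBound f C)
    (hg : HasDiffBound g D) : HasDiffBound (fun x => f x * g x) (4 * (C * D)) := by
  have hC := hf.nonneg
  have hD := hg.nonneg
  have hCD : 0 ≤ C * D := mul_nonneg hC hD
  refine ⟨by positivity, fun x => ?_, fun x y => ?_, fun x y => ?_⟩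
  · rw [abs_mul]
    have := mul_le_mul (hf.bound x) (hg.bound x) (abs_nonneg _) hC
    linarith
  · have e : f (x + y) * g (x + y) - f x * g x =
        f (x + y) * (g (x + y) - g x) + (f (x + y) - f x) * g x := by ring
    rw [e]
    refine (abs_add_le _ _).trans ?_
    rw [abs_mul, abs_mul]
    have h1 := mul_le_mul (hf.bound (x + y)) (hg.first x y) (abs_nonneg _) hC
    have h2 := mul_le_mul (hf.first x y) (hg.bound x) (abs_nonneg _)
      (mul_nonneg hC (by positivity : 0 ≤ min 1 ‖y‖))
    have h3 : 0 ≤ C * D * min 1 ‖y‖ := by positivity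
    nlinarith
  · have e : secondDiff (fun x => f x * g x) x y = g x * secondDiff f x y + f x * secondDiff g x y +
        (f (x + y) - f x) * (g (x + y) - g x) + (f (x + -y) - f x) * (g (x + -y) - g x) := by
      simp only [secondDiff, ← sub_eq_add_neg]; ring
    rw [e]
    have hn : ∀ y : Space d, |(f (x + y) - f x) * (g (x + y) - g x)| ≤ C * D * truncSq y := by
      intro y
      rw [abs_mul, ← min_one_norm_sq]
      refine (mul_le_mul (hf.first x y) (hg.first x y) (abs_nonneg _)
        (mul_nonneg hC (by positivity))).trans (le_of_eq ?_)
      ring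
    have ht : truncSq (-y) = truncSq y := by simp [truncSq]
    have h1 : |g x * secondDiff f x y| ≤ D * (C * truncSq y) := by
      rw [abs_mul]; exact mul_le_mul (hg.bound x) (hf.second x y) (abs_nonneg _) hD
    have h2 : |f x * secondDiff g x y| ≤ C * (D * truncSq y) := by
      rw [abs_mul]; exact mul_le_mul (hf.bound x) (hg.second x y) (abs_nonneg _) hC
    have h3 := hn y
    have h4 := hn (-y)
    rw [ht] at h4
    refine (abs_add_le _ _).trans ((add_le_add ((abs_add_le _ _).trans
      (add_le_add ((abs_add_le _ _).trans (add_le_add h1 h2)) h3)) h4).trans (le_of_eq ?_))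
    ring

lemma truncSq_smul_le {d : ℕ} {r : ℝ} (hr0 : 0 ≤ r) (hr1 : r ≤ 1) (y : Space d) :
    truncSq (r • y) ≤ truncSq y := by
  unfold truncSq
  rw [norm_smul, Real.norm_of_nonneg hr0]
  have := mul_le_of_le_one_left (norm_nonneg y) hr1
  gcongr

/-- Spreading a function out only shrinks its differences. The constant is unchanged, so rescaled
cutoffs are controlled uniformly. -/
lemma HasDiffBound.comp_smul {d : ℕ} {f : Space d → ℝ} {C r : ℝ} (hf : HasDiffBound f C)
    (hr0 : 0 ≤ r) (hr1 : r ≤ 1) : HasDiffBound (fun x => f (r • x)) C := by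
  refine ⟨hf.nonneg, fun x => hf.bound _, fun x y => ?_, fun x y => ?_⟩
  · rw [smul_add]
    refine (hf.first _ _).trans (mul_le_mul_of_nonneg_left ?_ hf.nonneg)
    rw [norm_smul, Real.norm_of_nonneg hr0]
    have := mul_le_of_le_one_left (norm_nonneg y) hr1
    gcongr
  · have e : secondDiff (fun x => f (r • x)) x y = secondDiff f (r • x) (r • y) := by
      simp only [secondDiff, smul_add, smul_sub]
    rw [e]
    exact (hf.second _ _).trans (mul_le_mul_of_nonneg_left (truncSq_smul_le hr0 hr1 y) hf.nonneg)

lemma secondDiff_cos {d : ℕ} (ξ : Space d) (θ : ℝ) (x y : Space d) :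
    secondDiff (fun x => Real.cos (⟪ξ, x⟫ + θ)) x y =
      -(2 * (1 - Real.cos ⟪ξ, y⟫)) * Real.cos (⟪ξ, x⟫ + θ) := by
  simp only [secondDiff, inner_add_right, inner_sub_right]
  rw [show ⟪ξ, x⟫ + ⟪ξ, y⟫ + θ = (⟪ξ, x⟫ + θ) + ⟪ξ, y⟫ by ring,
    show ⟪ξ, x⟫ - ⟪ξ, y⟫ + θ = (⟪ξ, x⟫ + θ) - ⟪ξ, y⟫ by ring, Real.cos_add, Real.cos_sub]
  ring

lemma abs_sub_le_mul_min {d : ℕ} {f : Space d → ℝ} {B L : ℝ} (hB : ∀ x, |f x| ≤ B)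
    (hL : ∀ x y, |f (x + y) - f x| ≤ L * ‖y‖) (hL0 : 0 ≤ L) (x y : Space d) :
    |f (x + y) - f x| ≤ (2 * B + L) * min 1 ‖y‖ := by
  have hB0 : 0 ≤ B := (abs_nonneg _).trans (hB 0)
  rcases le_total 1 ‖y‖ with h | h
  · rw [min_eq_left h]
    have := abs_sub (f (x + y)) (f x)
    linarith [hB x, hB (x + y)]
  · rw [min_eq_right h]
    nlinarith [hL x y, norm_nonneg y]

lemma hasDiffBound_cos {d : ℕ} (ξ : Space d) (θ : ℝ) :
    ∃ C, HasDiffBound (fun x : Space d => Real.cos (⟪ξ, x⟫ + θ)) C := by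
  have hb : ∀ x : Space d, |Real.cos (⟪ξ, x⟫ + θ)| ≤ 1 := fun x => Real.abs_cos_le_one _
  have hl : ∀ x y : Space d, |Real.cos (⟪ξ, x + y⟫ + θ) - Real.cos (⟪ξ, x⟫ + θ)| ≤ ‖ξ‖ * ‖y‖ := by
    intro x y
    refine (Real.abs_cos_sub_cos_le _ _).trans ?_
    rw [inner_add_right, show ⟪ξ, x⟫ + ⟪ξ, y⟫ + θ - (⟪ξ, x⟫ + θ) = ⟪ξ, y⟫ by ring]
    exact abs_real_inner_le_norm ξ y
  refine ⟨2 * (2 + ‖ξ‖ ^ 2) + (2 * 1 + ‖ξ‖), by positivity, fun x => ?_, fun x y => ?_,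
    fun x y => ?_⟩
  · nlinarith [hb x, norm_nonneg ξ, sq_nonneg ‖ξ‖]
  · have h := abs_sub_le_mul_min hb hl (norm_nonneg ξ) x y
    have : 0 ≤ 2 * (2 + ‖ξ‖ ^ 2) * min 1 ‖y‖ := by positivity
    linarith
  · rw [secondDiff_cos, abs_mul, abs_neg]
    have h0 : 0 ≤ 1 - Real.cos ⟪ξ, y⟫ := by linarith [Real.cos_le_one ⟪ξ, y⟫]
    rw [abs_of_nonneg (by linarith)]
    refine (mul_le_of_le_one_right (by linarith) (hb x)).trans ?_
    have h1 := one_sub_cos_le_truncSq ξ y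
    have : 0 ≤ (2 * 1 + ‖ξ‖) * truncSq y := by have := truncSq_nonneg y; positivity
    linarith

lemma hasDiffBound_of_hasCompactSupport {d : ℕ} {f : Space d → ℝ} (hf : ContDiff ℝ 2 f)
    (hs : HasCompactSupport f) : ∃ C, HasDiffBound f C := by
  obtain ⟨B, hB⟩ := hs.exists_bound_of_continuous hf.continuous
  have hB0 : 0 ≤ B := (norm_nonneg _).trans (hB 0)
  obtain ⟨L, hL⟩ := ContDiff.lipschitzWith_of_hasCompactSupport hs hf two_ne_zero
  obtain ⟨R, hR⟩ := hs.isCompact.isBounded.subset_closedBall (0 : Space d)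
  -- The radius R + 1 is chosen so that for ‖x‖ > R + 1 and ‖y‖ ≤ 1 the points x and x ± y all miss
  -- the support.
  obtain ⟨C, hC0, hC⟩ := exists_abs_secondDiff_le hf (R + 1)
  have hzero : ∀ x, R < ‖x‖ → f x = 0 := fun x hx => by
    by_contra h
    have := hR (subset_tsupport f h)
    rw [mem_closedBall_zero_iff] at this
    linarith
  refine ⟨4 * B + L + C, by positivity, fun x => ?_, fun x y => ?_, fun x y => ?_⟩
  · have := hB x
    rw [Real.norm_eq_abs] at this
    have : (0 : ℝ) ≤ L := L.2
    linarith
  · have h := abs_sub_le_mul_min (f := f) (B := B) (L := L) hB (fun x y => by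
      have := hL.dist_le_mul (x + y) x
      simpa [Real.dist_eq, dist_eq_norm] using this) L.2 x y
    have : 0 ≤ (2 * B + C) * min 1 ‖y‖ := by positivity
    linarith
  · have ht := truncSq_nonneg y
    have hL0 : (0 : ℝ) ≤ L := L.2
    rcases le_total 1 ‖y‖ with h | h
    · have e : truncSq y = 1 := min_eq_left (by nlinarith)
      rw [e]
      have h1 := hB (x + y)
      have h2 := hB x
      have h3 := hB (x - y)
      rw [Real.norm_eq_abs, abs_le] at h1 h2 h3
      rw [secondDiff, abs_le]
      constructor <;> linarith
    · have e : truncSq y = ‖y‖ ^ 2 := min_eq_right (by nlinarith [norm_nonneg y])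
      by_cases hx : ‖x‖ ≤ R + 1
      · refine (hC x y hx h).trans ?_
        rw [e]
        have : 0 ≤ (4 * B + L) * ‖y‖ ^ 2 := by positivity
        linarith
      · push Not at hx
        have h1 : R < ‖x + y‖ := by
          have := norm_sub_le (x + y) y
          rw [add_sub_cancel_right] at this
          linarith
        have h2 : R < ‖x - y‖ := by
          have := norm_add_le (x - y) y
          rw [sub_add_cancel] at this
          linarith
        rw [secondDiff, hzero _ h1, hzero _ h2, hzero x (by linarith)]
        simp only [mul_zero, sub_zero, add_zero, abs_zero]
        positivity


/-! ### The generator and its symmetry -/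

/-- The generator `∫ 𝔻_0^α f dρ(α)`, written with the Lévy density. -/
noncomputable def generator {d : ℕ} (ρ : Measure ℝ) (f : Space d → ℝ) (x : Space d) : ℝ :=
  ∫ y, secondDiff f x y * levyDensity ρ y

lemma continuous_secondDiff {d : ℕ} {f : Space d → ℝ} (hf : Continuous f) :
    Continuous fun p : Space d × Space d => secondDiff f p.1 p.2 := by
  unfold secondDiff; fun_prop

section Generator

variable {d : ℕ} {ρ : Measure ℝ} [IsFiniteMeasure ρ]

/-- For small y use the C² bound; for |y| ≥ 1 use that K is bounded there. Since f need not be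
bounded, the values f(x ± y) stay in the estimate, to be handled later by integrability of f. -/
lemma exists_secondDiff_mul_levyDensity_le (hd : 1 ≤ d) (hρ : ρ (Set.Ioo (0 : ℝ) 2)ᶜ = 0)
    {f : Space d → ℝ} (hf : ContDiff ℝ 2 f) (R : ℝ) :
    ∃ C B : ℝ, 0 ≤ C ∧ 0 ≤ B ∧ ∀ x y : Space d, ‖x‖ ≤ R →
      |secondDiff f x y * levyDensity ρ y| ≤
        C * (truncSq y * levyDensity ρ y) + B * (|f (x + y)| + |f (x - y)|) := by
  obtain ⟨C, hC0, hC⟩ := exists_abs_secondDiff_le hf R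
  obtain ⟨B, hB0, hB⟩ := exists_levyDensity_le (ρ := ρ) hd hρ one_pos
  obtain ⟨M, hM⟩ := (isCompact_closedBall (0 : Space d) R).exists_bound_of_continuousOn
    hf.continuous.continuousOn
  refine ⟨C + 2 * |M|, B, by positivity, hB0, fun x y hx => ?_⟩
  have hK := levyDensity_nonneg hρ y
  have ht := truncSq_nonneg y
  rw [abs_mul, abs_of_nonneg hK]
  rcases le_total ‖y‖ 1 with h | h
  · have e : truncSq y = ‖y‖ ^ 2 := min_eq_right (by nlinarith [norm_nonneg y])
    have h1 := mul_le_mul_of_nonneg_right (hC x y hx h) hK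
    rw [← e] at h1
    have h2 : 0 ≤ 2 * |M| * (truncSq y * levyDensity ρ y) := by positivity
    have h3 : 0 ≤ B * (|f (x + y)| + |f (x - y)|) := by positivity
    linarith
  · have e : truncSq y = 1 := min_eq_left (by nlinarith)
    have hfx : |f x| ≤ |M| := (hM x (by simpa using hx)).trans (le_abs_self M)
    have h1 : |secondDiff f x y| ≤ |f (x + y)| + |f (x - y)| + 2 * |M| := by
      unfold secondDiff
      have h := abs_add_le (f (x + y) - 2 * f x) (f (x - y))
      have h' := abs_sub (f (x + y)) (2 * f x)
      rw [abs_mul, abs_two] at h'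
      linarith
    have h2 := mul_le_mul_of_nonneg_right h1 hK
    have h3 := mul_le_mul_of_nonneg_right (hB y h)
      (by positivity : 0 ≤ |f (x + y)| + |f (x - y)|)
    have h4 : 0 ≤ C * levyDensity ρ y := by positivity
    rw [e]
    linarith

lemma integrable_secondDiff_mul_levyDensity (hd : 1 ≤ d) (hρ : ρ (Set.Ioo (0 : ℝ) 2)ᶜ = 0)
    {f : Space d → ℝ} (hf : ContDiff ℝ 2 f) (hi : Integrable f) (x : Space d) :
    Integrable fun y => secondDiff f x y * levyDensity ρ y := by
  obtain ⟨C, B, -, -, h⟩ := exists_secondDiff_mul_levyDensity_le hd hρ hf ‖x‖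
  have h1 : Integrable fun y => |f (x + y)| := (hi.comp_add_left x).norm
  have h2 : Integrable fun y => |f (x - y)| := (hi.comp_sub_left x).norm
  have hm := measurable_levyDensity (ρ := ρ) (d := d) hd hρ
  have hc := (continuous_secondDiff hf.continuous).comp (Continuous.prodMk_right x)
  exact (((integrable_truncSq_mul_levyDensity hρ).const_mul C).add ((h1.add h2).const_mul B)).mono'
    (hc.measurable.mul hm).aestronglyMeasurable (ae_of_all _ fun y => h x y le_rfl)

lemma integral_hypersingular_eq_generator (hd : 1 ≤ d) (hρ : ρ (Set.Ioo (0 : ℝ) 2)ᶜ = 0)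
    {f : Space d → ℝ} (hf : ContDiff ℝ 2 f) (hi : Integrable f) (x : Space d) :
    ∫ α, hypersingular α f x ∂ρ = generator ρ f x := by
  have hc := (continuous_secondDiff hf.continuous).comp (Continuous.prodMk_right x)
  exact integral_mul_levyDensity hd hρ hc.aestronglyMeasurable
    (integrable_secondDiff_mul_levyDensity hd hρ hf hi x)

lemma integrable_mul_secondDiff_of_hasDiffBound (hd : 1 ≤ d) (hρ : ρ (Set.Ioo (0 : ℝ) 2)ᶜ = 0)
    {v φ : Space d → ℝ} (hv : Integrable v) (hφc : Continuous φ) {C : ℝ}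
    (hφ : HasDiffBound φ C) :
    Integrable (fun p : Space d × Space d =>
      v p.1 * (secondDiff φ p.1 p.2 * levyDensity ρ p.2)) (volume.prod volume) := by
  have hm := measurable_levyDensity (ρ := ρ) (d := d) hd hρ
  have hs := (continuous_secondDiff hφc).measurable
  refine Integrable.mono (hv.mul_prod ((integrable_truncSq_mul_levyDensity (d := d) hρ).const_mul C))
    ?_ (ae_of_all _ fun p => ?_)
  · exact hv.1.comp_fst.mul (hs.mul (hm.comp measurable_snd)).aestronglyMeasurable
  · have hK := levyDensity_nonneg hρ p.2
    have ht := truncSq_nonneg p.2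
    have hC := hφ.nonneg
    rw [norm_mul, norm_mul, norm_mul]
    refine mul_le_mul_of_nonneg_left ?_ (norm_nonneg _)
    rw [Real.norm_of_nonneg hK,
      Real.norm_of_nonneg (by positivity : 0 ≤ C * (truncSq p.2 * levyDensity ρ p.2)), ← mul_assoc]
    exact mul_le_mul_of_nonneg_right (hφ.second _ _) hK

lemma integrable_mul_generator (hd : 1 ≤ d) (hρ : ρ (Set.Ioo (0 : ℝ) 2)ᶜ = 0)
    {v φ : Space d → ℝ} (hv : Integrable v) (hφc : Continuous φ) {C : ℝ}
    (hφ : HasDiffBound φ C) : Integrable fun x => v x * generator ρ φ x := by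
  refine (integrable_mul_secondDiff_of_hasDiffBound hd hρ hv hφc hφ).integral_prod_left.congr
    (ae_of_all _ fun x => ?_)
  simp only [generator, integral_const_mul]

lemma abs_generator_le (hρ : ρ (Set.Ioo (0 : ℝ) 2)ᶜ = 0) {φ : Space d → ℝ} {C : ℝ}
    (hφ : HasDiffBound φ C) (x : Space d) :
    |generator ρ φ x| ≤ C * ∫ y : Space d, truncSq y * levyDensity ρ y := by
  rw [← integral_const_mul, ← Real.norm_eq_abs]
  refine norm_integral_le_of_norm_le ((integrable_truncSq_mul_levyDensity hρ).const_mul C)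
    (ae_of_all _ fun y => ?_)
  have hK := levyDensity_nonneg hρ y
  rw [norm_mul, Real.norm_of_nonneg hK, ← mul_assoc]
  exact mul_le_mul_of_nonneg_right (hφ.second _ _) hK

/-- Translation invariance of Lebesgue measure exchanges the shifts by y and -y, and the second
difference is symmetric in them. -/
lemma integral_mul_secondDiff_comm {v φ : Space d → ℝ} (hvc : Continuous v)
    (hφc : Continuous φ) (hφs : HasCompactSupport φ) (y : Space d) :
    ∫ x, φ x * secondDiff v x y = ∫ x, v x * secondDiff φ x y := by
  have hφi : ∀ z : Space d, Integrable fun x => φ x * v (x + z) := fun z =>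
    Continuous.integrable_of_hasCompactSupport (by fun_prop) hφs.mul_right
  have hvi : ∀ z : Space d, Integrable fun x => v x * φ (x + z) := fun z => by
    have h := (hφi (-z)).comp_add_right z
    refine h.congr (ae_of_all _ fun x => ?_)
    simp [mul_comm]
  have hsw : ∀ z : Space d, ∫ x, φ x * v (x + z) = ∫ x, v x * φ (x + -z) := fun z => by
    rw [← integral_add_right_eq_self (fun x => v x * φ (x + -z)) z]
    congr 1; ext x
    simp [mul_comm]
  have e1 : ∀ x, φ x * secondDiff v x y =
      (φ x * v (x + y) - 2 * (φ x * v (x + 0))) + φ x * v (x + -y) := fun x => by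
    simp only [secondDiff, add_zero, ← sub_eq_add_neg]; ring
  have e2 : ∀ x, v x * secondDiff φ x y =
      (v x * φ (x + y) - 2 * (v x * φ (x + 0))) + v x * φ (x + -y) := fun x => by
    simp only [secondDiff, add_zero, ← sub_eq_add_neg]; ring
  simp_rw [e1, e2]
  have i1 : Integrable fun x => φ x * v (x + y) - 2 * (φ x * v (x + 0)) :=
    (hφi y).sub ((hφi 0).const_mul 2)
  have i2 : Integrable fun x => v x * φ (x + y) - 2 * (v x * φ (x + 0)) :=
    (hvi y).sub ((hvi 0).const_mul 2)
  rw [integral_add i1 (hφi (-y)), integral_sub (hφi y) ((hφi 0).const_mul 2),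
    integral_add i2 (hvi (-y)), integral_sub (hvi y) ((hvi 0).const_mul 2), integral_const_mul,
    integral_const_mul, hsw, hsw, hsw, neg_neg, neg_zero]
  ring

lemma integrable_mul_comp_add_prod {f g : Space d → ℝ} (hf : Integrable f) (hg : Integrable g) :
    Integrable (fun p : Space d × Space d => f p.1 * g (p.1 + p.2)) (volume.prod volume) :=
  (measurePreserving_prod_add (volume : Measure (Space d)) volume).integrable_comp_of_integrable
    (hf.mul_prod hg)

lemma integrable_mul_comp_sub_prod {f g : Space d → ℝ} (hf : Integrable f) (hg : Integrable g) :
    Integrable (fun p : Space d × Space d => f p.1 * g (p.1 - p.2)) (volume.prod volume) := by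
  have h : MeasurePreserving (fun p : Space d × Space d => (p.1, -p.2))
      (volume.prod volume) (volume.prod volume) :=
    (MeasurePreserving.id _).prod (Measure.measurePreserving_neg _)
  have := h.integrable_comp_of_integrable (integrable_mul_comp_add_prod hf hg)
  simpa [Function.comp_def, ← sub_eq_add_neg] using this

/-- Symmetry of the generator: it holds for each fixed y by `integral_mul_secondDiff_comm`, and
Fubini on both sides integrates it against K. On the side where the generator hits v, the bound is
needed only for x in the support of φ, and products φ(x) v(x ± y) are integrable in (x, y). -/
lemma integral_mul_generator_comm (hd : 1 ≤ d) (hρ : ρ (Set.Ioo (0 : ℝ) 2)ᶜ = 0)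
    {v φ : Space d → ℝ} (hv : Integrable v) (hv2 : ContDiff ℝ 2 v) (hφc : Continuous φ)
    (hφs : HasCompactSupport φ) {C : ℝ} (hφ : HasDiffBound φ C) :
    ∫ x, φ x * generator ρ v x = ∫ x, v x * generator ρ φ x := by
  have hm := measurable_levyDensity (ρ := ρ) (d := d) hd hρ
  have hφi : Integrable φ := hφc.integrable_of_hasCompactSupport hφs
  obtain ⟨R, hR⟩ := hφs.isCompact.isBounded.subset_closedBall (0 : Space d)
  obtain ⟨D, B, -, -, h⟩ := exists_secondDiff_mul_levyDensity_le hd hρ hv2 R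
  have hF1 : Integrable (fun p : Space d × Space d =>
      φ p.1 * (secondDiff v p.1 p.2 * levyDensity ρ p.2)) (volume.prod volume) := by
    have hs := (continuous_secondDiff hv2.continuous).measurable
    have hdom := (hφi.norm.mul_prod
      ((integrable_truncSq_mul_levyDensity (d := d) hρ).const_mul D)).add
      (((integrable_mul_comp_add_prod hφi.norm hv.norm).add
        (integrable_mul_comp_sub_prod hφi.norm hv.norm)).const_mul B)
    refine hdom.mono' ?_ (ae_of_all _ fun p => ?_)
    · exact ((hφc.measurable.comp measurable_fst).mul
        (hs.mul (hm.comp measurable_snd))).aestronglyMeasurable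
    · simp only [Pi.add_apply, Real.norm_eq_abs]
      rw [abs_mul]
      by_cases hp : φ p.1 = 0
      · simp [hp]
      · have hx : ‖p.1‖ ≤ R := by simpa using hR (subset_tsupport φ hp)
        refine (mul_le_mul_of_nonneg_left (h p.1 p.2 hx) (abs_nonneg _)).trans (le_of_eq ?_)
        ring
  have hF2 := integrable_mul_secondDiff_of_hasDiffBound hd hρ hv hφc hφ
  have e1 := integral_integral_swap (f := fun x y : Space d =>
    φ x * (secondDiff v x y * levyDensity ρ y)) hF1
  have e2 := integral_integral_swap (f := fun x y : Space d =>
    v x * (secondDiff φ x y * levyDensity ρ y)) hF2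
  simp only [integral_const_mul] at e1 e2
  unfold generator
  rw [e1, e2]
  congr 1; ext y
  simp_rw [← mul_assoc]
  rw [integral_mul_const, integral_mul_const, integral_mul_secondDiff_comm hv2.continuous hφc hφs]

/-- Cosines are eigenfunctions of every second difference; the phase θ lets one real statement cover
sines too. -/
lemma generator_cos (hd : 1 ≤ d) (hρ : ρ (Set.Ioo (0 : ℝ) 2)ᶜ = 0) (ξ : Space d) (θ : ℝ)
    (x : Space d) :
    generator ρ (fun x => Real.cos (⟪ξ, x⟫ + θ)) x =
      -charExponent ρ ξ * Real.cos (⟪ξ, x⟫ + θ) := by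
  unfold generator
  simp_rw [secondDiff_cos]
  rw [charExponent, ← integral_one_sub_cos_mul_levyDensity hd hρ, ← integral_neg,
    ← integral_mul_const]
  congr 1; ext y; ring

end Generator


/-! ### Uniqueness -/

/-- Multiply the cosine by a bump dilated by n + 1. The single constant C for all n comes from
`HasDiffBound.comp_smul` and the product rule. -/
lemma exists_cutoff_cos {d : ℕ} (ξ : Space d) (θ : ℝ) :
    ∃ (φ : ℕ → Space d → ℝ) (C : ℝ), (∀ n, Continuous (φ n)) ∧ (∀ n, HasCompactSupport (φ n)) ∧
      (∀ n, HasDiffBound (φ n) C) ∧ ∀ x, ∀ᶠ n in atTop, φ n x = Real.cos (⟪ξ, x⟫ + θ) := by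
  let χ : ContDiffBump (0 : Space d) := ⟨1, 2, one_pos, one_lt_two⟩
  obtain ⟨C, hC⟩ := hasDiffBound_of_hasCompactSupport (f := χ) χ.contDiff χ.hasCompactSupport
  obtain ⟨D, hD⟩ := hasDiffBound_cos ξ θ
  have hr0 : ∀ n : ℕ, 0 < ((n : ℝ) + 1)⁻¹ := fun n => by positivity
  have hr1 : ∀ n : ℕ, ((n : ℝ) + 1)⁻¹ ≤ 1 := fun n =>
    inv_le_one_of_one_le₀ (by linarith [n.cast_nonneg (α := ℝ)])
  refine ⟨fun n x => χ (((n : ℝ) + 1)⁻¹ • x) * Real.cos (⟪ξ, x⟫ + θ), 4 * (C * D), fun n => ?_,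
    fun n => ?_, fun n => (hC.comp_smul (hr0 n).le (hr1 n)).mul hD, fun x => ?_⟩
  · exact (χ.continuous.comp (continuous_const_smul _)).mul (by fun_prop)
  · exact (χ.hasCompactSupport.comp_homeomorph
      (Homeomorph.smulOfNeZero _ (hr0 n).ne')).mul_right
  · obtain ⟨N, hN⟩ := exists_nat_ge ‖x‖
    filter_upwards [eventually_ge_atTop N] with n hn
    have hn' : (N : ℝ) ≤ n := by exact_mod_cast hn
    rw [χ.one_of_mem_closedBall, one_mul]
    rw [mem_closedBall_zero_iff, norm_smul, Real.norm_of_nonneg (hr0 n).le, inv_mul_le_iff₀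
      (by positivity)]
    -- The final 1 is the inner radius of the bump.
    change ‖x‖ ≤ ((n : ℝ) + 1) * 1
    linarith

section Uniqueness

variable {d : ℕ} {ρ : Measure ℝ}

lemma IsSolution.continuous {u : ℝ → Space d → ℝ} (hu : IsSolution ρ u) {t : ℝ} (ht : 0 < t) :
    Continuous (u t) :=
  (hu.contDiff_space t ht).continuous

/-- Continuity of the time derivative bounds it on the compact set [t/2, 2t] × supp φ, which
dominates the difference quotients. -/
lemma IsSolution.hasDerivAt_integral_mul {u : ℝ → Space d → ℝ} (hu : IsSolution ρ u)
    {φ : Space d → ℝ} (hφc : Continuous φ) (hφs : HasCompactSupport φ) {t : ℝ} (ht : 0 < t) :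
    HasDerivAt (fun s => ∫ x, u s x * φ x) (∫ x, deriv (fun s => u s x) t * φ x) t := by
  have hφi : Integrable φ := hφc.integrable_of_hasCompactSupport hφs
  have hcpt : IsCompact (Set.Icc (t / 2) (2 * t) ×ˢ tsupport φ) :=
    isCompact_Icc.prod hφs.isCompact
  have hsub : Set.Icc (t / 2) (2 * t) ×ˢ tsupport φ ⊆ Set.Ioi 0 ×ˢ Set.univ := fun p hp =>
    ⟨lt_of_lt_of_le (half_pos ht) hp.1.1, trivial⟩
  obtain ⟨M, hM⟩ := hcpt.exists_bound_of_continuousOn (hu.continuousOn_deriv.mono hsub)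
  have hder : ∀ s, 0 < s → ∀ x, HasDerivAt (fun s => u s x) (deriv (fun s => u s x) s) s :=
    fun s hs x => (hu.equation s hs x).differentiableAt.hasDerivAt
  have hdc : Continuous fun x => deriv (fun s => u s x) t :=
    hu.continuousOn_deriv.comp_continuous (f := fun x : Space d => (t, x)) (by fun_prop)
      fun x => ⟨ht, trivial⟩
  have hI : Integrable fun x => u t x * φ x := by
    have := hu.continuous ht
    exact Continuous.integrable_of_hasCompactSupport (by fun_prop) hφs.mul_left
  refine (hasDerivAt_integral_of_dominated_loc_of_deriv_le (s := Set.Ioo (t / 2) (2 * t))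
    (F := fun s x => u s x * φ x) (F' := fun s x => deriv (fun s => u s x) s * φ x)
    (bound := fun x => M * |φ x|)
    (Ioo_mem_nhds (by linarith) (by linarith)) ?_ hI ?_ ?_ (hφi.norm.const_mul M) ?_).2
  · filter_upwards [Ioi_mem_nhds ht] with s hs
    exact ((hu.continuous hs).mul hφc).aestronglyMeasurable
  · exact (hdc.mul hφc).aestronglyMeasurable
  · refine ae_of_all _ fun x s hs => ?_
    rw [norm_mul]
    by_cases hx : φ x = 0
    · simp [hx]
    · exact mul_le_mul_of_nonneg_right
        (hM (s, x) ⟨⟨hs.1.le, hs.2.le⟩, subset_tsupport φ hx⟩) (norm_nonneg _)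
  · refine ae_of_all _ fun x s hs => (hder s (by linarith [hs.1]) x).mul_const _

lemma IsSolution.integral_mul_le {u : ℝ → Space d → ℝ} (hu : IsSolution ρ u) {t : ℝ} (ht : 0 < t)
    {g : Space d → ℝ} {C : ℝ} (hg : ∀ x, |g x| ≤ C) : |∫ x, u t x * g x| ≤ C := by
  have h : ∫ x, u t x * C = C := by rw [integral_mul_const, hu.integral_eq_one t ht, one_mul]
  rw [← Real.norm_eq_abs, ← h]
  refine norm_integral_le_of_norm_le ((hu.integrable t ht).mul_const C) (ae_of_all _ fun x => ?_)
  rw [norm_mul, Real.norm_of_nonneg (hu.nonneg t ht x)]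
  exact mul_le_mul_of_nonneg_left (hg x) (hu.nonneg t ht x)

variable [IsFiniteMeasure ρ]

/-- Weak form of the equation: by symmetry the generator is moved from u onto the test function. -/
lemma IsSolution.hasDerivAt_integral_mul_generator (hd : 1 ≤ d)
    (hρ : ρ (Set.Ioo (0 : ℝ) 2)ᶜ = 0) {u : ℝ → Space d → ℝ} (hu : IsSolution ρ u)
    {φ : Space d → ℝ} (hφc : Continuous φ) (hφs : HasCompactSupport φ) {C : ℝ}
    (hφ : HasDiffBound φ C) {t : ℝ} (ht : 0 < t) :
    HasDerivAt (fun s => ∫ x, u s x * φ x) (∫ x, u t x * generator ρ φ x) t := by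
  refine (hu.hasDerivAt_integral_mul hφc hφs ht).congr_deriv ?_
  rw [← integral_mul_generator_comm hd hρ (hu.integrable t ht) (hu.contDiff_space t ht) hφc hφs hφ]
  congr 1; ext x
  rw [(hu.equation t ht x).deriv, integral_hypersingular_eq_generator hd hρ
    (hu.contDiff_space t ht) (hu.integrable t ht), mul_comm]

lemma tendsto_generator_of_eventually_eq (hρ : ρ (Set.Ioo (0 : ℝ) 2)ᶜ = 0) (hd : 1 ≤ d)
    {φ : ℕ → Space d → ℝ} {ψ : Space d → ℝ} {C : ℝ} (hφc : ∀ n, Continuous (φ n))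
    (hφ : ∀ n, HasDiffBound (φ n) C) (h : ∀ x, ∀ᶠ n in atTop, φ n x = ψ x) (x : Space d) :
    Tendsto (fun n => generator ρ (φ n) x) atTop (𝓝 (generator ρ ψ x)) := by
  have hm := measurable_levyDensity (ρ := ρ) (d := d) hd hρ
  refine tendsto_integral_of_dominated_convergence _ (fun n => ?_)
    ((integrable_truncSq_mul_levyDensity (d := d) hρ).const_mul C)
    (fun n => ae_of_all _ fun y => ?_) (ae_of_all _ fun y => ?_)
  · have hc := (continuous_secondDiff (hφc n)).comp (Continuous.prodMk_right x)
    exact (hc.measurable.mul hm).aestronglyMeasurable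
  · have hK := levyDensity_nonneg hρ y
    rw [norm_mul, Real.norm_of_nonneg hK, ← mul_assoc]
    exact mul_le_mul_of_nonneg_right ((hφ n).second _ _) hK
  · refine tendsto_const_nhds.congr' ?_
    filter_upwards [h (x + y), h x, h (x - y)] with n h1 h2 h3
    simp only [secondDiff, h1, h2, h3]

/-- Let a = ψ(ξ) and let L be the generator. For a cutoff φ_n, the derivative of e^{ra} ∫ u(r) φ_n
is e^{ra} ∫ u(r) (L φ_n + a φ_n). The bracket is bounded uniformly in n and x, and tends to 0
because L cos = -a cos. Since u(r) has unit mass, the derivatives are bounded on [s,t] and tend to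
0, so the increments vanish in the limit. -/
lemma IsSolution.exp_mul_integral_cos_eq (hd : 1 ≤ d) (hρ : ρ (Set.Ioo (0 : ℝ) 2)ᶜ = 0)
    {u : ℝ → Space d → ℝ} (hu : IsSolution ρ u) (ξ : Space d) (θ : ℝ) {s t : ℝ} (hs : 0 < s)
    (hst : s ≤ t) :
    Real.exp (t * charExponent ρ ξ) * (∫ x, u t x * Real.cos (⟪ξ, x⟫ + θ)) =
      Real.exp (s * charExponent ρ ξ) * ∫ x, u s x * Real.cos (⟪ξ, x⟫ + θ) := by
  obtain ⟨φ, C, hφc, hφs, hφ, hlim⟩ := exists_cutoff_cos ξ θ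
  set a := charExponent ρ ξ with ha
  have ha0 : 0 ≤ a := charExponent_nonneg ρ ξ
  have hC := (hφ 0).nonneg
  set I : ℝ := ∫ y : Space d, truncSq y * levyDensity ρ y
  have hcomb : ∀ n x, |generator ρ (φ n) x + a * φ n x| ≤ C * I + a * C := fun n x => by
    refine (abs_add_le _ _).trans (add_le_add (abs_generator_le hρ (hφ n) x) ?_)
    rw [abs_mul, abs_of_nonneg ha0]
    exact mul_le_mul_of_nonneg_left ((hφ n).bound x) ha0
  have hi1 : ∀ n r, 0 < r → Integrable fun x => u r x * generator ρ (φ n) x := fun n r hr =>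
    integrable_mul_generator hd hρ (hu.integrable r hr) (hφc n) (hφ n)
  have hi2 : ∀ n r, 0 < r → Integrable fun x => u r x * φ n x := fun n r hr => by
    have := hu.continuous hr
    have := hφc n
    exact Continuous.integrable_of_hasCompactSupport (by fun_prop) (hφs n).mul_left
  let w : ℕ → ℝ → ℝ := fun n r => Real.exp (r * a) * ∫ x, u r x * φ n x
  let g : ℕ → ℝ → ℝ := fun n r =>
    Real.exp (r * a) * ∫ x, u r x * (generator ρ (φ n) x + a * φ n x)
  have hw : ∀ n r, 0 < r → HasDerivAt (w n) (g n r) r := by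
    intro n r hr
    have h1 : HasDerivAt (fun r : ℝ => Real.exp (r * a)) (Real.exp (r * a) * (1 * a)) r :=
      ((hasDerivAt_id r).mul_const a).exp
    have h2 := hu.hasDerivAt_integral_mul_generator hd hρ (hφc n) (hφs n) (hφ n) hr
    refine (h1.mul h2).congr_deriv ?_
    have e : ∀ x, u r x * (generator ρ (φ n) x + a * φ n x) =
        u r x * generator ρ (φ n) x + a * (u r x * φ n x) := fun x => by ring
    simp only [g, e]
    rw [integral_add (hi1 n r hr) ((hi2 n r hr).const_mul a), integral_const_mul]
    ring
  have hgb : ∀ n, ∀ r ∈ Set.Icc s t, ‖g n r‖ ≤ Real.exp (t * a) * (C * I + a * C) := by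
    intro n r hr
    rw [norm_mul, Real.norm_of_nonneg (Real.exp_pos _).le]
    refine mul_le_mul (Real.exp_le_exp.2 (mul_le_mul_of_nonneg_right hr.2 ha0))
      (hu.integral_mul_le (hs.trans_le hr.1) (hcomb n)) (norm_nonneg _) (Real.exp_pos _).le
  have hgl : ∀ r, 0 < r → Tendsto (fun n => g n r) atTop (𝓝 0) := by
    intro r hr
    have h1 : Tendsto (fun n => ∫ x, u r x * (generator ρ (φ n) x + a * φ n x)) atTop
        (𝓝 (∫ _x : Space d, (0 : ℝ))) := by
      refine tendsto_integral_of_dominated_convergence (fun x => u r x * (C * I + a * C))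
        (fun n => ?_) ((hu.integrable r hr).mul_const _) (fun n => ae_of_all _ fun x => ?_)
        (ae_of_all _ fun x => ?_)
      · have := ((hi1 n r hr).add ((hi2 n r hr).const_mul a)).1
        refine this.congr (ae_of_all _ fun x => ?_)
        simp only [Pi.add_apply]; ring
      · rw [norm_mul, Real.norm_of_nonneg (hu.nonneg r hr x)]
        exact mul_le_mul_of_nonneg_left (hcomb n x) (hu.nonneg r hr x)
      · have h2 := tendsto_generator_of_eventually_eq hρ hd hφc hφ hlim x
        rw [generator_cos hd hρ] at h2
        have h3 : Tendsto (fun n => φ n x) atTop (𝓝 (Real.cos (⟪ξ, x⟫ + θ))) :=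
          tendsto_const_nhds.congr' ((hlim x).mono fun n hn => hn.symm)
        have h4 := (h2.add (h3.const_mul a)).const_mul (u r x)
        simpa [← ha] using h4
    simpa [g] using h1.const_mul (Real.exp (r * a))
  have hpos : ∀ r ∈ Set.uIcc s t, 0 < r := fun r hr => by
    rw [Set.uIcc_of_le hst] at hr; exact hs.trans_le hr.1
  have hIoc : ∀ r ∈ Set.Ioc s t, 0 < r := fun r hr => hs.trans hr.1
  -- Measurability in r is free: `g n` agrees on (s,t] with the derivative of `w n`, and derivatives
  -- are always measurable.
  have hmeas : ∀ n, AEStronglyMeasurable (g n) (volume.restrict (Set.Ioc s t)) := fun n => by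
    refine (measurable_deriv (w n)).aestronglyMeasurable.congr ?_
    filter_upwards [ae_restrict_mem measurableSet_Ioc] with r hr using (hw n r (hIoc r hr)).deriv
  have hbd : ∀ n, ∀ᵐ r ∂(volume.restrict (Set.Ioc s t)),
      ‖g n r‖ ≤ Real.exp (t * a) * (C * I + a * C) := fun n => by
    filter_upwards [ae_restrict_mem measurableSet_Ioc] with r hr using hgb n r ⟨hr.1.le, hr.2⟩
  have hFTC : ∀ n, w n t - w n s = ∫ r in s..t, g n r := by
    intro n
    refine (intervalIntegral.integral_eq_sub_of_hasDerivAt (fun r hr => hw n r (hpos r hr)) ?_).symm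
    rw [intervalIntegrable_iff_integrableOn_Ioc_of_le hst]
    exact (integrable_const (Real.exp (t * a) * (C * I + a * C))).mono' (hmeas n) (hbd n)
  have hint0 : Tendsto (fun n => ∫ r in s..t, g n r) atTop (𝓝 0) := by
    simp_rw [intervalIntegral.integral_of_le hst]
    have := tendsto_integral_of_dominated_convergence (μ := volume.restrict (Set.Ioc s t))
      (F := g) (f := fun _ => 0) (fun _ => Real.exp (t * a) * (C * I + a * C)) hmeas
      (integrable_const _) hbd (by
        filter_upwards [ae_restrict_mem measurableSet_Ioc] with r hr using hgl r (hIoc r hr))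
    simpa using this
  have hwl : ∀ r, 0 < r → Tendsto (fun n => w n r) atTop
      (𝓝 (Real.exp (r * a) * ∫ x, u r x * Real.cos (⟪ξ, x⟫ + θ))) := by
    intro r hr
    refine Tendsto.const_mul _ ?_
    refine tendsto_integral_of_dominated_convergence (fun x => u r x * C)
      (fun n => (hi2 n r hr).1) ((hu.integrable r hr).mul_const _) (fun n => ae_of_all _ fun x => ?_)
      (ae_of_all _ fun x => ?_)
    · rw [norm_mul, Real.norm_of_nonneg (hu.nonneg r hr x)]
      exact mul_le_mul_of_nonneg_left ((hφ n).bound x) (hu.nonneg r hr x)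
    · refine Tendsto.const_mul _ (tendsto_const_nhds.congr' ?_)
      exact (hlim x).mono fun n hn => hn.symm
  have h1 := (hwl t (hs.trans_le hst)).sub (hwl s hs)
  simp_rw [hFTC] at h1
  exact sub_eq_zero.1 (tendsto_nhds_unique h1 hint0)

/-- The conserved quantity is evaluated as s ↓ 0, where weak convergence to δ_0 gives cos θ. -/
lemma IsSolution.integral_mul_cos_eq (hd : 1 ≤ d) (hρ : ρ (Set.Ioo (0 : ℝ) 2)ᶜ = 0)
    {u : ℝ → Space d → ℝ} (hu : IsSolution ρ u) (ξ : Space d) (θ : ℝ) {t : ℝ} (ht : 0 < t) :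
    ∫ x, u t x * Real.cos (⟪ξ, x⟫ + θ) = Real.exp (-t * charExponent ρ ξ) * Real.cos θ := by
  let ψ : BoundedContinuousFunction (Space d) ℝ :=
    BoundedContinuousFunction.ofNormedAddCommGroup (fun x => Real.cos (⟪ξ, x⟫ + θ))
      (by fun_prop) 1 fun x => Real.abs_cos_le_one _
  have h0 : Tendsto (fun s => ∫ x, u s x * Real.cos (⟪ξ, x⟫ + θ)) (𝓝[>] 0) (𝓝 (Real.cos θ)) := by
    have h := hu.initial ψ
    simp only [ψ, BoundedContinuousFunction.coe_ofNormedAddCommGroup, inner_zero_right,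
      zero_add] at h
    refine h.congr fun s => integral_congr_ae (ae_of_all _ fun x => mul_comm _ _)
  have hc : Tendsto (fun s : ℝ => Real.exp (s * charExponent ρ ξ)) (𝓝[>] 0) (𝓝 1) := by
    have : Continuous fun s : ℝ => Real.exp (s * charExponent ρ ξ) := by fun_prop
    simpa using (this.tendsto 0).mono_left nhdsWithin_le_nhds
  have h1 := hc.mul h0
  have h2 : ∀ᶠ s : ℝ in 𝓝[>] 0, Real.exp (s * charExponent ρ ξ) *
      (∫ x, u s x * Real.cos (⟪ξ, x⟫ + θ)) =
      Real.exp (t * charExponent ρ ξ) * ∫ x, u t x * Real.cos (⟪ξ, x⟫ + θ) := by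
    filter_upwards [Ioc_mem_nhdsGT ht] with s hs
    exact (hu.exp_mul_integral_cos_eq hd hρ ξ θ hs.1 hs.2).symm
  have h3 := tendsto_nhds_unique (h1.congr' h2) tendsto_const_nhds
  rw [one_mul] at h3
  rw [h3, ← mul_assoc, ← Real.exp_add]
  simp

/-- Both functions are continuous densities with the same characteristic function, so the measures
coincide, the densities agree almost everywhere, and continuity makes this everywhere. -/
theorem IsSolution.eq_kernelG (hd : 1 ≤ d) (hρ : ρ (Set.Ioo (0 : ℝ) 2)ᶜ = 0) (hρ0 : ρ ≠ 0)
    {u : ℝ → Space d → ℝ} (hu : IsSolution ρ u) {t : ℝ} (ht : 0 < t) (x : Space d) :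
    u t x = kernelG ρ t x := by
  have hc := hu.continuous ht
  have hG := isSolution_kernelG (d := d) hd hρ hρ0
  have hcG := hG.continuous ht
  have hchar : ∀ {v : ℝ → Space d → ℝ}, IsSolution ρ v → ∀ ξ,
      charFun (volume.withDensity fun x => ENNReal.ofReal (v t x)) ξ =
        ((Real.exp (-t * charExponent ρ ξ) : ℝ) : ℂ) := by
    intro v hv ξ
    have hvc := (hv.continuous ht).measurable
    have hI : ∀ θ, Integrable fun x => v t x * Real.cos (⟪ξ, x⟫ + θ) := fun θ => by
      refine (hv.integrable t ht).mono (by fun_prop) (ae_of_all _ fun x => ?_)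
      rw [norm_mul]
      exact mul_le_of_le_one_right (norm_nonneg _) (Real.abs_cos_le_one _)
    rw [charFun_apply, integral_withDensity_eq_integral_toReal_smul (by fun_prop)
      (ae_of_all _ fun _ => ENNReal.ofReal_lt_top)]
    -- The imaginary part is the cosine with phase -π/2.
    have e : ∀ x, (ENNReal.ofReal (v t x)).toReal • Complex.exp (((⟪x, ξ⟫ : ℝ) : ℂ) * Complex.I) =
        ((v t x * Real.cos (⟪ξ, x⟫ + 0) : ℝ) : ℂ) +
        ((v t x * Real.cos (⟪ξ, x⟫ + -(Real.pi / 2)) : ℝ) : ℂ) * Complex.I := by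
      intro x
      rw [ENNReal.toReal_ofReal (hv.nonneg t ht x), Complex.exp_mul_I, real_inner_comm, add_zero,
        ← sub_eq_add_neg, Real.cos_sub_pi_div_two, Complex.real_smul]
      push_cast
      ring
    simp_rw [e]
    rw [integral_add (hI 0).ofReal ((hI _).ofReal.mul_const _), integral_mul_const,
      integral_complex_ofReal, integral_complex_ofReal, hv.integral_mul_cos_eq hd hρ ξ _ ht,
      hv.integral_mul_cos_eq hd hρ ξ _ ht]
    simp
  have hf1 : IsFiniteMeasure (volume.withDensity fun x => ENNReal.ofReal (u t x)) :=
    isFiniteMeasure_withDensity_ofReal (hu.integrable t ht).2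
  have hf2 : IsFiniteMeasure (volume.withDensity fun x => ENNReal.ofReal (kernelG ρ t x)) :=
    isFiniteMeasure_withDensity_ofReal (hG.integrable t ht).2
  have hμ := Measure.ext_of_charFun (funext fun ξ => (hchar hu ξ).trans (hchar hG ξ).symm)
  have hae := (withDensity_eq_iff_of_sigmaFinite (by fun_prop) (by fun_prop)).1 hμ
  have heq : u t = kernelG ρ t := by
    refine Continuous.ae_eq_iff_eq volume hc hcG |>.1 ?_
    filter_upwards [hae] with x hx
    rwa [ENNReal.ofReal_eq_ofReal_iff (hu.nonneg t ht x) (hG.nonneg t ht x)] at hx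
  rw [heq]

end Uniqueness


/-! ### Rounding to the lattice -/

/-- The coordinatewise nearest integer point. -/
noncomputable def roundPoint {d : ℕ} (y : Space d) : Fin d → ℤ := fun i => round (y i)

lemma roundPoint_latticePoint {d : ℕ} (k : Fin d → ℤ) : roundPoint (latticePoint k) = k := by
  ext i; simp [roundPoint, latticePoint]

lemma measurable_roundPoint {d : ℕ} : Measurable (roundPoint (d := d)) := by
  refine measurable_pi_lambda _ fun i => ?_
  simp only [roundPoint, round_eq]
  exact Int.measurable_floor.comp (by fun_prop)

/-- Used twice: with Lebesgue measure and rounding, to read Riemann sums as integrals, and with the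
law of a lattice step, to compute its characteristic function. -/
lemma hasSum_integral_fibers {Ω ι F : Type*} [MeasurableSpace Ω] [MeasurableSpace ι]
    [MeasurableSingletonClass ι] [Countable ι] [NormedAddCommGroup F] [NormedSpace ℝ F]
    [CompleteSpace F] {μ : Measure Ω} {r : Ω → ι} (hr : Measurable r) {f : ι → F}
    (hf : Integrable (fun ω => f (r ω)) μ) :
    HasSum (fun k => μ.real (r ⁻¹' {k}) • f k) (∫ ω, f (r ω) ∂μ) := by
  have hm : ∀ k, MeasurableSet (r ⁻¹' {k}) := fun k => hr (measurableSet_singleton k)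
  have hU : ⋃ k, r ⁻¹' {k} = Set.univ := Set.iUnion_eq_univ_iff.2 fun ω => ⟨r ω, rfl⟩
  have hd : Pairwise (Function.onFun Disjoint fun k => r ⁻¹' {k}) := fun k l hkl =>
    Disjoint.preimage r (by simpa using hkl)
  have h := hasSum_integral_iUnion (μ := μ) (f := fun ω => f (r ω)) hm hd hf.integrableOn
  rw [hU, setIntegral_univ] at h
  convert h using 1
  ext k
  rw [setIntegral_congr_fun (hm k) (g := fun _ => f k) (fun ω hω => by
    simp only [Set.mem_preimage, Set.mem_singleton_iff] at hω; simp only [hω])]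
  simp

lemma volume_roundPoint_fiber {d : ℕ} {h : ℝ} (hh : 0 < h) (k : Fin d → ℤ) :
    (volume : Measure (Space d)).real ((fun y => roundPoint (h⁻¹ • y)) ⁻¹' {k}) = h ^ d := by
  have hset : (fun y : Space d => roundPoint (h⁻¹ • y)) ⁻¹' {k} =
      (WithLp.ofLp : Space d → Fin d → ℝ) ⁻¹'
        (Set.univ.pi fun i => Set.Ico (h * (k i - 1 / 2)) (h * (k i + 1 / 2))) := by
    ext y
    simp only [Set.mem_preimage, Set.mem_singleton_iff, Set.mem_univ_pi, funext_iff, roundPoint,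
      round_eq, Int.floor_eq_iff, Set.mem_Ico, PiLp.smul_apply, smul_eq_mul, inv_mul_eq_div]
    refine forall_congr' fun i => ?_
    have e : y.ofLp i = h * (y.ofLp i / h) := by field_simp
    constructor
    · rintro ⟨h1, h2⟩
      constructor
      · rw [e]; gcongr; linarith
      · rw [e]; gcongr; linarith
    · rintro ⟨h1, h2⟩
      rw [e] at h1 h2
      have h1' := le_of_mul_le_mul_left h1 hh
      have h2' := lt_of_mul_lt_mul_left h2 hh.le
      constructor <;> linarith
  rw [hset, measureReal_def, (PiLp.volume_preserving_ofLp (Fin d)).measure_preimage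
    (MeasurableSet.univ_pi fun i => measurableSet_Ico).nullMeasurableSet, Real.volume_pi_Ico_toReal]
  · have : ∀ i, h * ((k i : ℝ) + 1 / 2) - h * (k i - 1 / 2) = h := fun i => by ring
    simp_rw [this]
    simp
  · intro i
    have : (k i : ℝ) - 1 / 2 ≤ k i + 1 / 2 := by linarith
    simp only
    gcongr

lemma norm_le_card_mul {d : ℕ} {v : Space d} {M : ℝ} (hM : 0 ≤ M) (h : ∀ i, |v i| ≤ M) :
    ‖v‖ ≤ d * M := by
  rw [EuclideanSpace.norm_eq]
  refine Real.sqrt_le_iff.2 ⟨by positivity, ?_⟩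
  have h1 : ∑ i, ‖v i‖ ^ 2 ≤ ∑ _i : Fin d, M ^ 2 := by
    refine Finset.sum_le_sum fun i _ => ?_
    rw [Real.norm_eq_abs]
    have := h i
    gcongr
  refine h1.trans ?_
  simp only [Finset.sum_const, Finset.card_univ, Fintype.card_fin, nsmul_eq_mul]
  rw [mul_pow]
  refine mul_le_mul_of_nonneg_right ?_ (by positivity)
  exact_mod_cast Nat.le_self_pow two_ne_zero d

/-- The nearest point to `y` of the lattice `h ℤ^d`. -/
noncomputable def latticeRound {d : ℕ} (h : ℝ) (y : Space d) : Space d :=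
  h • latticePoint (roundPoint (h⁻¹ • y))

lemma norm_latticeRound_sub_le {d : ℕ} {h : ℝ} (hh : 0 < h) (y : Space d) :
    ‖latticeRound h y - y‖ ≤ d * (h / 2) := by
  refine norm_le_card_mul (by positivity) fun i => ?_
  simp only [latticeRound, latticePoint, roundPoint, PiLp.sub_apply, PiLp.smul_apply, smul_eq_mul]
  have h1 := abs_sub_round (h⁻¹ * y i)
  have e : h * (round (h⁻¹ * y i) : ℝ) - y i = -(h * (h⁻¹ * y i - round (h⁻¹ * y i))) := by
    field_simp; ring
  rw [e, abs_neg, abs_mul, abs_of_pos hh]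
  calc h * |h⁻¹ * y i - round (h⁻¹ * y i)| ≤ h * (1 / 2) := by gcongr
    _ = h / 2 := by ring

lemma one_le_norm_latticePoint {d : ℕ} {k : Fin d → ℤ} (hk : k ≠ 0) : 1 ≤ ‖latticePoint k‖ := by
  obtain ⟨i, hi⟩ := Function.ne_iff.1 hk
  refine le_trans ?_ (PiLp.norm_apply_le (latticePoint k) i)
  have : (1 : ℤ) ≤ |k i| := Int.one_le_abs hi
  simp only [latticePoint, Real.norm_eq_abs]
  exact_mod_cast this

lemma half_le_norm_of_roundPoint_ne_zero {d : ℕ} {h : ℝ} (hh : 0 < h) {y : Space d}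
    (hk : roundPoint (h⁻¹ • y) ≠ 0) : h / 2 ≤ ‖y‖ := by
  obtain ⟨i, hi⟩ := Function.ne_iff.1 hk
  refine le_trans ?_ (PiLp.norm_apply_le y i)
  by_contra! hlt
  rw [Real.norm_eq_abs, abs_lt] at hlt
  refine hi ?_
  simp only [roundPoint, round_eq, PiLp.smul_apply, smul_eq_mul, Pi.zero_apply]
  rw [Int.floor_eq_zero_iff, inv_mul_eq_div]
  have h1 : -(1 / 2) < y i / h := by rw [lt_div_iff₀ hh]; linarith
  have h2 : y i / h < 1 / 2 := by rw [div_lt_iff₀ hh]; linarith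
  constructor <;> linarith

/-- Outside the cell of the origin |y| ≥ h/2 and the rounded point has norm at least h, while
rounding moves y by at most dh/2. The two norms are thus comparable with constant 1 + d,
independently of h. -/
lemma norm_le_mul_norm_latticeRound {d : ℕ} {h : ℝ} (hh : 0 < h) {y : Space d}
    (hk : roundPoint (h⁻¹ • y) ≠ 0) :
    ‖y‖ ≤ (1 + d) * ‖latticeRound h y‖ ∧ ‖latticeRound h y‖ ≤ (1 + d) * ‖y‖ ∧
      0 < ‖y‖ ∧ 0 < ‖latticeRound h y‖ := by
  have h1 := norm_latticeRound_sub_le hh y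
  have h2 := half_le_norm_of_roundPoint_ne_zero hh hk
  have h3 : h ≤ ‖latticeRound h y‖ := by
    rw [latticeRound, norm_smul, Real.norm_of_nonneg hh.le]
    exact le_mul_of_one_le_right hh.le (one_le_norm_latticePoint hk)
  have h4 : ‖y‖ ≤ ‖latticeRound h y‖ + ‖latticeRound h y - y‖ := by
    have := norm_sub_le (latticeRound h y) (latticeRound h y - y)
    rwa [sub_sub_cancel] at this
  have h5 : ‖latticeRound h y‖ ≤ ‖y‖ + ‖latticeRound h y - y‖ := norm_le_norm_add_norm_sub' _ _
  have hd0 : (0 : ℝ) ≤ d := d.cast_nonneg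
  refine ⟨?_, ?_, by linarith, by linarith⟩
  · nlinarith
  · nlinarith

section Riemann

variable {d : ℕ} {ρ : Measure ℝ} [IsFiniteMeasure ρ]

/-! ### Riemann sums against the Lévy density -/

/-- On the cell of the origin the left side is zero because g(0) = 0. Elsewhere rounding changes the
norm by a factor at most 1 + d, so `truncSq` and K each change by a bounded factor. The majorant
does not depend on h, as dominated convergence requires. -/
lemma abs_mul_levyDensity_latticeRound_le (hd : 1 ≤ d) (hρ : ρ (Set.Ioo (0 : ℝ) 2)ᶜ = 0)
    {g : Space d → ℝ} {C : ℝ} (hg : ∀ z, |g z| ≤ C * truncSq z) {h : ℝ} (hh : 0 < h)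
    (y : Space d) :
    |g (latticeRound h y) * levyDensity ρ (latticeRound h y)| ≤
      (C * (1 + d) ^ 2 * (1 + d : ℝ) ^ ((d : ℝ) + 2)) * (truncSq y * levyDensity ρ y) := by
  have hC : 0 ≤ C := by
    have : Nonempty (Fin d) := ⟨⟨0, hd⟩⟩
    obtain ⟨z, hz⟩ := exists_ne (0 : Space d)
    have hz' : 0 < truncSq z := by
      have := norm_pos_iff.2 hz
      unfold truncSq; positivity
    have := (abs_nonneg _).trans (hg z)
    exact nonneg_of_mul_nonneg_left this hz'
  have hK := levyDensity_nonneg hρ y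
  have ht := truncSq_nonneg y
  by_cases hk : roundPoint (h⁻¹ • y) = 0
  · have e : latticeRound h y = 0 := by
      rw [latticeRound, hk]; ext i; simp [latticePoint]
    have hg0 : g (0 : Space d) = 0 := by
      have := hg 0
      simp only [truncSq, norm_zero] at this
      norm_num at this
      exact this
    rw [e, hg0, zero_mul, abs_zero]
    positivity
  · obtain ⟨h1, h2, h3, h4⟩ := norm_le_mul_norm_latticeRound hh hk
    set z := latticeRound h y
    have hKz := levyDensity_nonneg hρ z
    have hc : (1 : ℝ) ≤ 1 + d := by linarith [d.cast_nonneg (α := ℝ)]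
    have hcmp := levyDensity_le_of_norm_le hd hρ hc (norm_pos_iff.1 h3) (norm_pos_iff.1 h4) h1
    have htr : truncSq z ≤ (1 + d) ^ 2 * truncSq y := by
      unfold truncSq
      rw [mul_min_of_nonneg _ _ (by positivity), ← mul_pow]
      refine min_le_min ?_ (by gcongr)
      rw [mul_one]
      exact one_le_pow₀ hc
    rw [abs_mul, abs_of_nonneg hKz]
    calc |g z| * levyDensity ρ z
        ≤ (C * ((1 + d) ^ 2 * truncSq y)) * ((1 + d : ℝ) ^ ((d : ℝ) + 2) * levyDensity ρ y) := by
          refine mul_le_mul ((hg z).trans ?_) hcmp hKz (by positivity)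
          gcongr
      _ = _ := by ring

lemma integrable_mul_levyDensity_latticeRound (hd : 1 ≤ d) (hρ : ρ (Set.Ioo (0 : ℝ) 2)ᶜ = 0)
    {g : Space d → ℝ} {C : ℝ} (hgc : Continuous g) (hg : ∀ z, |g z| ≤ C * truncSq z) {h : ℝ}
    (hh : 0 < h) :
    Integrable fun y : Space d => g (latticeRound h y) * levyDensity ρ (latticeRound h y) := by
  refine ((integrable_truncSq_mul_levyDensity (d := d) hρ).const_mul _).mono' ?_
    (ae_of_all _ fun y => abs_mul_levyDensity_latticeRound_le hd hρ hg hh y)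
  have hm : Measurable (latticeRound (d := d) h) := by
    have h1 : Measurable fun k : Fin d → ℤ => h • latticePoint k := measurable_of_countable _
    exact h1.comp (measurable_roundPoint.comp (measurable_const_smul h⁻¹))
  exact ((hgc.measurable.comp hm).mul
    ((measurable_levyDensity hd hρ).comp hm)).aestronglyMeasurable

/-- The Riemann sum is the integral of a function constant on the cubes of side h around lattice
points, each of volume h^d. -/
lemma hasSum_lattice_mul_levyDensity (hd : 1 ≤ d) (hρ : ρ (Set.Ioo (0 : ℝ) 2)ᶜ = 0)
    {g : Space d → ℝ} {C : ℝ} (hgc : Continuous g) (hg : ∀ z, |g z| ≤ C * truncSq z) {h : ℝ}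
    (hh : 0 < h) :
    HasSum (fun k : Fin d → ℤ =>
      h ^ d * (g (h • latticePoint k) * levyDensity ρ (h • latticePoint k)))
      (∫ y : Space d, g (latticeRound h y) * levyDensity ρ (latticeRound h y)) := by
  have h1 := hasSum_integral_fibers (μ := (volume : Measure (Space d)))
    (r := fun y => roundPoint (h⁻¹ • y))
    (measurable_roundPoint.comp (measurable_const_smul h⁻¹))
    (f := fun k => g (h • latticePoint k) * levyDensity ρ (h • latticePoint k))
    (integrable_mul_levyDensity_latticeRound hd hρ hgc hg hh)
  simp only [volume_roundPoint_fiber hh, smul_eq_mul] at h1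
  exact h1

lemma tendsto_integral_latticeRound (hd : 1 ≤ d) (hρ : ρ (Set.Ioo (0 : ℝ) 2)ᶜ = 0)
    {g : Space d → ℝ} {C : ℝ} (hgc : Continuous g) (hg : ∀ z, |g z| ≤ C * truncSq z) {h : ℕ → ℝ}
    (hh : ∀ᶠ n in atTop, 0 < h n) (hl : Tendsto h atTop (𝓝 0)) :
    Tendsto (fun n => ∫ y : Space d, g (latticeRound (h n) y) * levyDensity ρ (latticeRound (h n) y))
      atTop (𝓝 (∫ y : Space d, g y * levyDensity ρ y)) := by
  refine tendsto_integral_filter_of_dominated_convergence _ ?_ ?_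
    ((integrable_truncSq_mul_levyDensity (d := d) hρ).const_mul
      (C * (1 + d) ^ 2 * (1 + d : ℝ) ^ ((d : ℝ) + 2))) ?_
  · filter_upwards [hh] with n hn
    exact (integrable_mul_levyDensity_latticeRound hd hρ hgc hg hn).1
  · filter_upwards [hh] with n hn
    exact ae_of_all _ fun y => abs_mul_levyDensity_latticeRound_le hd hρ hg hn y
  · filter_upwards [ae_ne_zero hd] with y hy
    have h1 : Tendsto (fun n => latticeRound (h n) y) atTop (𝓝 y) := by
      rw [tendsto_iff_norm_sub_tendsto_zero]
      refine squeeze_zero' (Eventually.of_forall fun n => norm_nonneg _)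
        (hh.mono fun n hn => norm_latticeRound_sub_le hn y) ?_
      simpa using (hl.div_const 2).const_mul (d : ℝ)
    exact ((hgc.tendsto y).comp h1).mul ((continuousAt_levyDensity hd hρ hy).tendsto.comp h1)

end Riemann


/-! ### The random walk -/

section Walk

variable {d : ℕ} {ρ : Measure ℝ}

/-- The jump weight `Q_k(h) / |k|^d`, written with the Lévy density; it vanishes at `k = 0`. -/
noncomputable def jumpWeight (ρ : Measure ℝ) (h : ℝ) (k : Fin d → ℤ) : ℝ :=
  2 * (h ^ d * levyDensity ρ (h • latticePoint k))

lemma latticePoint_zero : latticePoint (0 : Fin d → ℤ) = 0 := by ext i; simp [latticePoint]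

lemma latticePoint_neg (k : Fin d → ℤ) : latticePoint (-k) = -latticePoint k := by
  ext i; simp [latticePoint]

lemma jumpWeight_zero (hd : 1 ≤ d) (hρ : ρ (Set.Ioo (0 : ℝ) 2)ᶜ = 0) (h : ℝ) :
    jumpWeight ρ h (0 : Fin d → ℤ) = 0 := by
  -- Here 0^(d+α) = 0 and division by zero gives 0, so K vanishes at the origin and sums over k ≠ 0
  -- can be extended to all of ℤ^d.
  have h0 : levyDensity ρ (0 : Space d) = 0 := by
    refine integral_eq_zero_of_ae ?_
    filter_upwards [ae_mem_Ioo hρ] with α hα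
    have : (d : ℝ) + α ≠ 0 := by have := hα.1; positivity
    simp [Real.zero_rpow this]
  rw [jumpWeight, latticePoint_zero, smul_zero, h0]; ring

lemma jumpWeight_neg (h : ℝ) (k : Fin d → ℤ) : jumpWeight ρ h (-k) = jumpWeight ρ h k := by
  simp only [jumpWeight, latticePoint_neg, smul_neg, levyDensity, norm_neg]

lemma jumpWeight_nonneg (hρ : ρ (Set.Ioo (0 : ℝ) 2)ᶜ = 0) {h : ℝ} (hh : 0 < h)
    (k : Fin d → ℤ) : 0 ≤ jumpWeight ρ h k := by
  have := levyDensity_nonneg hρ (h • latticePoint k)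
  unfold jumpWeight; positivity

/-- The scaling h^(-α) |k|^(-d-α) = h^d |hk|^(-d-α), integrated over ρ, identifies the jump rates
with the Riemann weights of 2K. -/
lemma Qk_div_eq_jumpWeight {h : ℝ} (hh : 0 < h)
    {k : Fin d → ℤ} (hk : k ≠ 0) : Qk ρ h k / ‖latticePoint k‖ ^ d = jumpWeight ρ h k := by
  have hk0 : 0 < ‖latticePoint k‖ := one_pos.trans_le (one_le_norm_latticePoint hk)
  rw [Qk, jumpWeight, levyDensity, mul_div_assoc, ← integral_const_mul, ← integral_div]
  congr 2; ext α
  rw [norm_smul, Real.norm_of_nonneg hh.le, Real.mul_rpow hh.le hk0.le, Real.rpow_add hh,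
    Real.rpow_add hk0, Real.rpow_natCast, Real.rpow_natCast]
  field_simp

lemma Qsum_eq_tsum_jumpWeight (hd : 1 ≤ d) (hρ : ρ (Set.Ioo (0 : ℝ) 2)ᶜ = 0) {h : ℝ}
    (hh : 0 < h) : Qsum d ρ h = ∑' k : Fin d → ℤ, jumpWeight ρ h k := by
  have e : ∀ m : {m : Fin d → ℤ // m ≠ 0}, Qk ρ h m.1 / ‖latticePoint m.1‖ ^ d =
      jumpWeight ρ h m.1 := fun m => Qk_div_eq_jumpWeight hh m.2
  rw [Qsum, tsum_congr e]
  refine tsum_subtype_eq_of_support_subset (f := jumpWeight ρ h) (s := {m | m ≠ 0}) ?_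
  intro k hk h0
  subst h0
  exact hk (jumpWeight_zero hd hρ h)

lemma stepProb_eq (hρ : ρ (Set.Ioo (0 : ℝ) 2)ᶜ = 0) (hd : 1 ≤ d) (τ : ℝ) {h : ℝ} (hh : 0 < h)
    (k : Fin d → ℤ) : stepProb ρ τ h k =
      (if k = 0 then 1 - τ * Qsum d ρ h else 0) + τ * jumpWeight ρ h k := by
  unfold stepProb
  split_ifs with hk
  · rw [hk, jumpWeight_zero hd hρ, mul_zero, add_zero]
  · rw [Qk_div_eq_jumpWeight hh hk, zero_add]

lemma IsSS.aemeasurable {Ω : Type*} {mΩ : MeasurableSpace Ω} {𝓕 : Filtration ℝ≥0 mΩ}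
    {P : Measure Ω} {Z : ℝ≥0 → Ω → Space d} (hZ : IsSS ρ 𝓕 P Z) (t : ℝ≥0) :
    AEMeasurable (Z t) P :=
  ((hZ.semimartingale.1 t).mono (𝓕.le t)).measurable.aemeasurable

variable [IsFiniteMeasure ρ]

/-- The Riemann sum of `truncSq` times K converges, and at a nonzero lattice point |hk| ≥ h, so
`truncSq` is at least min(1, h²) there. -/
lemma summable_jumpWeight (hd : 1 ≤ d) (hρ : ρ (Set.Ioo (0 : ℝ) 2)ᶜ = 0) {h : ℝ} (hh : 0 < h) :
    Summable (jumpWeight (d := d) ρ h) := by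
  have h1 := (hasSum_lattice_mul_levyDensity (ρ := ρ) (d := d) hd hρ (C := 1) continuous_truncSq
    (fun z => by rw [abs_of_nonneg (truncSq_nonneg z), one_mul]) hh).summable
  refine (h1.mul_left (2 * (min 1 (h ^ 2))⁻¹)).of_nonneg_of_le
    (fun k => jumpWeight_nonneg hρ hh k) fun k => ?_
  by_cases hk : k = 0
  · rw [hk, jumpWeight_zero hd hρ]
    have := levyDensity_nonneg hρ (h • latticePoint (0 : Fin d → ℤ))
    have := truncSq_nonneg (h • latticePoint (0 : Fin d → ℤ))
    positivity
  have hK := levyDensity_nonneg hρ (h • latticePoint k)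
  have hle : min 1 (h ^ 2) ≤ truncSq (h • latticePoint k) := by
    refine min_le_min le_rfl ?_
    rw [norm_smul, Real.norm_of_nonneg hh.le]
    have := le_mul_of_one_le_right hh.le (one_le_norm_latticePoint hk)
    gcongr
  have hpos : 0 < min 1 (h ^ 2) := by positivity
  have h2 : 1 ≤ (min 1 (h ^ 2))⁻¹ * truncSq (h • latticePoint k) := by
    rw [inv_mul_eq_div, one_le_div hpos]; exact hle
  calc jumpWeight ρ h k = 1 * (2 * (h ^ d * levyDensity ρ (h • latticePoint k))) := by
        rw [jumpWeight, one_mul]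
    _ ≤ ((min 1 (h ^ 2))⁻¹ * truncSq (h • latticePoint k)) *
        (2 * (h ^ d * levyDensity ρ (h • latticePoint k))) := by gcongr
    _ = _ := by ring

/-- The exponent of one step of the walk: `∑ (Q_k(h) / |k|^d) (1 - cos(h ξ·k))`. -/
noncomputable def stepExponent (ρ : Measure ℝ) (h : ℝ) (ξ : Space d) : ℝ :=
  ∑' k : Fin d → ℤ, jumpWeight ρ h k * (1 - Real.cos ⟪ξ, h • latticePoint k⟫)

/-- The step exponent is the Riemann sum of 2(1 - cos ξ·y) K(y), whose integral is ψ(ξ). -/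
lemma tendsto_stepExponent (hd : 1 ≤ d) (hρ : ρ (Set.Ioo (0 : ℝ) 2)ᶜ = 0) {h : ℕ → ℝ}
    (hh : ∀ᶠ n in atTop, 0 < h n) (hl : Tendsto h atTop (𝓝 0)) (ξ : Space d) :
    Tendsto (fun n => stepExponent ρ (h n) ξ) atTop (𝓝 (charExponent ρ ξ)) := by
  have hg : ∀ z : Space d, |2 * (1 - Real.cos ⟪ξ, z⟫)| ≤ (2 * (2 + ‖ξ‖ ^ 2)) * truncSq z := by
    intro z
    have := one_sub_cos_le_truncSq ξ z
    rw [abs_of_nonneg (by linarith [Real.cos_le_one ⟪ξ, z⟫])]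
    linarith
  have hgc : Continuous fun z : Space d => 2 * (1 - Real.cos ⟪ξ, z⟫) := by fun_prop
  have h1 := tendsto_integral_latticeRound hd hρ hgc hg hh hl
  rw [integral_one_sub_cos_mul_levyDensity hd hρ] at h1
  refine h1.congr' ?_
  filter_upwards [hh] with n hn
  rw [← (hasSum_lattice_mul_levyDensity hd hρ hgc hg hn).tsum_eq, stepExponent]
  refine tsum_congr fun k => ?_
  rw [jumpWeight]; ring

lemma hasSum_jumpWeight_mul_cexp (hd : 1 ≤ d) (hρ : ρ (Set.Ioo (0 : ℝ) 2)ᶜ = 0) {h : ℝ}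
    (hh : 0 < h) (ξ : Space d) :
    HasSum (fun k : Fin d → ℤ => (jumpWeight ρ h k : ℂ) *
      Complex.exp (((⟪h • latticePoint k, ξ⟫ : ℝ) : ℂ) * Complex.I))
      ((Qsum d ρ h - stepExponent ρ h ξ : ℝ) : ℂ) := by
  have hs := summable_jumpWeight (d := d) hd hρ hh
  have hw := fun k : Fin d → ℤ => jumpWeight_nonneg hρ hh k
  have hb : ∀ f : (Fin d → ℤ) → ℝ, (∀ k, |f k| ≤ 1) →
      Summable fun k => jumpWeight ρ h k * f k := fun f hf =>
    Summable.of_norm_bounded hs fun k => by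
      rw [norm_mul, Real.norm_of_nonneg (hw k)]
      exact mul_le_of_le_one_right (hw k) (hf k)
  have hc := hb (fun k => Real.cos ⟪ξ, h • latticePoint k⟫) fun k => Real.abs_cos_le_one _
  have hsn := hb (fun k => Real.sin ⟪ξ, h • latticePoint k⟫) fun k => Real.abs_sin_le_one _
  have hsin : ∑' k : Fin d → ℤ, jumpWeight ρ h k * Real.sin ⟪ξ, h • latticePoint k⟫ = 0 := by
    have h1 := (Equiv.neg (Fin d → ℤ)).tsum_eq
      fun k => jumpWeight ρ h k * Real.sin ⟪ξ, h • latticePoint k⟫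
    simp only [Equiv.neg_apply, jumpWeight_neg, latticePoint_neg, smul_neg, inner_neg_right,
      Real.sin_neg, mul_neg, tsum_neg] at h1
    linarith
  have hcos : ∑' k : Fin d → ℤ, jumpWeight ρ h k * Real.cos ⟪ξ, h • latticePoint k⟫ =
      Qsum d ρ h - stepExponent ρ h ξ := by
    rw [Qsum_eq_tsum_jumpWeight hd hρ hh, stepExponent]
    simp_rw [mul_sub, mul_one]
    rw [hs.tsum_sub hc]
    ring
  have h1 := (Complex.hasSum_ofReal.2 hc.hasSum).add
    ((Complex.hasSum_ofReal.2 hsn.hasSum).mul_right Complex.I)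
  rw [hsin, hcos, Complex.ofReal_zero, zero_mul, add_zero] at h1
  refine h1.congr_fun fun k => ?_
  rw [Complex.exp_mul_I, real_inner_comm]
  push_cast
  ring

/-- Staying put contributes 1 - τQ and the jumps contribute τ(Q - A), where Q is the total rate and
A the step exponent; the sines cancel by symmetry of the weights. -/
lemma charFun_map_step {Ω : Type*} [MeasurableSpace Ω] {P : Measure Ω} [IsProbabilityMeasure P]
    (hd : 1 ≤ d) (hρ : ρ (Set.Ioo (0 : ℝ) 2)ᶜ = 0) {τ h : ℝ} (hτ : 0 ≤ τ) (hh : 0 < h)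
    (hQ : 2 * τ * Qsum d ρ h ≤ 1) {X : Ω → Space d} (hX : Measurable X)
    (hmem : ∀ᵐ ω ∂P, ∃ k : Fin d → ℤ, X ω = h • latticePoint k)
    (hprob : ∀ k : Fin d → ℤ,
      P {ω | X ω = h • latticePoint k} = ENNReal.ofReal (stepProb ρ τ h k)) (ξ : Space d) :
    charFun (P.map X) ξ = 1 - τ * stepExponent ρ h ξ := by
  let r : Ω → Fin d → ℤ := fun ω => roundPoint (h⁻¹ • X ω)
  have hr : Measurable r := measurable_roundPoint.comp (hX.const_smul h⁻¹)
  have hrX : ∀ᵐ ω ∂P, X ω = h • latticePoint (r ω) := by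
    filter_upwards [hmem] with ω ⟨k, hk⟩
    simp only [r]
    rw [hk, smul_smul, inv_mul_cancel₀ hh.ne', one_smul, roundPoint_latticePoint]
  have hfib : ∀ k, P.real (r ⁻¹' {k}) = stepProb ρ τ h k := by
    intro k
    have hae : r ⁻¹' {k} =ᵐ[P] {ω | X ω = h • latticePoint k} := by
      filter_upwards [hrX] with ω hω
      refine propext ⟨fun hk => ?_, fun hk => ?_⟩
      · have hk : r ω = k := hk
        change X ω = _
        rw [hω, hk]
      · have hk : X ω = h • latticePoint k := hk
        change r ω = k
        simp only [r]
        rw [hk, smul_smul, inv_mul_cancel₀ hh.ne', one_smul, roundPoint_latticePoint]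
    -- The step-size condition enters here: it gives p_0 ≥ 1/2, so `ENNReal.ofReal` loses nothing.
    have hp0 : 0 ≤ stepProb ρ τ h k := by
      rw [stepProb_eq hρ hd τ hh]
      have := mul_nonneg hτ (jumpWeight_nonneg hρ hh k)
      split_ifs <;> linarith
    rw [measureReal_def, measure_congr hae, hprob, ENNReal.toReal_ofReal hp0]
  let f : (Fin d → ℤ) → ℂ := fun k =>
    Complex.exp (((⟪h • latticePoint k, ξ⟫ : ℝ) : ℂ) * Complex.I)
  have hf : Integrable (fun ω => f (r ω)) P := by
    have hm : Measurable fun ω => f (r ω) := (measurable_of_countable f).comp hr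
    refine (integrable_const (1 : ℝ)).mono' hm.aestronglyMeasurable (ae_of_all _ fun ω => ?_)
    exact (Complex.norm_exp_ofReal_mul_I _).le
  have h1 := hasSum_integral_fibers hr hf
  have h2 : ∫ ω, f (r ω) ∂P = charFun (P.map X) ξ := by
    rw [charFun_apply, integral_map hX.aemeasurable (by fun_prop)]
    refine integral_congr_ae ?_
    filter_upwards [hrX] with ω hω
    simp only [f]
    rw [← hω]
  rw [h2] at h1
  have h3 := (hasSum_jumpWeight_mul_cexp hd hρ hh ξ).mul_left (τ : ℂ)
  have h4 : HasSum (fun k : Fin d → ℤ => if k = 0 then ((1 - τ * Qsum d ρ h : ℝ) : ℂ) else 0)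
      ((1 - τ * Qsum d ρ h : ℝ) : ℂ) := hasSum_ite_eq 0 _
  have h5 := h4.add h3
  have h6 := h1.unique (h5.congr_fun fun k => by
    rw [hfib, stepProb_eq hρ hd τ hh, Complex.real_smul]
    split_ifs with hk
    · simp only [f, hk, latticePoint_zero, smul_zero, inner_zero_left, Complex.ofReal_zero,
        zero_mul, Complex.exp_zero]
      push_cast
      ring
    · simp only [f]
      push_cast
      ring)
  rw [h6]
  push_cast
  ring

/-- By independence the characteristic function is (1 - (t/N) A_N)^N with A_N → ψ(ξ), and (1 +
z_N)^N → e^z whenever N z_N → z. -/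
lemma tendsto_charFun_walk (hd : 1 ≤ d) (hρ : ρ (Set.Ioo (0 : ℝ) 2)ᶜ = 0) {t : ℝ} (ht : 0 < t)
    {h : ℕ → ℝ} (hh : ∀ N, 1 ≤ N → 0 < h N) (hl : Tendsto h atTop (𝓝 0))
    (hQ : ∀ N : ℕ, 1 ≤ N → 2 * (t / N) * Qsum d ρ (h N) ≤ 1)
    {Ω : ℕ → Type*} {mΩ : ∀ N, MeasurableSpace (Ω N)} {P : ∀ N, Measure (Ω N)}
    [∀ N, IsProbabilityMeasure (P N)] {X : ∀ N, ℕ → Ω N → Space d}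
    (hX : ∀ N j, Measurable (X N j))
    (hstep : ∀ N : ℕ, 1 ≤ N → IsLatticeSteps ρ (t / N) (h N) (P N) (X N)) (ξ : Space d) :
    Tendsto (fun N => charFun ((P N).map fun ω => ∑ j ∈ Finset.range N, X N j ω) ξ) atTop
      (𝓝 ((Real.exp (-t * charExponent ρ ξ) : ℝ) : ℂ)) := by
  have hev : ∀ᶠ N : ℕ in atTop, 0 < h N := by
    filter_upwards [eventually_ge_atTop 1] with N hN using hh N hN
  have hA := tendsto_stepExponent hd hρ hev hl ξ
  have h1 : Tendsto (fun N : ℕ => (N : ℂ) * (-((t / N : ℝ) : ℂ) * stepExponent ρ (h N) ξ)) atTop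
      (𝓝 ((-t * charExponent ρ ξ : ℝ) : ℂ)) := by
    have h2 : Tendsto (fun N : ℕ => ((-t * stepExponent ρ (h N) ξ : ℝ) : ℂ)) atTop
        (𝓝 ((-t * charExponent ρ ξ : ℝ) : ℂ)) :=
      (Complex.continuous_ofReal.tendsto _).comp (hA.const_mul (-t))
    refine h2.congr' ?_
    filter_upwards [eventually_ge_atTop 1] with N hN
    have : (N : ℂ) ≠ 0 := by exact_mod_cast (by omega : N ≠ 0)
    push_cast
    field_simp
  rw [Complex.ofReal_exp]
  refine (Complex.tendsto_one_add_pow_exp_of_tendsto h1).congr' ?_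
  filter_upwards [eventually_ge_atTop 1] with N hN
  have hs := hstep N hN
  rw [iIndepFun.charFun_map_fun_finsetSum_eq_prod (fun j _ => (hX N j).aemeasurable)
    (hs.indep.restrict _), Finset.prod_apply]
  have e : ∀ j ∈ Finset.range N, charFun ((P N).map (X N j)) ξ =
      1 + -((t / N : ℝ) : ℂ) * stepExponent ρ (h N) ξ := fun j _ => by
    rw [charFun_map_step hd hρ (by positivity) (hh N hN) (hQ N hN) (hX N j) (hs.mem_lattice j)
      (hs.prob j)]
    ring
  rw [Finset.prod_congr rfl e, Finset.prod_const, Finset.card_range]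

lemma tendsto_probabilityMeasure_walk (hd : 1 ≤ d) (hρ : ρ (Set.Ioo (0 : ℝ) 2)ᶜ = 0)
    (hρ0 : ρ ≠ 0) {t : ℝ} (ht : 0 < t) {μ : ℕ → ProbabilityMeasure (Space d)}
    {ν : ProbabilityMeasure (Space d)} (hν : (ν : Measure (Space d)) = kernelMeasure d ρ t)
    (hμ : ∀ ξ, Tendsto (fun N => charFun (μ N : Measure (Space d)) ξ) atTop
      (𝓝 ((Real.exp (-t * charExponent ρ ξ) : ℝ) : ℂ))) : Tendsto μ atTop (𝓝 ν) := by
  refine ProbabilityMeasure.tendsto_of_tendsto_charFun fun ξ => ?_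
  rw [hν, charFun_kernelMeasure hd hρ hρ0 ht]
  exact hμ ξ

lemma IsSS.map_eq {Ω : Type*} {mΩ : MeasurableSpace Ω} {𝓕 : Filtration ℝ≥0 mΩ}
    {P : Measure Ω} [IsProbabilityMeasure P] {Z : ℝ≥0 → Ω → Space d} (hd : 1 ≤ d)
    (hρ : ρ (Set.Ioo (0 : ℝ) 2)ᶜ = 0) (hρ0 : ρ ≠ 0) (hZ : IsSS ρ 𝓕 P Z) {t : ℝ≥0} (ht : 0 < t) :
    P.map (Z t) = kernelMeasure d ρ t := by
  have ht' : (0 : ℝ) < t := ht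
  have := isProbabilityMeasure_kernelMeasure (d := d) hd hρ hρ0 ht'
  have := Measure.isProbabilityMeasure_map (hZ.aemeasurable t)
  refine Measure.ext_of_charFun (funext fun ξ => ?_)
  rw [charFun_kernelMeasure hd hρ hρ0 ht', charFun_apply,
    integral_map (hZ.aemeasurable t) (by fun_prop), Complex.ofReal_exp, neg_mul]
  refine Eq.trans ?_ (hZ.charFun_eq t ξ)
  congr 1; ext ω
  rw [real_inner_comm, mul_comm]

end Walk

end MixedStable

/-! ### The main theorem -/

open MixedStable in
theorem theorem2 {d : ℕ} (hd : 1 ≤ d) (ρ : Measure ℝ) [IsFiniteMeasure ρ]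
    (hρ : ρ (Set.Ioo (0 : ℝ) 2)ᶜ = 0) (hρ0 : ρ ≠ 0) :
    -- the integral defining `G^ρ` converges, is real, and has the stated Fourier transform
    (∀ t : ℝ, 0 < t → ∀ x : Space d,
      Integrable (kernelIntegrand ρ t x) ∧ kernelC ρ t x = ((kernelG ρ t x : ℝ) : ℂ)) ∧
    (∀ t : ℝ, 0 < t → ∀ ξ : Space d,
      ∫ x : Space d, Complex.exp (Complex.I * ((⟪ξ, x⟫ : ℝ) : ℂ)) * ((kernelG ρ t x : ℝ) : ℂ) =
        Complex.exp ((-(t * ∫ α, ‖ξ‖ ^ α ∂ρ) : ℝ) : ℂ)) ∧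
    -- `G^ρ` is the solution of the equation with initial condition `δ_0`
    IsSolution (d := d) ρ (kernelG ρ) ∧
    (∀ u : ℝ → Space d → ℝ, IsSolution ρ u → ∀ t : ℝ, 0 < t → ∀ x, u t x = kernelG ρ t x) ∧
    -- `G^ρ(t,·)` is the probability density of `X^ρ_t`
    (∀ (Ω' : Type*) (mΩ' : MeasurableSpace Ω') (P' : Measure Ω') (_ : IsProbabilityMeasure P')
      (𝓕 : Filtration ℝ≥0 mΩ') (Z : ℝ≥0 → Ω' → Space d), IsSS ρ 𝓕 P' Z →
      ∀ t : ℝ≥0, 0 < t →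
        P'.map (Z t) = volume.withDensity (fun x => ENNReal.ofReal (kernelG ρ t x))) ∧
    -- convergence in law of the random walks with `N` steps, `τ = t / N`, `h = h_N → 0`
    (∀ (t : ℝ≥0), 0 < t → ∀ (h : ℕ → ℝ), (∀ N, 1 ≤ N → 0 < h N) → Tendsto h atTop (𝓝 0) →
      (∀ N : ℕ, 1 ≤ N → 2 * ((t : ℝ) / N) * Qsum d ρ (h N) ≤ 1) →
      ∀ (Ω : ℕ → Type*) (_ : ∀ N, MeasurableSpace (Ω N)) (P : ∀ N, Measure (Ω N))
        (_ : ∀ N, IsProbabilityMeasure (P N)) (X : ∀ N, ℕ → Ω N → Space d),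
      (∀ N j, Measurable (X N j)) →
      (∀ N : ℕ, 1 ≤ N → IsLatticeSteps ρ ((t : ℝ) / N) (h N) (P N) (X N)) →
      -- to the law with density `G^ρ(t,·)`
      (∀ f : BoundedContinuousFunction (Space d) ℝ,
        Tendsto (fun N => ∫ ω, f (∑ j ∈ Finset.range N, X N j ω) ∂(P N)) atTop
          (𝓝 (∫ x, f x * kernelG ρ t x))) ∧
      -- that is, to `X^ρ_t`
      (∀ (Ω' : Type*) (mΩ' : MeasurableSpace Ω') (P' : Measure Ω') (_ : IsProbabilityMeasure P')
        (𝓕 : Filtration ℝ≥0 mΩ') (Z : ℝ≥0 → Ω' → Space d), IsSS ρ 𝓕 P' Z →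
        TendstoInDistribution (fun N ω => ∑ j ∈ Finset.range N, X N j ω) atTop (Z t) P P')) := by
  refine ⟨fun t ht x => ⟨integrable_kernelIntegrand hρ hρ0 ht x, kernelC_eq_kernelG hρ hρ0 ht x⟩,
    fun t ht ξ => ?_, isSolution_kernelG hd hρ hρ0, fun u hu t ht x => hu.eq_kernelG hd hρ hρ0 ht x,
    fun Ω' mΩ' P' _ 𝓕 Z hZ t ht => hZ.map_eq hd hρ hρ0 ht,
    fun t ht h hh hl hQ Ω mΩ P _ X hX hstep => ?_⟩
  · rw [integral_cexp_mul_kernelG hd hρ hρ0 ht, neg_mul]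
    exact Complex.ofReal_exp _
  have ht' : (0 : ℝ) < t := ht
  have hS : ∀ N, AEMeasurable (fun ω => ∑ j ∈ Finset.range N, X N j ω) (P N) := fun N =>
    (Finset.measurable_fun_sum _ fun j _ => hX N j).aemeasurable
  have hchar := tendsto_charFun_walk hd hρ ht' hh hl hQ hX hstep
  refine ⟨fun f => ?_, fun Ω' mΩ' P' _ 𝓕 Z hZ => ?_⟩
  · have hlim := tendsto_probabilityMeasure_walk hd hρ hρ0 ht'
      (μ := fun N => ⟨(P N).map fun ω => ∑ j ∈ Finset.range N, X N j ω,
        Measure.isProbabilityMeasure_map (hS N)⟩)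
      (ν := ⟨kernelMeasure d ρ t, isProbabilityMeasure_kernelMeasure hd hρ hρ0 ht'⟩) rfl hchar
    have h1 := ProbabilityMeasure.tendsto_iff_forall_integral_tendsto.1 hlim f
    simp only [ProbabilityMeasure.coe_mk] at h1
    rw [integral_kernelMeasure hd hρ hρ0 ht'] at h1
    simp_rw [smul_eq_mul, mul_comm _ (f _)] at h1
    refine h1.congr fun N => ?_
    exact integral_map (hS N) f.continuous.aestronglyMeasurable
  · exact ⟨hS, hZ.aemeasurable t,
      tendsto_probabilityMeasure_walk hd hρ hρ0 ht' (hZ.map_eq hd hρ hρ0 ht) hchar⟩
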